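/- Let $F(s)=\sum_{n\ge1}a_nn^{-s}$ be a Dirichlet series, absolutely convergent for $\Re s>1$, such that, for some $k\in\mathbb N$: (a) (i) $(s-1)^kF(s)$ extends to an entire function of finite order; (ii) $a_1=1$ and $a_n\ll_\varepsilon n^\varepsilon$ for every $\varepsilon>0$; (iii) for $\Re s>1$, $F(s)=\prod_pF_p(s)$ with $\log F_p(s)=\sum_{j\ge1}b_{p^j}p^{-js}$, where $b_{p^j}=O(p^{j\theta})$ for some $\theta<1/2$. (b) For every $q\in\mathbb N$ and every Dirichlet character $\chi$ mod $q$, put $F(s,\chi)=\sum_{n\ge1}a_n\chi(n)n^{-s}$ for $\Re s>1$; then $(s-1)^kF(s,\chi)$ again extends to an entire function of finite order. (c) (Lindelöf Hypothesis in the $t$- and $q$-aspects) For every $\varepsilon>0$, $F(\tfrac12+it,\chi)\ll_\varepsilon(|t|q)^\varepsilon$ for all $|t|\ge1$, $q\in\mathbb N$ and characters $\chi$ mod $q$. Moreover, at low height a crude bound holds: there are constants $A,B$ with $|F(\tfrac12+it,\chi)|\le\exp(Bq^A)$ for all $|t|\le1$, $q\in\mathbb N$ and characters $\chi$ mod $q$.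 Let $f:[1,\infty)\to\mathbb R$ be three times continuously differentiable and monotonically increasing such that, for all $x\ge1$, $f(x)\asymp f(2x)$, $f^{(j)}(x)\asymp f(x)/x^j$ for $j=1,2,3$, $f'(x)+xf''(x)\asymp f(x)/x$ and $2f''(x)+xf'''(x)\asymp f(x)/x^2$. Here $g\asymp h$ means $c|h|\le|g|\le C|h|$ with constants $c,C>0$. Fix $\eta>0$ and $\varepsilon>0$. Then, for all $m\in\mathbb N$ and all real $N,N'$ with $1\le N<N'\le2N$ and $N^{1/2+\eta}\le f(N)\le N^{3/2-\eta}$, $$\sum_{\substack{N<n\le N'\\(n,m)=1}}\mu^2(n)\,a_n\,e(f(n))\ll m^\varepsilon N^{19/22+\varepsilon}f(N)^{1/11},$$ where $e(x)=e^{2\pi ix}$, $\mu$ is the Möbius function, and the implied constant depends only on $F$, $f$, $\eta$ and $\varepsilon$ (not on $m,N,N'$). -/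

import Mathlib

/-- `e(x) = exp(2πix)`. -/
noncomputable def expE (x : ℝ) : ℂ := Complex.exp (2 * Real.pi * Complex.I * x)

/-- The entire function `G` has finite order. -/
def FiniteOrder (G : ℂ → ℂ) : Prop :=
  ∃ ρ : ℝ, 0 < ρ ∧ ∃ C : ℝ, ∀ s : ℂ, ‖G s‖ ≤ C * Real.exp (‖s‖ ^ ρ)

/-- `G` is an entire function of finite order which continues
`(s - 1) ^ k * ∑ n ≥ 1, c n * n ^ (-s)` from the half plane `Re s > 1`.
By the identity theorem there is at most one such `G`. -/
structure IsEntireExtension (c : ℕ → ℂ) (k : ℕ) (G : ℂ → ℂ) : Prop where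
  entire : Differentiable ℂ G
  finiteOrder : FiniteOrder G
  eq_of_one_lt_re : ∀ s : ℂ, 1 < s.re → G s = (s - 1) ^ k * LSeries c s

/-- The coefficients `a n * χ n` of the twisted series `F(s, χ)`. -/
noncomputable def twist (a : ℕ → ℂ) {q : ℕ} (χ : DirichletCharacter ℂ q) : ℕ → ℂ :=
  fun n => a n * χ (n : ZMod q)

/-- Euler product: for `Re s > 1`, `F(s) = ∏ p, F_p(s)` where
`log F_p(s) = ∑ j ≥ 1, b (p ^ j) * p ^ (-j s)` and `b (p ^ j) = O(p ^ (j θ))` for some `θ < 1/2`. -/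
def HasEulerProduct (a : ℕ → ℂ) : Prop :=
  ∃ b : ℕ → ℂ, ∃ θ : ℝ, θ < 1 / 2 ∧
    (∃ C : ℝ, ∀ p : ℕ, p.Prime → ∀ j : ℕ, 1 ≤ j → ‖b (p ^ j)‖ ≤ C * (p : ℝ) ^ ((j : ℝ) * θ)) ∧
    ∀ s : ℂ, 1 < s.re →
      HasProd
        (fun p : Nat.Primes => Complex.exp
          (∑' j : ℕ, b ((p : ℕ) ^ (j + 1)) * ((p : ℕ) : ℂ) ^ (-((j + 1 : ℕ) : ℂ) * s)))
        (LSeries a s)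

/-- The conditions on the Dirichlet series `F(s) = ∑ n ≥ 1, a n * n ^ (-s)`; `k` is the exponent for
which `(s - 1) ^ k * F(s)` and `(s - 1) ^ k * F(s, χ)` are entire. If `G` is the entire extension of
`(s - 1) ^ k * F(s, χ)`, then `G s / (s - 1) ^ k` is the continued value `F(s, χ)` for `s ≠ 1`. -/
structure SeriesConditions (a : ℕ → ℂ) (k : ℕ) : Prop where
  summable : ∀ s : ℂ, 1 < s.re → LSeriesSummable a s
  analytic : ∃ G : ℂ → ℂ, IsEntireExtension a k G
  coeff_one : a 1 = 1
  ramanujan : ∀ ε : ℝ, 0 < ε → ∃ C : ℝ, ∀ n : ℕ, 1 ≤ n → ‖a n‖ ≤ C * (n : ℝ) ^ ε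
  eulerProduct : HasEulerProduct a
  analytic_twist : ∀ q : ℕ, 1 ≤ q → ∀ χ : DirichletCharacter ℂ q,
    ∃ G : ℂ → ℂ, IsEntireExtension (twist a χ) k G
  /-- Lindelöf hypothesis in the `t`- and `q`-aspects, `|t| ≥ 1`. -/
  lindelof : ∀ ε : ℝ, 0 < ε → ∃ C : ℝ, ∀ q : ℕ, 1 ≤ q → ∀ χ : DirichletCharacter ℂ q,
    ∀ G : ℂ → ℂ, IsEntireExtension (twist a χ) k G → ∀ t : ℝ, 1 ≤ |t| →
      ‖G (1 / 2 + t * Complex.I) / ((1 / 2 + t * Complex.I) - 1) ^ k‖ ≤ C * (|t| * q) ^ ε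
  /-- At low height only a crude bound `exp (O(q ^ A))`, far weaker than the Lindelöf bound. -/
  lowHeight : ∃ A C : ℝ, ∀ q : ℕ, 1 ≤ q → ∀ χ : DirichletCharacter ℂ q,
    ∀ G : ℂ → ℂ, IsEntireExtension (twist a χ) k G → ∀ t : ℝ, |t| ≤ 1 →
      ‖G (1 / 2 + t * Complex.I) / ((1 / 2 + t * Complex.I) - 1) ^ k‖ ≤
        Real.exp (C * (q : ℝ) ^ A)

/-- `g(x) ≍ h(x)` for all `x ≥ 1`: `|g(x)|` and `|h(x)|` agree up to positive constant factors. -/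
def Comparable (g h : ℝ → ℝ) : Prop :=
  ∃ c C : ℝ, 0 < c ∧ 0 < C ∧ ∀ x : ℝ, 1 ≤ x → c * |h x| ≤ |g x| ∧ |g x| ≤ C * |h x|

/-- The `k`-th derivative of `f` on `[1, ∞)` (one-sided at `1`). -/
noncomputable def derivFromOne (k : ℕ) (f : ℝ → ℝ) : ℝ → ℝ :=
  iteratedDerivWithin k f (Set.Ici 1)

/-- The conditions on the phase function `f : [1, ∞) → ℝ` (values outside `[1, ∞)` play no role). -/
structure PhaseConditions (f : ℝ → ℝ) : Prop where
  contDiff : ContDiffOn ℝ 3 f (Set.Ici 1)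
  monotone : MonotoneOn f (Set.Ici 1)
  doubling : Comparable f (fun x => f (2 * x))
  deriv_comparable : ∀ k : ℕ, 1 ≤ k → k ≤ 3 →
    Comparable (derivFromOne k f) (fun x => f x / x ^ k)
  first_comb : Comparable (fun x => derivFromOne 1 f x + x * derivFromOne 2 f x)
    (fun x => f x / x)
  second_comb : Comparable (fun x => 2 * derivFromOne 2 f x + x * derivFromOne 3 f x)
    (fun x => f x / x ^ 2)

/-! ### Growth inside the strip by a damped Phragmén–Lindelöf argument -/

section StripGrowth

open Complex

/-! On a short block starting at `X` the phase is compared with `A x + B log x`. The choice `B = X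
(f'(X) - A)` makes the first derivative of the remainder vanish at `X`, and its second derivative
there is then `(f'(X) + X f''(X) - A) / X`. So `A` should be a rational `b / q` close to `f'(X) + X
f''(X)`; Dirichlet's theorem gives one within `1 / (q Q)` with `q ≤ Q`. On the block `e(f(n))` is
then `e(b n / q) n ^ (i τ)`, `τ = 2 π B`, times a nearly constant factor (`phase_expansion`,
`exists_rational_approx`), and `|τ| ≍ f(N)`.

The sums of `μ²(n) a_n e(b n / q) n ^ (i τ)` over `n ≤ x` are handled by the Lindelöf hypothesis.
For a single Dirichlet character, moving a smoothed Perron integral to `Re s = 1/2` bounds the sum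
of `a_n χ(n) n ^ (i τ)` by `√x + x / |τ|`, up to ε-powers (`twisted_sum_le`). The pole at `s = 1`
and the crude low-height bound are avoided by moving the line only at heights at least `L q ^ ε`,
where a damped Phragmén–Lindelöf argument makes the low-height bound harmless (`twisted_growth`);
the part left behind produces `x / |τ|`. The restriction to squarefree `n` coprime to `m` is a
Dirichlet convolution of `a` with a multiplicative function whose series converges absolutely for
`Re s > 1/2`, with sum `O(m ^ ε)` (`sum_norm_quotFun_le`); this rests on `θ < 1/2`. The additive
character is expanded in Dirichlet characters with total coefficient mass at most `√q`
(`exists_character_expansion`). As `f(N) ≥ √N`, a block sum is `O(√(q N))`, up to ε-powers.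

Put `S = N ^ (3/2) / f(N)`, and let `R = S ^ (-1/11)` be the saving aimed at. A block of length `h`
saves `R` if `√(q N) ≪ R h` and both phase errors are `O(R)`, that is, `h² ≪ N q Q R` and `h³ f(N) ≪
N³ R`. With `Q ≍ S ^ (3/11)` such an `h` exists for every `q ≤ Q` (`exists_block_length`). Adding up
the blocks gives `N ^ (1 + ε) R = N ^ (19/22 + ε) f(N) ^ (1/11)`. -/

lemma normSq_cos (z : ℂ) : normSq (cos z) = Real.cos z.re ^ 2 + Real.sinh z.im ^ 2 := by
  have h1 : (cos z).re = Real.cos z.re * Real.cosh z.im := by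
    rw [cos_eq z]
    simp [← ofReal_cos, ← ofReal_cosh, ← ofReal_sin, ← ofReal_sinh]
  have h2 : (cos z).im = -(Real.sin z.re * Real.sinh z.im) := by
    rw [cos_eq z]
    simp [← ofReal_cos, ← ofReal_cosh, ← ofReal_sin, ← ofReal_sinh]
  rw [normSq_apply, h1, h2]
  nlinarith [Real.cosh_sq z.im, Real.sin_sq_add_cos_sq z.re]

lemma re_cos (z : ℂ) : (cos z).re = Real.cos z.re * Real.cosh z.im := by
  rw [cos_eq z]
  simp [← ofReal_cos, ← ofReal_cosh, ← ofReal_sin, ← ofReal_sinh]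

lemma half_le_cos_of_abs_le_half {x : ℝ} (hx : |x| ≤ 1 / 2) : 7 / 8 ≤ Real.cos x := by
  have h := Real.one_sub_sq_div_two_le_cos (x := x)
  have : x ^ 2 ≤ 1 / 4 := by
    rw [← sq_abs]; nlinarith [abs_nonneg x]
  linarith

lemma half_cosh_le_norm_cos {z : ℂ} (hz : |z.re| ≤ 1 / 2) :
    Real.cosh z.im / 2 ≤ ‖cos z‖ := by
  have h1 := half_le_cos_of_abs_le_half hz
  have h2 := Real.one_le_cosh z.im
  calc Real.cosh z.im / 2 ≤ (cos z).re := by rw [re_cos]; nlinarith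
    _ ≤ ‖cos z‖ := re_le_norm _

lemma cos_ne_zero_of_abs_re_le_half {z : ℂ} (hz : |z.re| ≤ 1 / 2) : cos z ≠ 0 := by
  have h1 := half_cosh_le_norm_cos hz
  have h2 := Real.one_le_cosh z.im
  intro h
  rw [h, norm_zero] at h1
  linarith

/-- The function `1 / cos` has nonnegative real part on `|Re z| ≤ 1/2`, real part at least `1/2`
where also `|Im z| ≤ 1`, and decays exponentially in `|Im z|`. Hence `exp (-2K / cos z)` never
exceeds `1` in modulus, is at most `exp (-K)` near the real axis, and is harmless high up. -/
lemma inv_cos_re_nonneg {z : ℂ} (hz : |z.re| ≤ 1 / 2) : 0 ≤ ((cos z)⁻¹).re := by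
  rw [inv_re, re_cos]
  have h1 := half_le_cos_of_abs_le_half hz
  have h2 := Real.one_le_cosh z.im
  have := normSq_nonneg (cos z)
  positivity

lemma cosh_one_le : Real.cosh 1 ≤ 7 / 4 := by
  rw [Real.cosh_eq]
  have h1 := Real.exp_one_lt_d9
  have h2 : Real.exp (-1) ≤ 0.5 := by
    rw [Real.exp_neg]
    rw [inv_le_comm₀ (Real.exp_pos 1) (by norm_num)]
    have := Real.exp_one_gt_d9
    norm_num; linarith
  linarith

lemma half_le_inv_cos_re {z : ℂ} (hz : |z.re| ≤ 1 / 2) (hi : |z.im| ≤ 1) :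
    1 / 2 ≤ ((cos z)⁻¹).re := by
  rw [inv_re, re_cos, normSq_cos]
  have h1 := half_le_cos_of_abs_le_half hz
  have h2 := Real.one_le_cosh z.im
  have h3 : Real.cosh z.im ≤ 7 / 4 := by
    refine le_trans ?_ cosh_one_le
    rw [Real.cosh_le_cosh]; simpa using hi
  have h4 := Real.cosh_sq z.im
  have h5 := Real.cos_le_one z.re
  rw [le_div_iff₀ (by positivity)]
  nlinarith

lemma norm_inv_cos_le {z : ℂ} (hz : |z.re| ≤ 1 / 2) : ‖(cos z)⁻¹‖ ≤ 2 / Real.cosh z.im := by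
  have h1 := half_cosh_le_norm_cos hz
  have h2 := Real.cosh_pos z.im
  rw [norm_inv, inv_eq_one_div, div_le_div_iff₀ (by linarith) h2]
  linarith

lemma one_add_abs_le_two_cosh (u : ℝ) : 1 + |u| ≤ 2 * Real.cosh u := by
  rw [← Real.cosh_abs, Real.cosh_eq]
  have := Real.add_one_le_exp |u|
  have := Real.exp_pos (-|u|)
  linarith

/-- Allows `(s - 1) ^ k`, which vanishes inside the strip, to be replaced by the zero-free `(s + 1)
^ k`. -/
lemma norm_sub_one_le_norm_add_one {w : ℂ} (hw : 0 ≤ w.re) : ‖w - 1‖ ≤ ‖w + 1‖ := by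
  rw [Complex.norm_def, Complex.norm_def]
  apply Real.sqrt_le_sqrt
  simp only [normSq_apply, sub_re, add_re, sub_im, add_im, one_re, one_im]
  nlinarith

/-- Turns finite order into the growth `exp (B exp |Im s|)` admitted by Phragmén–Lindelöf; the rate
`1` is allowed because the strip has width at most `1 < π`. -/
lemma rpow_two_add_le_exp {ρ y : ℝ} (hρ : 0 < ρ) (hy : 0 ≤ y) :
    (2 + y) ^ ρ ≤ ρ ^ ρ * Real.exp 2 * Real.exp y := by
  have h1 : (2 + y) / ρ ≤ Real.exp ((2 + y) / ρ) := by
    linarith [Real.add_one_le_exp ((2 + y) / ρ)]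
  have h2 : 2 + y ≤ ρ * Real.exp ((2 + y) / ρ) := by
    rwa [div_le_iff₀' hρ] at h1
  calc (2 + y) ^ ρ ≤ (ρ * Real.exp ((2 + y) / ρ)) ^ ρ :=
        Real.rpow_le_rpow (by positivity) h2 hρ.le
    _ = ρ ^ ρ * Real.exp 2 * Real.exp y := by
        rw [Real.mul_rpow hρ.le (Real.exp_pos _).le, ← Real.exp_mul, div_mul_cancel₀ _ hρ.ne',
          Real.exp_add, mul_assoc]

/-- A Phragmén–Lindelöf bound in the strip `1/2 ≤ Re s ≤ 1 + δ` away from the real axis. The bound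
on the left edge may be as large as `exp K` near the real axis. -/
lemma norm_le_of_strip {G : ℂ → ℂ} (hG : Differentiable ℂ G) (hfo : FiniteOrder G) {k : ℕ}
    {δ ε D K q : ℝ} (hδ : 0 < δ) (hδ' : δ ≤ 1 / 2) (hε : 0 < ε) (hε' : ε ≤ 1) (hD : 0 ≤ D)
    (hK : 0 ≤ K) (hq : 1 ≤ q)
    (hleft : ∀ t : ℝ, 1 ≤ |t| →
      ‖G (1 / 2 + t * I) / ((1 / 2 + t * I) - 1) ^ k‖ ≤ D * (|t| * q) ^ ε)
    (hlow : ∀ t : ℝ, |t| ≤ 1 → ‖G (1 / 2 + t * I) / ((1 / 2 + t * I) - 1) ^ k‖ ≤ Real.exp K)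
    (hright : ∀ s : ℂ, s.re = 1 + δ → ‖G s‖ ≤ D * ‖s - 1‖ ^ k)
    {w : ℂ} (hw1 : 1 / 2 ≤ w.re) (hw2 : w.re ≤ 1 + δ) (hwim : 1 ≤ |w.im|)
    (hwK : 4 * K ≤ Real.cosh w.im) :
    ‖G w / (w - 1) ^ k‖ ≤ 3 ^ k * Real.exp 1 * (4 * (D + 1) * (q * |w.im|) ^ ε) := by
  set M : ℝ := 4 * (D + 1) * (q * |w.im|) ^ ε with hM
  have hqw : 1 ≤ q * |w.im| := by nlinarith
  have hqw' : 1 ≤ (q * |w.im|) ^ ε := Real.one_le_rpow hqw hε.le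
  -- The exponential factor cancels `exp K` on the low part of the left edge. The last factor decays
  -- away from the height of `w`, so it absorbs the growth of `|t| ^ ε` relative to `|Im w| ^ ε`.
  -- All edges are thus bounded by the single constant `M`.
  set Φ : ℂ → ℂ := fun s => G s / (s + 1) ^ k * exp (-(2 * K * (cos (s - 1))⁻¹)) *
    (cos (s - 1 - w.im * I))⁻¹ with hΦ
  have hre1 : ∀ s : ℂ, 1 / 2 ≤ s.re → s.re ≤ 1 + δ → |(s - 1).re| ≤ 1 / 2 := by
    intro s h1 h2
    rw [sub_re, one_re, abs_le]; constructor <;> linarith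
  have hre2 : ∀ s : ℂ, 1 / 2 ≤ s.re → s.re ≤ 1 + δ → |(s - 1 - w.im * I).re| ≤ 1 / 2 := by
    intro s h1 h2
    have := hre1 s h1 h2
    simpa using this
  have hs1 : ∀ s : ℂ, 1 / 2 ≤ s.re → s + 1 ≠ 0 := by
    intro s h1 h
    have := congrArg re h
    simp at this; linarith
  have hexp : ∀ s : ℂ, ‖exp (-(2 * K * (cos (s - 1))⁻¹))‖ =
      Real.exp (-(2 * K * ((cos (s - 1))⁻¹).re)) := by
    intro s
    rw [norm_exp]
    congr 1
    rw [neg_re]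
    have : (2 * (K : ℂ)) = ((2 * K : ℝ) : ℂ) := by push_cast; ring
    rw [this, re_ofReal_mul]
  have hexp1 : ∀ s : ℂ, 1 / 2 ≤ s.re → s.re ≤ 1 + δ →
      ‖exp (-(2 * K * (cos (s - 1))⁻¹))‖ ≤ 1 := by
    intro s h1 h2
    rw [hexp, Real.exp_le_one_iff]
    have := inv_cos_re_nonneg (hre1 s h1 h2)
    have : 0 ≤ 2 * K * ((cos (s - 1))⁻¹).re := by positivity
    linarith
  have hcos2 : ∀ s : ℂ, 1 / 2 ≤ s.re → s.re ≤ 1 + δ → ‖(cos (s - 1 - w.im * I))⁻¹‖ ≤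
      2 / Real.cosh (s.im - w.im) := by
    intro s h1 h2
    simpa using norm_inv_cos_le (hre2 s h1 h2)
  have hcos2' : ∀ s : ℂ, 1 / 2 ≤ s.re → s.re ≤ 1 + δ → ‖(cos (s - 1 - w.im * I))⁻¹‖ ≤ 2 := by
    intro s h1 h2
    refine (hcos2 s h1 h2).trans ?_
    rw [div_le_iff₀ (Real.cosh_pos _)]
    linarith [Real.one_le_cosh (s.im - w.im)]
  have hdiff : DifferentiableOn ℂ Φ {s | 1 / 2 ≤ s.re ∧ s.re ≤ 1 + δ} := by
    intro s hs
    apply DifferentiableAt.differentiableWithinAt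
    have c1 := cos_ne_zero_of_abs_re_le_half (hre1 s hs.1 hs.2)
    have c2 := cos_ne_zero_of_abs_re_le_half (hre2 s hs.1 hs.2)
    have c3 : (s + 1) ^ k ≠ 0 := pow_ne_zero _ (hs1 s hs.1)
    have d1 : DifferentiableAt ℂ (fun s => (cos (s - 1))⁻¹) s := by
      have d0 : DifferentiableAt ℂ (fun s => cos (s - 1)) s := by fun_prop
      exact d0.fun_inv c1
    have d2 : DifferentiableAt ℂ (fun s => (cos (s - 1 - w.im * I))⁻¹) s := by
      have d0 : DifferentiableAt ℂ (fun s => cos (s - 1 - w.im * I)) s := by fun_prop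
      exact d0.fun_inv c2
    have d3 : DifferentiableAt ℂ (fun s => G s / (s + 1) ^ k) s := by
      apply DifferentiableAt.div (hG s) _ c3
      fun_prop
    exact (d3.mul (((d1.const_mul (2 * (K : ℂ))).neg).cexp)).mul d2
  have hclos : closure (re ⁻¹' Set.Ioo (1 / 2 : ℝ) (1 + δ)) ⊆
      {s | 1 / 2 ≤ s.re ∧ s.re ≤ 1 + δ} := by
    apply closure_minimal
    · intro s hs; exact ⟨hs.1.le, hs.2.le⟩
    · exact (isClosed_le continuous_const continuous_re).inter
        (isClosed_le continuous_re continuous_const)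
  have hquot : ∀ s : ℂ, 1 / 2 ≤ s.re → ∀ B, 0 ≤ B → ‖G s‖ ≤ B * ‖s - 1‖ ^ k →
      ‖G s / (s + 1) ^ k‖ ≤ B := by
    intro s h1 B hB h
    have hp : 0 < ‖s + 1‖ := norm_pos_iff.mpr (hs1 s h1)
    rw [norm_div, norm_pow, div_le_iff₀ (by positivity)]
    refine h.trans ?_
    gcongr
    exact norm_sub_one_le_norm_add_one (by linarith)
  have hFG : ∀ s : ℂ, s ≠ 1 → ∀ B, ‖G s / (s - 1) ^ k‖ ≤ B → ‖G s‖ ≤ B * ‖s - 1‖ ^ k := by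
    intro s hs B h
    have hp : 0 < ‖s - 1‖ := norm_pos_iff.mpr (sub_ne_zero.mpr hs)
    rwa [norm_div, norm_pow, div_le_iff₀ (by positivity)] at h
  have key : ‖Φ w‖ ≤ M := by
    refine PhragmenLindelof.vertical_strip (a := 1 / 2) (b := 1 + δ) (C := M) (f := Φ) (z := w)
      (hdiff.mono hclos).diffContOnCl ?_ ?_ ?_ hw1 hw2
    · obtain ⟨ρ, hρ, C, hC⟩ := hfo
      refine ⟨1, ?_, ρ ^ ρ * Real.exp 2, ?_⟩
      · rw [lt_div_iff₀ (by linarith)]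
        linarith [Real.pi_gt_three]
      · refine Asymptotics.IsBigO.of_bound (|C| * 2) ?_
        rw [Filter.eventually_inf_principal]
        filter_upwards with s hs
        have h1 : 1 / 2 ≤ s.re := hs.1.le
        have h2 : s.re ≤ 1 + δ := hs.2.le
        have hn : ‖s‖ ≤ 2 + |s.im| := by
          refine (norm_le_abs_re_add_abs_im s).trans ?_
          rw [abs_of_nonneg (by linarith)]
          linarith
        have hden : 1 ≤ ‖s + 1‖ := by
          refine le_trans ?_ (re_le_norm _)
          simp; linarith
        have hg : ‖G s / (s + 1) ^ k‖ ≤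
            |C| * Real.exp (ρ ^ ρ * Real.exp 2 * Real.exp (1 * |s.im|)) := by
          rw [norm_div, norm_pow]
          refine (div_le_self (norm_nonneg _) (one_le_pow₀ hden)).trans ?_
          refine (hC s).trans ?_
          gcongr
          · exact le_abs_self C
          · rw [one_mul]
            refine le_trans ?_ (rpow_two_add_le_exp hρ (abs_nonneg _))
            exact Real.rpow_le_rpow (norm_nonneg _) hn hρ.le
        rw [hΦ]
        simp only [norm_mul]
        rw [Real.norm_of_nonneg (Real.exp_pos _).le]
        calc _ ≤ |C| * Real.exp (ρ ^ ρ * Real.exp 2 * Real.exp (1 * |s.im|)) * 1 * 2 := by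
              gcongr
              · exact hexp1 s h1 h2
              · exact hcos2' s h1 h2
          _ = _ := by ring
    · intro s hs
      have h1 : 1 / 2 ≤ s.re := hs.ge
      have h2 : s.re ≤ 1 + δ := by linarith
      have hseq : s = 1 / 2 + (s.im : ℂ) * I := by
        apply Complex.ext <;> simp [hs]
      have hs1' : s ≠ 1 := by
        intro h; rw [h] at hs; norm_num at hs
      rw [hΦ]
      simp only [norm_mul]
      rcases le_total |s.im| 1 with hc | hc
      · have hb := hlow s.im hc
        rw [← hseq] at hb
        have hb1 := hquot s h1 _ (Real.exp_pos _).le (hFG s hs1' _ hb)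
        have hb2 : ‖exp (-(2 * K * (cos (s - 1))⁻¹))‖ ≤ Real.exp (-K) := by
          rw [hexp, Real.exp_le_exp]
          have := half_le_inv_cos_re (hre1 s h1 h2) (by simpa using hc)
          nlinarith
        calc _ ≤ Real.exp K * Real.exp (-K) * 2 := by
              gcongr
              exact hcos2' s h1 h2
          _ = 2 := by rw [← Real.exp_add]; simp
          _ ≤ M := by rw [hM]; nlinarith
      · have hb := hleft s.im hc
        rw [← hseq] at hb
        have hb1 := hquot s h1 _ (by positivity) (hFG s hs1' _ hb)
        have hb3 : (|s.im| * q) ^ ε ≤ (q * |w.im|) ^ ε * (2 * Real.cosh (s.im - w.im)) := by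
          have e1 : |s.im| ≤ |w.im| * (1 + |s.im - w.im|) := by
            have : |s.im| ≤ |s.im - w.im| + |w.im| := by
              simpa using abs_add_le (s.im - w.im) w.im
            nlinarith [abs_nonneg (s.im - w.im)]
          calc (|s.im| * q) ^ ε ≤ ((q * |w.im|) * (1 + |s.im - w.im|)) ^ ε := by
                apply Real.rpow_le_rpow (by positivity) _ hε.le
                nlinarith
            _ = (q * |w.im|) ^ ε * (1 + |s.im - w.im|) ^ ε := by
                rw [Real.mul_rpow (by positivity) (by positivity)]
            _ ≤ (q * |w.im|) ^ ε * (1 + |s.im - w.im|) := by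
                gcongr
                calc (1 + |s.im - w.im|) ^ ε ≤ (1 + |s.im - w.im|) ^ (1 : ℝ) :=
                      Real.rpow_le_rpow_of_exponent_le (by linarith [abs_nonneg (s.im - w.im)]) hε'
                  _ = _ := Real.rpow_one _
            _ ≤ _ := by
                gcongr
                exact one_add_abs_le_two_cosh _
        have hch := Real.cosh_pos (s.im - w.im)
        calc _ ≤ D * (|s.im| * q) ^ ε * 1 * (2 / Real.cosh (s.im - w.im)) := by
              gcongr
              · exact hexp1 s h1 h2
              · exact hcos2 s h1 h2
          _ ≤ D * ((q * |w.im|) ^ ε * (2 * Real.cosh (s.im - w.im))) * 1 *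
              (2 / Real.cosh (s.im - w.im)) := by gcongr
          _ = 4 * D * (q * |w.im|) ^ ε := by field_simp; ring
          _ ≤ M := by rw [hM]; gcongr; linarith
    · intro s hs
      have h1 : 1 / 2 ≤ s.re := by linarith
      have h2 : s.re ≤ 1 + δ := hs.le
      rw [hΦ]
      simp only [norm_mul]
      calc _ ≤ D * 1 * 2 := by
            gcongr
            · exact hquot s h1 D hD (hright s hs)
            · exact hexp1 s h1 h2
            · exact hcos2' s h1 h2
        _ ≤ M := by rw [hM]; nlinarith
  have hw1' : w - 1 ≠ 0 := by
    intro h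
    have := congrArg im h
    simp at this
    rw [this] at hwim; norm_num at hwim
  have hpw : 0 < ‖w - 1‖ := norm_pos_iff.mpr hw1'
  have hpw1 : 1 ≤ ‖w - 1‖ := by
    refine hwim.trans ?_
    have := abs_im_le_norm (w - 1)
    simpa using this
  have hqw3 : ‖w + 1‖ ≤ 3 * ‖w - 1‖ := by
    calc ‖w + 1‖ = ‖(w - 1) + 2‖ := by ring_nf
      _ ≤ ‖w - 1‖ + ‖(2 : ℂ)‖ := norm_add_le _ _
      _ ≤ _ := by simp; linarith
  have hcw : ‖cos (w - 1 - w.im * I)‖ ≤ 1 := by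
    have : w - 1 - w.im * I = ((w.re - 1 : ℝ) : ℂ) := by
      apply Complex.ext <;> simp
    rw [this, ← ofReal_cos, norm_real]
    exact Real.abs_cos_le_one _
  have hew : ‖exp (2 * K * (cos (w - 1))⁻¹)‖ ≤ Real.exp 1 := by
    rw [norm_exp, Real.exp_le_exp]
    refine (re_le_norm _).trans ?_
    have h1 := norm_inv_cos_le (hre1 w hw1 hw2)
    rw [norm_mul, norm_mul, norm_real, Real.norm_of_nonneg hK]
    have e : (w - 1).im = w.im := by simp
    rw [e] at h1
    calc ‖(2 : ℂ)‖ * K * ‖(cos (w - 1))⁻¹‖ ≤ 2 * K * (2 / Real.cosh w.im) := by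
          simp only [Complex.norm_ofNat]
          gcongr
      _ = 4 * K / Real.cosh w.im := by ring
      _ ≤ 1 := by rw [div_le_one (Real.cosh_pos _)]; exact hwK
  -- Undoing the factors at `w` costs only a constant: at most `e` for the damping because `4K ≤
  -- cosh (Im w)`, at most `1` for a cosine at a real argument, and at most `3 ^ k` for replacing `w
  -- + 1` by `w - 1`.
  have hfac : G w / (w - 1) ^ k = Φ w * exp (2 * K * (cos (w - 1))⁻¹) *
      cos (w - 1 - w.im * I) * ((w + 1) / (w - 1)) ^ k := by
    have c2 := cos_ne_zero_of_abs_re_le_half (hre2 w hw1 hw2)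
    have c3 := hs1 w hw1
    rw [hΦ]
    simp only [exp_neg]
    have c4 := exp_ne_zero (2 * K * (cos (w - 1))⁻¹)
    rw [div_pow]
    field_simp
  rw [hfac]
  simp only [norm_mul, norm_pow, norm_div]
  calc _ ≤ M * Real.exp 1 * 1 * 3 ^ k := by
        gcongr
        rw [div_le_iff₀ hpw]; exact hqw3
    _ = _ := by ring

end StripGrowth

/-! ### Growth of the twisted series, uniformly in the modulus -/

section TwistedGrowth

lemma norm_LSeries_twist_le {a : ℕ → ℂ} {s : ℂ} {σ : ℝ} (hs : s.re = σ)
    (ha : LSeriesSummable a σ) {q : ℕ} (χ : DirichletCharacter ℂ q) :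
    ‖LSeries (twist a χ) s‖ ≤ ∑' n, ‖LSeries.term a σ n‖ := by
  have h1 : ∀ n, ‖LSeries.term (twist a χ) s n‖ ≤ ‖LSeries.term a σ n‖ := by
    intro n
    rw [LSeries.norm_term_eq, LSeries.norm_term_eq]
    split_ifs with h
    · exact le_rfl
    · rw [hs, Complex.ofReal_re, twist, norm_mul]
      gcongr
      exact mul_le_of_le_one_right (norm_nonneg _) (DirichletCharacter.norm_le_one χ _)
  exact tsum_of_norm_bounded (ha.norm.hasSum) h1

lemma LSeriesSummable_twist {a : ℕ → ℂ} {s : ℂ} (ha : LSeriesSummable a s) {q : ℕ}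
    (χ : DirichletCharacter ℂ q) : LSeriesSummable (twist a χ) s := by
  refine Summable.of_norm_bounded ha.norm fun n => ?_
  rw [LSeries.norm_term_eq, LSeries.norm_term_eq]
  split_ifs with h
  · exact le_rfl
  · rw [twist, norm_mul]
    gcongr
    exact mul_le_of_le_one_right (norm_nonneg _) (DirichletCharacter.norm_le_one χ _)

/-- A low-height bound `exp K` with `K = |C₂| q ^ |A|` is forgotten once `cosh (Im w) ≥ 4K`, i.e. at
heights of order `log q`. So a starting height `L q ^ ε` is ample. On the right edge all twists are
dominated by the series of the `|a n|`. -/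
lemma twisted_growth {a : ℕ → ℂ} {k : ℕ} (ha : SeriesConditions a k) {ε δ : ℝ} (hε : 0 < ε)
    (hε' : ε ≤ 1) (hδ : 0 < δ) (hδ' : δ ≤ 1 / 2) :
    ∃ C L : ℝ, 0 < C ∧ 1 ≤ L ∧ ∀ q : ℕ, 1 ≤ q → ∀ χ : DirichletCharacter ℂ q,
      ∀ G : ℂ → ℂ, IsEntireExtension (twist a χ) k G → ∀ w : ℂ, 1 / 2 ≤ w.re → w.re ≤ 1 + δ →
        L * (q : ℝ) ^ ε ≤ |w.im| → ‖G w / (w - 1) ^ k‖ ≤ C * (q * |w.im|) ^ ε := by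
  obtain ⟨C₁, hC₁⟩ := ha.lindelof ε hε
  obtain ⟨A, C₂, hC₂⟩ := ha.lowHeight
  have hsum : LSeriesSummable a ((1 + δ : ℝ) : ℂ) := ha.summable _ (by simp [hδ])
  set B := ∑' n, ‖LSeries.term a ((1 + δ : ℝ) : ℂ) n‖ with hB
  have hB0 : 0 ≤ B := tsum_nonneg fun _ => norm_nonneg _
  set D := |C₁| + B with hD
  have hD0 : 0 ≤ D := by positivity
  -- In the threshold, `8 |C₂|` comes from `8 |C₂| ≤ exp (8 |C₂|)` and `|A| / ε` from `log q ≤ q ^ ε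
  -- / ε`; together they give `8K ≤ exp |Im w| ≤ 2 cosh (Im w)`.
  refine ⟨3 ^ k * Real.exp 1 * (4 * (D + 1)), 8 * |C₂| + |A| / ε + 1, by positivity, ?_, ?_⟩
  · have : 0 ≤ 8 * |C₂| + |A| / ε := by positivity
    linarith
  intro q hq χ G hG w hw1 hw2 hwim
  have hq1 : (1 : ℝ) ≤ q := by exact_mod_cast hq
  have hqε : 1 ≤ (q : ℝ) ^ ε := Real.one_le_rpow hq1 hε.le
  have hL : 8 * |C₂| + |A| / ε * (q : ℝ) ^ ε + 1 ≤ |w.im| := by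
    refine le_trans ?_ hwim
    have : 0 ≤ |C₂| := abs_nonneg _
    nlinarith
  have hpos1 : 0 ≤ 8 * |C₂| := by positivity
  have hpos2 : 0 ≤ |A| / ε * (q : ℝ) ^ ε := by positivity
  have := norm_le_of_strip hG.entire hG.finiteOrder (k := k) (K := |C₂| * (q : ℝ) ^ |A|) (D := D)
    (q := q) hδ hδ' hε hε' hD0 (by positivity) hq1 ?_ ?_ ?_ hw1 hw2 ?_ ?_
  · refine this.trans (le_of_eq (by ring))
  · intro t ht
    refine (hC₁ q hq χ G hG t ht).trans ?_
    gcongr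
    exact (le_abs_self _).trans (by linarith)
  · intro t ht
    refine (hC₂ q hq χ G hG t ht).trans ?_
    rw [Real.exp_le_exp]
    refine mul_le_mul (le_abs_self _) ?_ (by positivity) (abs_nonneg _)
    exact Real.rpow_le_rpow_of_exponent_le hq1 (le_abs_self _)
  · intro s hs
    rw [hG.eq_of_one_lt_re s (by linarith), norm_mul, norm_pow, mul_comm]
    gcongr
    refine (norm_LSeries_twist_le hs hsum χ).trans ?_
    linarith [abs_nonneg C₁]
  · linarith
  · have h1 : (q : ℝ) ^ |A| ≤ Real.exp (|A| / ε * (q : ℝ) ^ ε) := by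
      rw [Real.rpow_def_of_pos (by linarith), Real.exp_le_exp]
      have := Real.log_le_rpow_div (x := q) (by linarith) hε
      calc Real.log q * |A| ≤ (q : ℝ) ^ ε / ε * |A| := by gcongr
        _ = _ := by ring
    have h2 : 8 * |C₂| ≤ Real.exp (8 * |C₂|) := by linarith [Real.add_one_le_exp (8 * |C₂|)]
    have h3 : 8 * (|C₂| * (q : ℝ) ^ |A|) ≤ Real.exp |w.im| := by
      calc 8 * (|C₂| * (q : ℝ) ^ |A|) = 8 * |C₂| * (q : ℝ) ^ |A| := by ring
        _ ≤ Real.exp (8 * |C₂|) * Real.exp (|A| / ε * (q : ℝ) ^ ε) := by gcongr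
        _ = Real.exp (8 * |C₂| + |A| / ε * (q : ℝ) ^ ε) := by rw [Real.exp_add]
        _ ≤ Real.exp |w.im| := by rw [Real.exp_le_exp]; linarith
    rw [← Real.cosh_abs, Real.cosh_eq]
    have := Real.exp_pos (-|w.im|)
    linarith

end TwistedGrowth

/-! ### Shifting a vertical line away from the real axis -/

section Contour

open Complex MeasureTheory

lemma norm_vertical_integral_le {Ψ : ℂ → ℂ} {σ₁ σ₂ v₁ v₂ H₁ H₂ : ℝ} (hσ : σ₁ ≤ σ₂)
    (hΨ : DifferentiableOn ℂ Ψ (Set.uIcc σ₁ σ₂ ×ℂ Set.uIcc v₁ v₂))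
    (h₁ : ∀ x ∈ Set.Icc σ₁ σ₂, ‖Ψ (x + v₁ * I)‖ ≤ H₁)
    (h₂ : ∀ x ∈ Set.Icc σ₁ σ₂, ‖Ψ (x + v₂ * I)‖ ≤ H₂) :
    ‖∫ v in v₁..v₂, Ψ (σ₂ + v * I)‖ ≤
      ‖∫ v in v₁..v₂, Ψ (σ₁ + v * I)‖ + H₁ * (σ₂ - σ₁) + H₂ * (σ₂ - σ₁) := by
  have h := integral_boundary_rect_eq_zero_of_differentiableOn Ψ (σ₁ + v₁ * I) (σ₂ + v₂ * I)
    (by simpa using hΨ)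
  simp only [add_re, ofReal_re, mul_re, I_re, mul_zero, ofReal_im, I_im, mul_one, sub_self,
    add_zero, add_im, mul_im, zero_add, smul_eq_mul] at h
  have b₁ : ‖∫ x in σ₁..σ₂, Ψ (x + v₁ * I)‖ ≤ H₁ * (σ₂ - σ₁) := by
    rw [← abs_of_nonneg (sub_nonneg.mpr hσ)]
    apply intervalIntegral.norm_integral_le_of_norm_le_const
    intro x hx
    rw [Set.uIoc_of_le hσ] at hx
    exact h₁ x ⟨hx.1.le, hx.2⟩
  have b₂ : ‖∫ x in σ₁..σ₂, Ψ (x + v₂ * I)‖ ≤ H₂ * (σ₂ - σ₁) := by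
    rw [← abs_of_nonneg (sub_nonneg.mpr hσ)]
    apply intervalIntegral.norm_integral_le_of_norm_le_const
    intro x hx
    rw [Set.uIoc_of_le hσ] at hx
    exact h₂ x ⟨hx.1.le, hx.2⟩
  set J₁ := ∫ x in σ₁..σ₂, Ψ (x + v₁ * I)
  set J₂ := ∫ x in σ₁..σ₂, Ψ (x + v₂ * I)
  set V₁ := ∫ v in v₁..v₂, Ψ (σ₁ + v * I)
  set V₂ := ∫ v in v₁..v₂, Ψ (σ₂ + v * I)
  have e : I * V₂ = I * V₁ - J₁ + J₂ := by linear_combination h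
  calc ‖V₂‖ = ‖I * V₂‖ := by simp
    _ ≤ ‖I * V₁‖ + ‖J₁‖ + ‖J₂‖ := by
        rw [e]
        exact (norm_add_le _ _).trans (by gcongr; exact norm_sub_le _ _)
    _ ≤ _ := by
        have : ‖I * V₁‖ = ‖V₁‖ := by simp
        linarith

/-- Moving the part `|Im w| ≥ v₀` of a vertical line from `Re w = σ₂` to `Re w = σ₁`. -/
lemma norm_integral_le_of_shift {Ψ : ℂ → ℂ} {σ₁ σ₂ v₀ T₀ H M : ℝ} {g : ℝ → ℝ} (hσ : σ₁ ≤ σ₂)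
    (hv₀ : 0 < v₀)
    (hΨ : DifferentiableOn ℂ Ψ {w | w.im ≠ 0 ∧ σ₁ ≤ w.re ∧ w.re ≤ σ₂})
    (hint : Integrable fun v : ℝ => Ψ (σ₂ + v * I))
    (hg : Integrable g) (hg0 : ∀ v, 0 ≤ g v)
    (hleft : ∀ v : ℝ, v₀ ≤ |v| → ‖Ψ (σ₁ + v * I)‖ ≤ g v)
    (hhor : ∀ v : ℝ, |v| = v₀ ∨ T₀ ≤ |v| → ∀ x ∈ Set.Icc σ₁ σ₂, ‖Ψ (x + v * I)‖ ≤ H)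
    (hmid : ∀ v : ℝ, |v| ≤ v₀ → ‖Ψ (σ₂ + v * I)‖ ≤ M) :
    ‖∫ v : ℝ, Ψ (σ₂ + v * I)‖ ≤ 2 * v₀ * M + 4 * H * (σ₂ - σ₁) + 2 * ∫ v, g v := by
  have hlim := intervalIntegral_tendsto_integral hint Filter.tendsto_neg_atTop_atBot
    Filter.tendsto_id
  refine le_of_tendsto hlim.norm ?_
  filter_upwards [Filter.eventually_ge_atTop T₀, Filter.eventually_ge_atTop v₀] with T hT hTv
  simp only [id]
  have hT0 : 0 < T := hv₀.trans_le hTv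
  have hii : ∀ a b : ℝ, IntervalIntegrable (fun v : ℝ => Ψ (σ₂ + v * I)) volume a b :=
    fun a b => hint.intervalIntegrable
  rw [← intervalIntegral.integral_add_adjacent_intervals (hii (-T) (-v₀)) (hii (-v₀) T),
    ← intervalIntegral.integral_add_adjacent_intervals (hii (-v₀) v₀) (hii v₀ T)]
  have hmidb : ‖∫ v in -v₀..v₀, Ψ (σ₂ + v * I)‖ ≤ 2 * v₀ * M := by
    refine (intervalIntegral.norm_integral_le_of_norm_le_const (C := M) ?_).trans ?_
    · intro x hx
      rw [Set.uIoc_of_le (by linarith)] at hx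
      exact hmid x (abs_le.mpr ⟨hx.1.le, hx.2⟩)
    · rw [abs_of_pos (by linarith)]
      exact le_of_eq (by ring)
  have hside : ∀ u₁ u₂ : ℝ, u₁ ≤ u₂ → (∀ v ∈ Set.Icc u₁ u₂, v₀ ≤ |v|) →
      (|u₁| = v₀ ∨ T₀ ≤ |u₁|) → (|u₂| = v₀ ∨ T₀ ≤ |u₂|) →
      ‖∫ v in u₁..u₂, Ψ (σ₂ + v * I)‖ ≤ (∫ v, g v) + H * (σ₂ - σ₁) + H * (σ₂ - σ₁) := by
    intro u₁ u₂ hu hu0 h1 h2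
    refine (norm_vertical_integral_le hσ ?_ (hhor u₁ h1) (hhor u₂ h2)).trans ?_
    · refine hΨ.mono ?_
      intro w hw
      rw [mem_reProdIm, Set.uIcc_of_le hσ, Set.uIcc_of_le hu] at hw
      refine ⟨?_, hw.1.1, hw.1.2⟩
      intro h0
      have := hu0 _ hw.2
      rw [h0, abs_zero] at this
      linarith
    · gcongr
      refine (intervalIntegral.norm_integral_le_of_norm_le (g := g) hu ?_
        hg.intervalIntegrable).trans ?_
      · refine Filter.Eventually.of_forall fun v hv => hleft v (hu0 v ⟨hv.1.le, hv.2⟩)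
      · rw [intervalIntegral.integral_of_le hu]
        exact setIntegral_le_integral hg (Filter.Eventually.of_forall hg0)
  have hs1 := hside (-T) (-v₀) (by linarith) (by
    intro v hv
    have : v < 0 := by linarith [hv.2]
    rw [abs_of_neg this]; linarith [hv.2]) (by rw [abs_neg, abs_of_pos hT0]; exact Or.inr hT)
    (by rw [abs_neg, abs_of_pos hv₀]; exact Or.inl rfl)
  have hs2 := hside v₀ T hTv (by
    intro v hv
    have : 0 < v := by linarith [hv.1]
    rw [abs_of_pos this]; exact hv.1) (by rw [abs_of_pos hv₀]; exact Or.inl rfl)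
    (by rw [abs_of_pos hT0]; exact Or.inr hT)
  calc _ ≤ _ := norm_add_le _ _
    _ ≤ _ := add_le_add_right (norm_add_le _ _) _
    _ ≤ _ := by linarith

end Contour

/-! ### A smoothed Perron formula -/

section Perron

open Complex MeasureTheory

lemma one_add_sq_le_norm_mul {σ : ℝ} (hσ : 1 ≤ σ) (v : ℝ) :
    1 + v ^ 2 ≤ ‖(σ + v * I : ℂ)‖ * ‖(σ + v * I + 1 : ℂ)‖ := by
  have h1 : 1 + v ^ 2 ≤ ‖(σ + v * I : ℂ)‖ ^ 2 := by
    rw [Complex.sq_norm, normSq_apply]; simp; nlinarith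
  have h2 : ‖(σ + v * I : ℂ)‖ ≤ ‖(σ + v * I + 1 : ℂ)‖ := by
    rw [Complex.norm_def, Complex.norm_def]
    apply Real.sqrt_le_sqrt
    rw [normSq_apply, normSq_apply]; simp; nlinarith
  nlinarith [norm_nonneg (σ + v * I : ℂ)]

lemma norm_cesaro_kernel_le {σ : ℝ} (hσ : 1 ≤ σ) {y : ℝ} (hy : 0 < y) (v : ℝ) :
    ‖(y : ℂ) ^ (σ + v * I + 1) / ((σ + v * I) * (σ + v * I + 1))‖ ≤
      y ^ (σ + 1) * (1 + v ^ 2)⁻¹ := by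
  have h := one_add_sq_le_norm_mul hσ v
  have h0 : 0 < 1 + v ^ 2 := by positivity
  rw [norm_div, norm_mul, norm_cpow_eq_rpow_re_of_pos hy, div_eq_mul_inv]
  have : (σ + v * I + 1 : ℂ).re = σ + 1 := by simp
  rw [this]
  gcongr

lemma continuous_cesaro_kernel {σ : ℝ} (hσ : 1 ≤ σ) {y : ℝ} (hy : 0 < y) :
    Continuous fun v : ℝ => (y : ℂ) ^ (σ + v * I + 1 : ℂ) / ((σ + v * I) * (σ + v * I + 1)) := by
  have hy' : (y : ℂ) ≠ 0 := by exact_mod_cast hy.ne'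
  refine Continuous.div ?_ (by fun_prop) ?_
  · refine Continuous.const_cpow (by fun_prop) (Or.inl hy')
  · intro v h
    have := one_add_sq_le_norm_mul hσ v
    rw [← norm_mul, h, norm_zero] at this
    nlinarith

lemma integrable_cesaro_kernel {σ : ℝ} (hσ : 1 ≤ σ) {y : ℝ} (hy : 0 < y) :
    Integrable fun v : ℝ => (y : ℂ) ^ (σ + v * I + 1 : ℂ) / ((σ + v * I) * (σ + v * I + 1)) :=
  (integrable_inv_one_add_sq.const_mul (y ^ (σ + 1))).mono'
    (continuous_cesaro_kernel hσ hy).aestronglyMeasurable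
    (Filter.Eventually.of_forall (norm_cesaro_kernel_le hσ hy))

/-- Mellin inversion of `max (1 - t) 0`, whose transform is `1 / s - 1 / (s + 1) = 1 / (s (s + 1))`,
at the point `t = 1 / y`. -/
lemma integral_cesaro_kernel {σ : ℝ} (hσ : 1 ≤ σ) {y : ℝ} (hy : 0 < y) :
    (1 / (2 * Real.pi) : ℂ) *
      ∫ v : ℝ, (y : ℂ) ^ (σ + v * I + 1 : ℂ) / ((σ + v * I) * (σ + v * I + 1)) =
      (max (y - 1) 0 : ℝ) := by
  set F : ℝ → ℂ := fun t => (Set.Ioc 0 1).indicator (fun _ => 1 : ℝ → ℂ) t -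
    (Set.Ioc 0 1).indicator (fun t => (t : ℂ) ^ (1 : ℂ) : ℝ → ℂ) t with hF
  have hM : ∀ s : ℂ, 0 < s.re → HasMellin F s (1 / (s * (s + 1))) := by
    intro s hs
    have m1 := hasMellin_one_Ioc hs
    have m2 := hasMellin_cpow_Ioc 1 (s := s) (by simp; linarith)
    have h1 : s ≠ 0 := by rintro rfl; simp at hs
    have h2 : s + 1 ≠ 0 := by
      intro h; have := congrArg re h; simp at this; linarith
    have e : 1 / (s * (s + 1)) = 1 / s - 1 / (s + 1) := by field_simp; ring
    have := hasMellin_sub m1.1 m2.1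
    rw [m1.2, m2.2] at this
    rw [e]
    exact this
  have hFval : ∀ t : ℝ, 0 < t → F t = (max (1 - t) 0 : ℝ) := by
    intro t ht
    rw [hF]
    by_cases h : t ≤ 1
    · have : t ∈ Set.Ioc (0 : ℝ) 1 := ⟨ht, h⟩
      simp only [Set.indicator_of_mem this, cpow_one]
      rw [max_eq_left (by linarith)]; push_cast; ring
    · have : t ∉ Set.Ioc (0 : ℝ) 1 := fun hh => h hh.2
      simp only [Set.indicator_of_notMem this]
      rw [max_eq_right (by linarith)]; simp
  have hre : ∀ v : ℝ, 0 < (σ + v * I : ℂ).re := by intro v; simp; linarith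
  have hker : ∀ v : ℝ, ((y : ℂ)) ^ (σ + v * I + 1 : ℂ) / ((σ + v * I) * (σ + v * I + 1)) =
      y * (((y⁻¹ : ℝ) : ℂ) ^ (-(σ + v * I)) • mellin F (σ + v * I)) := by
    intro v
    have hy' : (y : ℂ) ≠ 0 := by exact_mod_cast hy.ne'
    rw [(hM _ (hre v)).2, cpow_add _ _ hy', cpow_one, smul_eq_mul, ofReal_inv,
      cpow_neg, inv_cpow _ _ (by rw [arg_ofReal_of_nonneg hy.le]; exact Real.pi_pos.ne), inv_inv]
    ring
  have hvert : VerticalIntegrable (mellin F) σ := by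
    have h1 := integrable_cesaro_kernel hσ one_pos
    refine h1.congr (Filter.Eventually.of_forall fun v => ?_)
    simp only [ofReal_one, one_cpow]
    rw [(hM _ (hre v)).2]
  have hcont : ContinuousAt F y⁻¹ := by
    have : F =ᶠ[nhds y⁻¹] fun t => ((max (1 - t) 0 : ℝ) : ℂ) := by
      filter_upwards [lt_mem_nhds (inv_pos.mpr hy)] with t ht
      exact hFval t ht
    refine ContinuousAt.congr ?_ this.symm
    fun_prop
  have hinv := mellinInv_mellin_eq σ F (inv_pos.mpr hy) (hM σ (by simp; linarith)).1 hvert hcont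
  rw [mellinInv, hFval _ (inv_pos.mpr hy)] at hinv
  simp_rw [hker]
  rw [integral_const_mul]
  have e : (1 / (2 * Real.pi) : ℂ) * ∫ v : ℝ, (((y⁻¹ : ℝ) : ℂ) ^ (-(σ + v * I)) •
      mellin F (σ + v * I)) = (max (1 - y⁻¹) 0 : ℝ) := by
    rw [← hinv, real_smul]; push_cast; rfl
  rw [mul_left_comm, e, ← ofReal_mul, mul_max_of_nonneg _ _ hy.le, mul_sub, mul_inv_cancel₀ hy.ne']
  simp

/-- Perron's formula with the Cesàro kernel. -/
lemma sum_mul_sub_eq_integral {c : ℕ → ℂ} {σ : ℝ} (hσ : 1 ≤ σ) (hc : LSeriesSummable c σ)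
    {y : ℝ} (hy : 0 < y) :
    ∑ n ∈ Finset.Icc 1 ⌊y⌋₊, c n * (y - n) = (1 / (2 * Real.pi) : ℂ) *
      ∫ v : ℝ, LSeries c (σ + v * I) *
        ((y : ℂ) ^ (σ + v * I + 1 : ℂ) / ((σ + v * I) * (σ + v * I + 1))) := by
  set κ : ℝ → ℂ := fun v => (y : ℂ) ^ (σ + v * I + 1 : ℂ) / ((σ + v * I) * (σ + v * I + 1)) with hκ
  have hκi : Integrable κ := integrable_cesaro_kernel hσ hy
  set T : ℕ → ℝ → ℂ := fun n v => LSeries.term c (σ + v * I) n * κ v with hT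
  have hnorm : ∀ n v, ‖T n v‖ = ‖LSeries.term c σ n‖ * ‖κ v‖ := by
    intro n v
    rw [hT]
    simp only [norm_mul, LSeries.norm_term_eq]
    simp
  have hcontT : ∀ n, Continuous (T n) := by
    intro n
    refine Continuous.mul ?_ (continuous_cesaro_kernel hσ hy)
    rcases eq_or_ne n 0 with rfl | hn
    · simp only [LSeries.term_zero]; fun_prop
    · simp only [LSeries.term_of_ne_zero hn]
      have hn' : (n : ℂ) ≠ 0 := by exact_mod_cast hn
      refine Continuous.div continuous_const
        (Continuous.const_cpow (by fun_prop) (Or.inl hn')) ?_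
      intro v h
      rw [cpow_eq_zero_iff] at h
      exact hn' h.1
  have hTint : ∀ n, Integrable (T n) := by
    intro n
    refine (hκi.norm.const_mul ‖LSeries.term c σ n‖).mono' (hcontT n).aestronglyMeasurable ?_
    exact Filter.Eventually.of_forall fun v => (hnorm n v).le
  have hTsum : Summable fun n => ∫ v, ‖T n v‖ := by
    simp_rw [hnorm, integral_const_mul]
    exact hc.norm.mul_right _
  have hmain := hasSum_integral_of_summable_integral_norm hTint hTsum
  have e1 : ∀ v : ℝ, ∑' n, T n v = LSeries c (σ + v * I) * κ v := by
    intro v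
    rw [hT, LSeries, tsum_mul_right]
  simp_rw [e1] at hmain
  have hterm : ∀ n : ℕ, 0 < n → ∀ v : ℝ, T n v = (c n * n) * ((((y / n : ℝ)) : ℂ) ^
      (σ + v * I + 1 : ℂ) / ((σ + v * I) * (σ + v * I + 1))) := by
    intro n hn v
    have hn0 : (0 : ℝ) < n := by exact_mod_cast hn
    have hn' : (n : ℂ) ≠ 0 := by exact_mod_cast hn0.ne'
    rw [hT, hκ]
    simp only
    rw [LSeries.term_of_ne_zero (by omega), Complex.ofReal_div, div_cpow_ofReal_nonneg hy.le hn0.le,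
      ofReal_natCast, cpow_add (σ + v * I) 1 hn', cpow_one]
    have : (n : ℂ) ^ (σ + v * I : ℂ) ≠ 0 := by
      intro h; rw [cpow_eq_zero_iff] at h; exact hn' h.1
    field_simp
  rw [← hmain.tsum_eq, ← tsum_mul_left, tsum_eq_sum (s := Finset.Icc 1 ⌊y⌋₊)]
  · refine Finset.sum_congr rfl fun n hn => ?_
    rw [Finset.mem_Icc] at hn
    have hn0 : (0 : ℝ) < n := by exact_mod_cast hn.1
    have hny : (n : ℝ) ≤ y := (Nat.le_floor_iff hy.le).mp hn.2
    have h := integral_cesaro_kernel hσ (y := y / n) (by positivity)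
    simp_rw [hterm n (by omega)]
    rw [integral_const_mul, mul_left_comm, h, max_eq_left]
    · push_cast
      have hn' : (n : ℂ) ≠ 0 := by exact_mod_cast hn0.ne'
      field_simp
    · rw [sub_nonneg, le_div_iff₀ hn0]; linarith
  · intro n hn
    rcases eq_or_ne n 0 with rfl | hn0'
    · simp [hT]
    have hn0 : (0 : ℝ) < n := by exact_mod_cast Nat.pos_of_ne_zero hn0'
    have hny : y < n := by
      by_contra hcon
      push Not at hcon
      exact hn (Finset.mem_Icc.mpr ⟨by omega, (Nat.le_floor_iff hy.le).mpr hcon⟩)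
    have h := integral_cesaro_kernel hσ (y := y / n) (by positivity)
    simp_rw [hterm n (by omega)]
    rw [integral_const_mul, mul_left_comm, h, max_eq_right]
    · simp
    · rw [sub_nonpos, div_le_one hn0]; exact hny.le

lemma integrable_LSeries_mul_cesaro_kernel {c : ℕ → ℂ} {σ : ℝ} (hσ : 1 ≤ σ)
    (hc : LSeriesSummable c σ) {y : ℝ} (hy : 0 < y) :
    Integrable fun v : ℝ => LSeries c (σ + v * I) *
      ((y : ℂ) ^ (σ + v * I + 1 : ℂ) / ((σ + v * I) * (σ + v * I + 1))) := by
  have hk := integrable_cesaro_kernel hσ hy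
  refine hk.bdd_mul (c := ∑' n, ‖LSeries.term c σ n‖) ?_ ?_
  · apply Continuous.aestronglyMeasurable
    unfold LSeries
    refine continuous_tsum (u := fun n => ‖LSeries.term c σ n‖) ?_ hc.norm ?_
    · intro n
      rcases eq_or_ne n 0 with rfl | hn
      · simp only [LSeries.term_zero]; fun_prop
      · simp only [LSeries.term_of_ne_zero hn]
        have hn' : (n : ℂ) ≠ 0 := by exact_mod_cast hn
        refine Continuous.div continuous_const
          (Continuous.const_cpow (by fun_prop) (Or.inl hn')) ?_
        intro v h
        rw [cpow_eq_zero_iff] at h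
        exact hn' h.1
    · intro n v
      simp [LSeries.norm_term_eq]
  · refine Filter.Eventually.of_forall fun v => ?_
    refine tsum_of_norm_bounded hc.norm.hasSum fun n => ?_
    simp [LSeries.norm_term_eq]

/-- The kernel which counts `n ≤ y` with a linear decay on `[y, y + h]`. -/
noncomputable def diffKernel (y h : ℝ) (s : ℂ) : ℂ :=
  (((y + h : ℝ) : ℂ) ^ (s + 1) - (y : ℂ) ^ (s + 1)) / (h * (s * (s + 1)))

lemma integrable_LSeries_mul_diffKernel {c : ℕ → ℂ} {σ : ℝ} (hσ : 1 ≤ σ)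
    (hc : LSeriesSummable c σ) {y h : ℝ} (hy : 0 < y) (hh : 0 < h) :
    Integrable fun v : ℝ => LSeries c (σ + v * I) * diffKernel y h (σ + v * I) := by
  have h1 := ((integrable_LSeries_mul_cesaro_kernel hσ hc (add_pos hy hh)).sub
    (integrable_LSeries_mul_cesaro_kernel hσ hc hy)).const_mul (1 / h : ℂ)
  refine h1.congr (Filter.Eventually.of_forall fun v => ?_)
  simp only [diffKernel, Pi.sub_apply]
  have hh' : (h : ℂ) ≠ 0 := by exact_mod_cast hh.ne'
  field_simp

/-- The difference quotient of the Cesàro sums at `y` and `y + h` has weight `1` on `n ≤ y` and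
weights in `[0, 1]` on `(y, y + h]`. The sharp cutoff is recovered by removing the latter terms
trivially; the factor `1 / (2π)` is discarded. -/
lemma norm_sum_le_integral_diffKernel {c : ℕ → ℂ} {σ : ℝ} (hσ : 1 ≤ σ)
    (hc : LSeriesSummable c σ) {y h : ℝ} (hy : 0 < y) (hh : 0 < h) :
    ‖∑ n ∈ Finset.Icc 1 ⌊y⌋₊, c n‖ ≤
      ‖∫ v : ℝ, LSeries c (σ + v * I) * diffKernel y h (σ + v * I)‖ +
        ∑ n ∈ Finset.Ioc ⌊y⌋₊ ⌊y + h⌋₊, ‖c n‖ := by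
  have hyh : 0 < y + h := by linarith
  have p1 := sum_mul_sub_eq_integral hσ hc hy
  have p2 := sum_mul_sub_eq_integral hσ hc hyh
  have hint := fun z hz => integrable_LSeries_mul_cesaro_kernel hσ hc (y := z) hz
  have hsplit : ∑ n ∈ Finset.Icc 1 ⌊y + h⌋₊, c n * (((y + h : ℝ) : ℂ) - n) =
      ∑ n ∈ Finset.Icc 1 ⌊y⌋₊, c n * (((y + h : ℝ) : ℂ) - n) +
        ∑ n ∈ Finset.Ioc ⌊y⌋₊ ⌊y + h⌋₊, c n * (((y + h : ℝ) : ℂ) - n) := by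
    have hfl : ⌊y⌋₊ ≤ ⌊y + h⌋₊ := Nat.floor_le_floor (by linarith)
    have e1 : ∀ m, Finset.Icc 1 m = Finset.Ioc 0 m := fun m => by
      ext; simp; omega
    rw [e1, e1]
    exact (Finset.sum_Ioc_consecutive _ (Nat.zero_le _) hfl).symm
  have hS : (h : ℂ) * ∑ n ∈ Finset.Icc 1 ⌊y⌋₊, c n =
      (∑ n ∈ Finset.Icc 1 ⌊y + h⌋₊, c n * (((y + h : ℝ) : ℂ) - n) -
        ∑ n ∈ Finset.Icc 1 ⌊y⌋₊, c n * (y - n)) -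
        ∑ n ∈ Finset.Ioc ⌊y⌋₊ ⌊y + h⌋₊, c n * (((y + h : ℝ) : ℂ) - n) := by
    rw [hsplit, Finset.mul_sum, add_sub_right_comm, add_sub_cancel_right, ← Finset.sum_sub_distrib]
    refine Finset.sum_congr rfl fun n _ => ?_
    push_cast; ring
  have hI : ∫ v : ℝ, LSeries c (σ + v * I) * diffKernel y h (σ + v * I) = (1 / h : ℂ) *
      ((∫ v : ℝ, LSeries c (σ + v * I) *
        ((((y + h : ℝ) : ℂ)) ^ (σ + v * I + 1 : ℂ) / ((σ + v * I) * (σ + v * I + 1)))) -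
      ∫ v : ℝ, LSeries c (σ + v * I) *
        ((y : ℂ) ^ (σ + v * I + 1 : ℂ) / ((σ + v * I) * (σ + v * I + 1)))) := by
    rw [← integral_sub (hint _ hyh) (hint _ hy), ← integral_const_mul]
    refine integral_congr_ae (Filter.Eventually.of_forall fun v => ?_)
    simp only [diffKernel]
    have hh' : (h : ℂ) ≠ 0 := by exact_mod_cast hh.ne'
    field_simp
  have hh' : (h : ℂ) ≠ 0 := by exact_mod_cast hh.ne'
  have hfin : ∑ n ∈ Finset.Icc 1 ⌊y⌋₊, c n = (1 / (2 * Real.pi) : ℂ) *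
      (∫ v : ℝ, LSeries c (σ + v * I) * diffKernel y h (σ + v * I)) -
      (1 / h : ℂ) * ∑ n ∈ Finset.Ioc ⌊y⌋₊ ⌊y + h⌋₊, c n * (((y + h : ℝ) : ℂ) - n) := by
    rw [p1, p2] at hS
    rw [hI]
    have : ∑ n ∈ Finset.Icc 1 ⌊y⌋₊, c n =
        (1 / h : ℂ) * ((h : ℂ) * ∑ n ∈ Finset.Icc 1 ⌊y⌋₊, c n) := by
      field_simp
    rw [this, hS]
    ring
  rw [hfin]
  refine (norm_sub_le _ _).trans (add_le_add ?_ ?_)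
  · rw [norm_mul]
    refine mul_le_of_le_one_left (norm_nonneg _) ?_
    have : (1 / (2 * Real.pi) : ℂ) = ((1 / (2 * Real.pi) : ℝ) : ℂ) := by push_cast; rfl
    rw [this, norm_real, Real.norm_of_nonneg (by positivity), div_le_one (by positivity)]
    linarith [Real.pi_gt_three]
  · rw [Finset.mul_sum]
    refine norm_sum_le_of_le _ fun n hn => ?_
    rw [Finset.mem_Ioc] at hn
    have h1 : y ≤ n := ((Nat.floor_lt hy.le).mp hn.1).le
    have h2 : (n : ℝ) ≤ y + h := (Nat.le_floor_iff hyh.le).mp hn.2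
    have e : (((y + h : ℝ) : ℂ) - n) = ((y + h - n : ℝ) : ℂ) := by push_cast; rfl
    rw [norm_mul, norm_mul, e, norm_real, Real.norm_of_nonneg (by linarith), norm_div, norm_one,
      norm_real, Real.norm_of_nonneg hh.le]
    rw [div_mul_eq_mul_div, div_le_iff₀ hh, one_mul]
    gcongr
    linarith

end Perron

/-! ### Size of the smoothing kernel for `h = √y` -/

section KernelBounds

open Complex MeasureTheory

/-- The mean value theorem gives `y ^ σ / |s|`, while bounding the two powers separately gives an
extra factor `√y / |s|`. Then `min 1 Z ≤ Z ^ ε` interpolates: the small gain in `|s|` is what makes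
the vertical integral converge absolutely, at the price of `y ^ ε` only. -/
lemma norm_diffKernel_le {s : ℂ} (hs : 1 / 2 ≤ s.re) (hs' : s.re ≤ 3 / 2) {y ε : ℝ} (hy : 1 ≤ y)
    (hε : 0 < ε) (hε' : ε ≤ 1) :
    ‖diffKernel y (√y) s‖ ≤ 16 * (y ^ s.re / ‖s‖) * (√y / ‖s‖) ^ ε := by
  have hy0 : 0 < y := by linarith
  have hh : 0 < √y := Real.sqrt_pos.mpr hy0
  have hhy : √y ≤ y := by
    rw [Real.sqrt_le_left (by linarith)]; nlinarith
  have hs0 : 0 < ‖s‖ := lt_of_lt_of_le (by linarith) (re_le_norm s)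
  have hs1 : ‖s‖ ≤ ‖s + 1‖ := by
    rw [Complex.norm_def, Complex.norm_def]
    apply Real.sqrt_le_sqrt
    rw [normSq_apply, normSq_apply]; simp; nlinarith
  have hs1' : s + 1 ≠ 0 := norm_pos_iff.mp (hs0.trans_le hs1)
  have hyh : y + √y ≤ 2 * y := by linarith
  have p2 : (2 : ℝ) ^ s.re ≤ 4 := by
    calc (2 : ℝ) ^ s.re ≤ 2 ^ (2 : ℝ) :=
          Real.rpow_le_rpow_of_exponent_le (by norm_num) (by linarith)
      _ = 4 := by norm_num
  have hX : 0 ≤ y ^ s.re / ‖s‖ := by positivity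
  have hZ : 0 < √y / ‖s‖ := by positivity
  have hA : ‖diffKernel y (√y) s‖ ≤ 16 * (y ^ s.re / ‖s‖) := by
    have hmv : ‖((y + √y : ℝ) : ℂ) ^ (s + 1) / (s + 1) - (y : ℂ) ^ (s + 1) / (s + 1)‖ ≤
        (2 * y) ^ s.re * ‖(y + √y) - y‖ := by
      refine Convex.norm_image_sub_le_of_norm_hasDerivWithin_le
        (f := fun t : ℝ => (t : ℂ) ^ (s + 1) / (s + 1)) (f' := fun t : ℝ => (t : ℂ) ^ s)
        (s := Set.Icc y (y + √y)) ?_ ?_ (convex_Icc _ _) (Set.left_mem_Icc.mpr (by linarith))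
        (Set.right_mem_Icc.mpr (by linarith))
      · intro t ht
        refine (hasDerivAt_ofReal_cpow_const' (by linarith [ht.1]) ?_).hasDerivWithinAt
        intro h; rw [h] at hs1'; simp at hs1'
      · intro t ht
        have ht0 : 0 < t := by linarith [ht.1]
        rw [norm_cpow_eq_rpow_re_of_pos ht0]
        exact Real.rpow_le_rpow ht0.le (ht.2.trans hyh) (by linarith)
    have e : diffKernel y (√y) s = (((y + √y : ℝ) : ℂ) ^ (s + 1) / (s + 1) -
        (y : ℂ) ^ (s + 1) / (s + 1)) / (√y * s) := by
      have h1 : ((√y : ℝ) : ℂ) ≠ 0 := by exact_mod_cast hh.ne'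
      have h2 : s ≠ 0 := norm_pos_iff.mp hs0
      rw [diffKernel]; field_simp
    rw [e, norm_div, norm_mul, norm_real, Real.norm_of_nonneg hh.le, div_le_iff₀ (by positivity)]
    refine hmv.trans ?_
    rw [add_sub_cancel_left, Real.norm_of_nonneg hh.le, Real.mul_rpow (by norm_num) hy0.le]
    have : 16 * (y ^ s.re / ‖s‖) * (√y * ‖s‖) = 16 * y ^ s.re * √y := by field_simp
    rw [this]
    gcongr
    linarith
  have hB : ‖diffKernel y (√y) s‖ ≤ 16 * (y ^ s.re / ‖s‖) * (√y / ‖s‖) := by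
    have hn : ∀ t : ℝ, 0 < t → t ≤ 2 * y → ‖(t : ℂ) ^ (s + 1)‖ ≤ 8 * (y ^ s.re * y) := by
      intro t ht hty
      rw [norm_cpow_eq_rpow_re_of_pos ht]
      have : (s + 1).re = s.re + 1 := by simp
      rw [this]
      calc t ^ (s.re + 1) ≤ (2 * y) ^ (s.re + 1) := Real.rpow_le_rpow ht.le hty (by linarith)
        _ = 2 ^ s.re * 2 * (y ^ s.re * y) := by
            rw [Real.mul_rpow (by norm_num) hy0.le, Real.rpow_add_one (by norm_num),
              Real.rpow_add_one hy0.ne']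
        _ ≤ _ := by gcongr; linarith
    rw [diffKernel, norm_div, norm_mul, norm_mul, norm_real, Real.norm_of_nonneg hh.le,
      div_le_iff₀ (by positivity)]
    refine (norm_sub_le _ _).trans ?_
    calc _ ≤ 8 * (y ^ s.re * y) + 8 * (y ^ s.re * y) :=
          add_le_add (hn _ (by linarith) hyh) (hn _ hy0 (by linarith))
      _ = 16 * (y ^ s.re / ‖s‖) * (√y / ‖s‖) * (√y * (‖s‖ * ‖s‖)) := by
          have := Real.mul_self_sqrt hy0.le
          field_simp
          nlinarith
      _ ≤ _ := by gcongr
  rcases le_total (√y / ‖s‖) 1 with h | h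
  · refine hB.trans ?_
    gcongr
    calc √y / ‖s‖ = (√y / ‖s‖) ^ (1 : ℝ) := (Real.rpow_one _).symm
      _ ≤ _ := Real.rpow_le_rpow_of_exponent_ge hZ h hε'
  · refine hA.trans ?_
    exact le_mul_of_one_le_right (by positivity) (Real.one_le_rpow h hε.le)

lemma differentiableAt_diffKernel {y h : ℝ} (hy : 0 < y) (hh : 0 < h) {s : ℂ} (hs : 0 < s.re) :
    DifferentiableAt ℂ (diffKernel y h) s := by
  have h1 : (((y + h : ℝ)) : ℂ) ≠ 0 := by exact_mod_cast (add_pos hy hh).ne'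
  have h2 : (y : ℂ) ≠ 0 := by exact_mod_cast hy.ne'
  have h3 : (h : ℂ) ≠ 0 := by exact_mod_cast hh.ne'
  have h4 : s ≠ 0 := by rintro rfl; simp at hs
  have h5 : s + 1 ≠ 0 := by
    intro h; have := congrArg re h; simp at this; linarith
  unfold diffKernel
  refine DifferentiableAt.div ?_ (by fun_prop) (by positivity)
  refine DifferentiableAt.sub ?_ ?_
  · exact (DifferentiableAt.const_cpow (by fun_prop) (Or.inl h1))
  · exact (DifferentiableAt.const_cpow (by fun_prop) (Or.inl h2))

lemma one_add_abs_im_le {s : ℂ} (hs : 1 / 2 ≤ s.re) : 1 + |s.im| ≤ 4 * ‖s‖ := by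
  have h1 := re_le_norm s
  have h2 := abs_im_le_norm s
  linarith

end KernelBounds

/-! ### Square root cancellation in the twisted sums of `a` -/

section TwistedSums

open Complex MeasureTheory

lemma sum_norm_le_of_ramanujan {c : ℕ → ℂ} {C ε y : ℝ} (hC : 0 ≤ C) (hε : 0 ≤ ε)
    (hc : ∀ n : ℕ, 1 ≤ n → ‖c n‖ ≤ C * (n : ℝ) ^ ε) (s : Finset ℕ)
    (hs : ∀ n ∈ s, 1 ≤ n ∧ (n : ℝ) ≤ y) : ∑ n ∈ s, ‖c n‖ ≤ C * y ^ ε * s.card := by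
  rw [mul_comm, ← nsmul_eq_mul]
  refine Finset.sum_le_card_nsmul _ _ _ fun n hn => ?_
  refine (hc n (hs n hn).1).trans ?_
  gcongr
  exact (hs n hn).2

lemma LSeries_mul_cpow (c : ℕ → ℂ) (τ : ℝ) (s : ℂ) :
    LSeries (fun n => c n * (n : ℂ) ^ (τ * I)) s = LSeries c (s - τ * I) := by
  refine tsum_congr fun n => ?_
  rcases eq_or_ne n 0 with rfl | hn
  · simp
  · have hn' : (n : ℂ) ≠ 0 := by exact_mod_cast hn
    rw [LSeries.term_of_ne_zero hn, LSeries.term_of_ne_zero hn, cpow_sub _ _ hn', div_div_eq_mul_div]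

lemma norm_natCast_cpow_mul_I {n : ℕ} (hn : 1 ≤ n) (τ : ℝ) : ‖(n : ℂ) ^ (τ * I)‖ = 1 := by
  rw [norm_natCast_cpow_of_pos (by omega)]; simp

lemma LSeriesSummable_mul_cpow {c : ℕ → ℂ} {s : ℂ} (hc : LSeriesSummable c s) (τ : ℝ) :
    LSeriesSummable (fun n => c n * (n : ℂ) ^ (τ * I)) s := by
  refine Summable.of_norm_bounded hc.norm fun n => ?_
  rw [LSeries.norm_term_eq, LSeries.norm_term_eq]
  split_ifs with h
  · exact le_rfl
  · rw [norm_mul, norm_natCast_cpow_mul_I (by omega), mul_one]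

/-- The kernel bound is used with exponent `2ε`: one `ε` pays for the growth of `F`, the other
leaves the integrable power `-(1 + ε)`. The height of `F` and that of the kernel differ by `τ`,
which costs `(1 + |τ|) ^ ε`. -/
lemma norm_mul_diffKernel_le {F w : ℂ} {ε τ y q C : ℝ} (hε : 0 < ε) (hε' : ε ≤ 1 / 2)
    (hy : 1 ≤ y) (hq1 : 1 ≤ q) (hC : 0 ≤ C) (h1 : 1 / 2 ≤ w.re) (h2 : w.re ≤ 1 + ε)
    (hF : ‖F‖ ≤ C * (q * |w.im|) ^ ε) :
    ‖F * diffKernel y (√y) (w + τ * I)‖ ≤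
      256 * C * (q * (1 + |τ|) * y) ^ ε * y ^ w.re * (1 + |w.im + τ|) ^ (-(1 + ε)) := by
  have hy0 : 0 < y := by linarith
  have hsy : 0 ≤ √y := Real.sqrt_nonneg _
  have hsre : (w + τ * I).re = w.re := by simp
  have hsim : (w + τ * I).im = w.im + τ := by simp
  have hk := norm_diffKernel_le (s := w + τ * I) (by rw [hsre]; exact h1)
    (by rw [hsre]; linarith) hy (ε := 2 * ε) (by linarith) (by linarith)
  have hu := one_add_abs_im_le (s := w + τ * I) (by rw [hsre]; exact h1)
  rw [hsim] at hu
  rw [hsre] at hk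
  set S := ‖w + τ * I‖
  set u := 1 + |w.im + τ| with hu'
  have hu1 : 1 ≤ u := by linarith [abs_nonneg (w.im + τ)]
  have hu0 : 0 < u := by linarith
  have hSu : u / 4 ≤ S := by linarith
  have him : |w.im| ≤ u * (1 + |τ|) := by
    have : |w.im| ≤ |w.im + τ| + |τ| := by simpa using abs_sub (w.im + τ) τ
    nlinarith [abs_nonneg τ, abs_nonneg (w.im + τ)]
  have e1 : (q * |w.im|) ^ ε ≤ (q * (1 + |τ|)) ^ ε * u ^ ε := by
    rw [← Real.mul_rpow (by positivity) hu0.le]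
    refine Real.rpow_le_rpow (by positivity) ?_ hε.le
    calc q * |w.im| ≤ q * (u * (1 + |τ|)) := by gcongr
      _ = _ := by ring
  have e2 : (√y / S) ^ (2 * ε) ≤ 4 * (y ^ ε * u ^ (-(2 * ε))) := by
    calc (√y / S) ^ (2 * ε) ≤ (√y / (u / 4)) ^ (2 * ε) := by gcongr
      _ = (4 * (√y * u⁻¹)) ^ (2 * ε) := by congr 1; field_simp
      _ = 4 ^ (2 * ε) * ((√y) ^ (2 * ε) * u ^ (-(2 * ε))) := by
          rw [Real.mul_rpow (by norm_num) (by positivity), Real.mul_rpow hsy (by positivity),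
            Real.inv_rpow hu0.le, ← Real.rpow_neg hu0.le]
      _ ≤ 4 ^ (1 : ℝ) * ((√y) ^ (2 * ε) * u ^ (-(2 * ε))) := by
          gcongr
          · norm_num
          · linarith
      _ = _ := by
          rw [Real.rpow_one, Real.rpow_mul hsy, Real.rpow_two, Real.sq_sqrt hy0.le]
  have e3 : y ^ w.re / S ≤ 4 * (y ^ w.re * u ^ (-1 : ℝ)) := by
    rw [Real.rpow_neg_one]
    calc y ^ w.re / S ≤ y ^ w.re / (u / 4) := by gcongr
      _ = _ := by field_simp
  rw [norm_mul]
  calc _ ≤ (C * ((q * (1 + |τ|)) ^ ε * u ^ ε)) * (16 * (4 * (y ^ w.re * u ^ (-1 : ℝ))) *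
        (4 * (y ^ ε * u ^ (-(2 * ε))))) := by
        refine mul_le_mul (hF.trans (by gcongr)) (hk.trans ?_) (norm_nonneg _) (by positivity)
        gcongr
    _ = 256 * C * ((q * (1 + |τ|)) ^ ε * y ^ ε) * y ^ w.re *
        (u ^ ε * u ^ (-1 : ℝ) * u ^ (-(2 * ε))) := by ring
    _ = _ := by
        rw [← Real.mul_rpow (by positivity) hy0.le, ← Real.rpow_add hu0, ← Real.rpow_add hu0]
        ring_nf

/-- Here `F` is evaluated near the real axis but the kernel at height about `τ`, so `|s| ≥ |τ| / 2`.
This is the origin of the term `y / |τ|`. -/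
lemma norm_mul_diffKernel_le_of_low {F : ℂ} {ε τ y v B : ℝ} (hε : 0 < ε) (hε' : ε ≤ 1 / 2)
    (hy : 1 ≤ y) (hB : 0 ≤ B) (hτ : 0 < |τ|) (hv : |v| ≤ |τ| / 2) (hF : ‖F‖ ≤ B) :
    ‖F * diffKernel y (√y) (((1 + ε : ℝ) : ℂ) + v * I + τ * I)‖ ≤
      32 * B * (y * y ^ ε * y ^ ε) / |τ| := by
  have hy0 : 0 < y := by linarith
  have hsy : 0 ≤ √y := Real.sqrt_nonneg _
  have hsre : (((1 + ε : ℝ) : ℂ) + v * I + τ * I).re = 1 + ε := by simp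
  have hsim : (((1 + ε : ℝ) : ℂ) + v * I + τ * I).im = v + τ := by simp
  have hk := norm_diffKernel_le (s := ((1 + ε : ℝ) : ℂ) + v * I + τ * I) (by rw [hsre]; linarith)
    (by rw [hsre]; linarith) hy (ε := 2 * ε) (by linarith) (by linarith)
  have hn1 := re_le_norm (((1 + ε : ℝ) : ℂ) + v * I + τ * I)
  have hn2 := abs_im_le_norm (((1 + ε : ℝ) : ℂ) + v * I + τ * I)
  rw [hsre] at hn1 hk
  rw [hsim] at hn2
  have hSτ : |τ| / 2 ≤ ‖((1 + ε : ℝ) : ℂ) + v * I + τ * I‖ := by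
    have h1 : |τ| ≤ |v + τ| + |v| := by
      have := abs_sub (v + τ) v
      simpa using this
    linarith
  rw [norm_mul]
  set S := ‖((1 + ε : ℝ) : ℂ) + v * I + τ * I‖
  have e2 : (√y / S) ^ (2 * ε) ≤ y ^ ε := by
    calc (√y / S) ^ (2 * ε) ≤ (√y) ^ (2 * ε) := by
          refine Real.rpow_le_rpow (by positivity) (div_le_self hsy (by linarith)) (by linarith)
      _ = _ := by rw [Real.rpow_mul hsy, Real.rpow_two, Real.sq_sqrt hy0.le]
  have hy1 : y ^ (1 + ε) = y * y ^ ε := by rw [Real.rpow_add hy0, Real.rpow_one]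
  calc _ ≤ B * (16 * (y ^ (1 + ε) / (|τ| / 2)) * y ^ ε) := by
        refine mul_le_mul hF (hk.trans ?_) (norm_nonneg _) hB
        gcongr
    _ = _ := by rw [hy1]; field_simp; ring

set_option maxHeartbeats 1000000 in
/-- Sums of `a n * χ n * n ^ (i τ)` exhibit square root cancellation up to the contribution of
low heights. -/
lemma twisted_sum_le {a : ℕ → ℂ} {k : ℕ} (ha : SeriesConditions a k) {ε : ℝ} (hε : 0 < ε)
    (hε' : ε ≤ 1 / 2) :
    ∃ C : ℝ, 0 < C ∧ ∀ q : ℕ, 1 ≤ q → ∀ χ : DirichletCharacter ℂ q, ∀ τ y : ℝ, 1 ≤ |τ| → 1 ≤ y →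
      ‖∑ n ∈ Finset.Icc 1 ⌊y⌋₊, twist a χ n * (n : ℂ) ^ (τ * I)‖ ≤
        C * (q * (1 + |τ|) * y) ^ (2 * ε) * (√y + y / |τ|) := by
  obtain ⟨C₀, L, hC₀, hL, hgrow⟩ := twisted_growth ha hε (by linarith) hε hε'
  obtain ⟨C₁', hC₁'⟩ := ha.ramanujan ε hε
  set C₁ := |C₁'| with hC₁
  have hC₁0 : 0 ≤ C₁ := abs_nonneg _
  have hram : ∀ n : ℕ, 1 ≤ n → ‖a n‖ ≤ C₁ * (n : ℝ) ^ ε := fun n hn =>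
    (hC₁' n hn).trans (by gcongr; exact le_abs_self _)
  have hsum : LSeriesSummable a ((1 + ε : ℝ) : ℂ) := ha.summable _ (by simp [hε])
  set B := ∑' n, ‖LSeries.term a ((1 + ε : ℝ) : ℂ) n‖ with hB
  have hB0 : 0 ≤ B := tsum_nonneg fun _ => norm_nonneg _
  set J := ∫ v : ℝ, (1 + ‖v‖) ^ (-(1 + ε)) with hJ
  have hJint : Integrable fun v : ℝ => (1 + ‖v‖) ^ (-(1 + ε)) :=
    integrable_one_add_norm (by simp [hε])
  have hJ0 : 0 ≤ J := integral_nonneg fun v => by positivity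
  refine ⟨2 * C₁ * L + 128 * L * B + 2048 * C₀ + 512 * C₀ * J + 4 * C₁ + 1, by positivity, ?_⟩
  intro q hq χ τ y hτ hy
  have hq1 : (1 : ℝ) ≤ q := by exact_mod_cast hq
  have hy0 : 0 < y := by linarith
  have hτ0 : 0 < |τ| := by linarith
  set c : ℕ → ℂ := fun n => twist a χ n * (n : ℂ) ^ (τ * I) with hc
  have hcn : ∀ n : ℕ, 1 ≤ n → ‖c n‖ ≤ C₁ * (n : ℝ) ^ ε := by
    intro n hn
    rw [hc]
    simp only [norm_mul, twist]
    rw [norm_natCast_cpow_mul_I hn, mul_one]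
    exact (mul_le_of_le_one_right (norm_nonneg _) (DirichletCharacter.norm_le_one χ _)).trans
      (hram n hn)
  set E := (q * (1 + |τ|) * y) ^ ε with hE
  have hE2 : (q * (1 + |τ|) * y) ^ (2 * ε) = E * E := by
    rw [hE, ← Real.rpow_add (by positivity)]; ring_nf
  have hqτ : 1 ≤ q * (1 + |τ|) := by nlinarith
  have hE1 : 1 ≤ E := Real.one_le_rpow (by nlinarith) hε.le
  have hyE : y ^ ε ≤ E := Real.rpow_le_rpow hy0.le (by nlinarith) hε.le
  have hqyE : (q : ℝ) ^ ε * y ^ ε ≤ E := by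
    rw [← Real.mul_rpow (by positivity) hy0.le]
    refine Real.rpow_le_rpow (by positivity) ?_ hε.le
    gcongr; nlinarith
  have hyτ : 0 ≤ y / |τ| := by positivity
  have hsy : 0 ≤ √y := Real.sqrt_nonneg _
  have hEE : E ≤ E * E := by nlinarith
  rw [hE2]
  set v₀ := L * (q : ℝ) ^ ε with hv₀
  have hv₀1 : 1 ≤ v₀ := by
    have := Real.one_le_rpow hq1 hε.le
    nlinarith
  -- For `|τ| < 2 v₀` the claimed term `y / |τ|` already exceeds the trivial bound up to `q ^ ε`.
  -- Otherwise heights `|v| ≤ v₀` keep the kernel at distance at least `|τ| / 2` from height `0`.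
  rcases lt_or_ge |τ| (2 * v₀) with hcase | hcase
  · have h1 : ‖∑ n ∈ Finset.Icc 1 ⌊y⌋₊, c n‖ ≤ C₁ * y ^ ε * y := by
      refine (norm_sum_le _ _).trans ?_
      refine (sum_norm_le_of_ramanujan hC₁0 hε.le hcn (y := y) _ ?_).trans ?_
      · intro n hn
        rw [Finset.mem_Icc] at hn
        exact ⟨hn.1, (Nat.le_floor_iff hy0.le).mp hn.2⟩
      · gcongr
        rw [Nat.card_Icc]
        simpa using Nat.floor_le hy0.le
    have h2 : y ≤ 2 * v₀ * (y / |τ|) := by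
      rw [mul_div_assoc', le_div_iff₀ hτ0]
      nlinarith
    calc _ ≤ C₁ * y ^ ε * y := h1
      _ ≤ C₁ * y ^ ε * (2 * v₀ * (y / |τ|)) := by gcongr
      _ = 2 * C₁ * L * ((q : ℝ) ^ ε * y ^ ε) * (y / |τ|) := by rw [hv₀]; ring
      _ ≤ 2 * C₁ * L * (E * E) * (y / |τ|) :=
          mul_le_mul_of_nonneg_right (mul_le_mul_of_nonneg_left (hqyE.trans hEE) (by positivity)) hyτ
      _ ≤ (2 * C₁ * L + 128 * L * B + 2048 * C₀ + 512 * C₀ * J + 4 * C₁ + 1) * (E * E) *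
          (√y + y / |τ|) := by
          gcongr
          · have : 0 ≤ 128 * L * B + 2048 * C₀ + 512 * C₀ * J + 4 * C₁ + 1 := by positivity
            linarith
          · linarith
  · obtain ⟨G, hG⟩ := ha.analytic_twist q hq χ
    set Ψ : ℂ → ℂ := fun w => G w / (w - 1) ^ k * diffKernel y (√y) (w + τ * I) with hΨ
    have hh : 0 < √y := Real.sqrt_pos.mpr hy0
    have hsumc : LSeriesSummable c ((1 + ε : ℝ) : ℂ) :=
      LSeriesSummable_mul_cpow (LSeriesSummable_twist hsum χ) τ
    have hperron := norm_sum_le_integral_diffKernel (σ := 1 + ε) (by linarith) hsumc hy0 hh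
    have hintc := integrable_LSeries_mul_diffKernel (σ := 1 + ε) (by linarith) hsumc hy0 hh
    have hF : ∀ w : ℂ, 1 < w.re → G w / (w - 1) ^ k = LSeries (twist a χ) w := by
      intro w hw
      rw [hG.eq_of_one_lt_re w hw, mul_div_cancel_left₀]
      refine pow_ne_zero _ (sub_ne_zero.mpr ?_)
      rintro rfl; simp at hw
    have hΨc : ∀ v : ℝ, LSeries c (((1 + ε : ℝ) : ℂ) + v * I) *
        diffKernel y (√y) (((1 + ε : ℝ) : ℂ) + v * I) =
        Ψ (((1 + ε : ℝ) : ℂ) + ((v - τ : ℝ) : ℂ) * I) := by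
      intro v
      rw [hc, LSeries_mul_cpow, hΨ]
      simp only
      rw [hF _ (by simp [hε])]
      congr 2 <;> (push_cast; ring)
    -- The factor `n ^ (i τ)` translates the series by `-i τ`; changing variables puts the series at
    -- height `v` and the kernel at height `v + τ`.
    have hshift : ∫ v : ℝ, LSeries c (((1 + ε : ℝ) : ℂ) + v * I) *
        diffKernel y (√y) (((1 + ε : ℝ) : ℂ) + v * I) =
        ∫ v : ℝ, Ψ (((1 + ε : ℝ) : ℂ) + v * I) := by
      simp_rw [hΨc]
      exact integral_sub_right_eq_self (fun v : ℝ => Ψ (((1 + ε : ℝ) : ℂ) + v * I)) τ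
    have hΨint : Integrable fun v : ℝ => Ψ (((1 + ε : ℝ) : ℂ) + v * I) := by
      have := hintc.comp_add_right τ
      refine this.congr (Filter.Eventually.of_forall fun v => ?_)
      simp only
      rw [hΨc]; simp
    set P := 256 * C₀ * E with hP
    have hP0 : 0 ≤ P := by positivity
    have hbound : ∀ w : ℂ, 1 / 2 ≤ w.re → w.re ≤ 1 + ε → v₀ ≤ |w.im| →
        ‖Ψ w‖ ≤ P * y ^ w.re * (1 + |w.im + τ|) ^ (-(1 + ε)) := fun w h1 h2 h3 =>
      norm_mul_diffKernel_le hε hε' hy hq1 hC₀.le h1 h2 (hgrow q hq χ G hG w h1 h2 h3)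
    have hym : y ^ (1 / 2 : ℝ) = √y := (Real.sqrt_eq_rpow y).symm
    have hy1 : y ^ (1 + ε) = y * y ^ ε := by rw [Real.rpow_add hy0, Real.rpow_one]
    -- On the horizontal sides either `|v| = v₀ ≤ |τ| / 2` or `|v| ≥ 2 |τ|`, so `|v + τ| ≥ |τ| / 2`
    -- in both cases; `H` follows from this. The left line contributes the `√y` term, and the middle
    -- segment and horizontal sides the `y / |τ|` term.
    have hmain := norm_integral_le_of_shift (Ψ := Ψ) (σ₁ := 1 / 2) (σ₂ := 1 + ε) (v₀ := v₀)
      (T₀ := 2 * |τ|) (H := 2 * P * (y * y ^ ε) / |τ|) (M := 32 * B * (y * y ^ ε * y ^ ε) / |τ|)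
      (g := fun v => P * √y * (1 + ‖v + τ‖) ^ (-(1 + ε))) (by linarith) (by linarith) ?_ hΨint ?_
      ?_ ?_ ?_ ?_
    · rw [hshift] at hperron
      have hJ' : ∫ v : ℝ, P * √y * (1 + ‖v + τ‖) ^ (-(1 + ε)) = P * √y * J := by
        rw [integral_const_mul, hJ]
        congr 1
        exact integral_add_right_eq_self (fun v : ℝ => (1 + ‖v‖) ^ (-(1 + ε))) τ
      rw [hJ'] at hmain
      have herr : ∑ n ∈ Finset.Ioc ⌊y⌋₊ ⌊y + √y⌋₊, ‖c n‖ ≤ 4 * C₁ * E * √y := by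
        refine (sum_norm_le_of_ramanujan hC₁0 hε.le hcn (y := 2 * y) _ ?_).trans ?_
        · intro n hn
          rw [Finset.mem_Ioc] at hn
          refine ⟨by omega, ?_⟩
          have := (Nat.le_floor_iff (by linarith)).mp hn.2
          have hhy : √y ≤ y := by
            rw [Real.sqrt_le_left (by linarith)]; nlinarith
          linarith
        · have hcard : ((Finset.Ioc ⌊y⌋₊ ⌊y + √y⌋₊).card : ℝ) ≤ 2 * √y := by
            rw [Nat.card_Ioc, Nat.cast_sub (Nat.floor_le_floor (by linarith))]
            have h1 := Nat.floor_le (a := y + √y) (by linarith)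
            have h2 := Nat.lt_floor_add_one y
            have h3 : 1 ≤ √y := Real.one_le_sqrt.mpr hy
            linarith
          have h2ε : (2 * y) ^ ε ≤ 2 * E := by
            rw [Real.mul_rpow (by norm_num) hy0.le]
            have : (2 : ℝ) ^ ε ≤ 2 ^ (1 : ℝ) :=
              Real.rpow_le_rpow_of_exponent_le (by norm_num) (by linarith)
            rw [Real.rpow_one] at this
            gcongr
          calc C₁ * (2 * y) ^ ε * ((Finset.Ioc ⌊y⌋₊ ⌊y + √y⌋₊).card : ℝ) ≤
                C₁ * (2 * E) * (2 * √y) := by gcongr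
            _ = _ := by ring
      have t1 : 2 * v₀ * (32 * B * (y * y ^ ε * y ^ ε) / |τ|) ≤ 128 * L * B * (E * E) * (y / |τ|) := by
        calc _ = 64 * L * B * (((q : ℝ) ^ ε * y ^ ε) * y ^ ε) * (y / |τ|) := by rw [hv₀]; ring
          _ ≤ 64 * L * B * (E * E) * (y / |τ|) := by gcongr
          _ ≤ _ := by
            have : 0 ≤ L * B * (E * E) * (y / |τ|) := by positivity
            linarith
      have t2 : 4 * (2 * P * (y * y ^ ε) / |τ|) * (1 + ε - 1 / 2) ≤
          2048 * C₀ * (E * E) * (y / |τ|) := by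
        calc _ = 2048 * C₀ * (E * y ^ ε) * (y / |τ|) * (1 + ε - 1 / 2) := by rw [hP]; ring
          _ ≤ 2048 * C₀ * (E * E) * (y / |τ|) * 1 := by
            gcongr <;> linarith
          _ = _ := by ring
      have t3 : 2 * (P * √y * J) ≤ 512 * C₀ * J * (E * E) * √y := by
        calc _ = 512 * C₀ * J * E * √y := by rw [hP]; ring
          _ ≤ _ := by gcongr
      have t4 : 4 * C₁ * E * √y ≤ 4 * C₁ * (E * E) * √y := by gcongr
      have hEE0 : 0 ≤ E * E := by positivity
      have r1 : 0 ≤ 2 * C₁ * L * (E * E) * (√y + y / |τ|) := by positivity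
      have r2 : 0 ≤ 128 * L * B * (E * E) * √y := by positivity
      have r3 : 0 ≤ 2048 * C₀ * (E * E) * √y := by positivity
      have r4 : 0 ≤ 512 * C₀ * J * (E * E) * (y / |τ|) := by positivity
      have r5 : 0 ≤ 4 * C₁ * (E * E) * (y / |τ|) := by positivity
      have r6 : 0 ≤ (E * E) * (√y + y / |τ|) := by positivity
      have ecast : (((1 + ε : ℝ) : ℂ)) = 1 + (ε : ℂ) := by push_cast; rfl
      calc _ ≤ 2 * v₀ * (32 * B * (y * y ^ ε * y ^ ε) / |τ|) +
            4 * (2 * P * (y * y ^ ε) / |τ|) * (1 + ε - 1 / 2) + 2 * (P * √y * J) +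
            4 * C₁ * E * √y := by linarith
        _ ≤ _ := by linarith
    · intro w hw
      apply DifferentiableAt.differentiableWithinAt
      have hw1 : (w - 1) ^ k ≠ 0 := by
        refine pow_ne_zero _ (sub_ne_zero.mpr ?_)
        rintro rfl; simp at hw
      refine DifferentiableAt.mul ((hG.entire w).div (by fun_prop) hw1) ?_
      have := differentiableAt_diffKernel hy0 hh (s := w + τ * I) (by simp; linarith [hw.2.1])
      exact DifferentiableAt.comp (f := fun w : ℂ => w + τ * I) w this (by fun_prop)
    · exact (hJint.comp_add_right τ).const_mul _
    · intro v; positivity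
    · intro v hv
      have := hbound (((1 / 2 : ℝ) : ℂ) + v * I) (by simp) (by simp; linarith) (by simpa using hv)
      simp only [add_re, ofReal_re, mul_re, I_re, mul_zero, ofReal_im, I_im, mul_one, sub_self,
        add_zero, add_im, mul_im, zero_add, hym] at this
      simpa only [Real.norm_eq_abs] using this
    · intro v hv x hx
      have hv1 : v₀ ≤ |v| := by
        rcases hv with h | h
        · exact h.ge
        · linarith
      have hb := hbound (x + v * I) (by simpa using hx.1) (by simpa using hx.2) (by simpa using hv1)
      simp only [add_re, ofReal_re, mul_re, I_re, mul_zero, ofReal_im, I_im, mul_one, sub_self,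
        add_zero, add_im, mul_im, zero_add] at hb
      refine hb.trans ?_
      have hvτ : |τ| / 2 ≤ 1 + |v + τ| := by
        have h1 : |τ| ≤ |v + τ| + |v| := by
          have := abs_sub (v + τ) v
          simpa using this
        have h2 : |v| ≤ |v + τ| + |τ| := by
          have := abs_sub (v + τ) τ
          simpa using this
        rcases hv with h | h <;> linarith
      have hu1 : 1 ≤ 1 + |v + τ| := by linarith [abs_nonneg (v + τ)]
      have e1 : (1 + |v + τ|) ^ (-(1 + ε)) ≤ 2 / |τ| := by
        calc (1 + |v + τ|) ^ (-(1 + ε)) ≤ (1 + |v + τ|) ^ (-1 : ℝ) :=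
              Real.rpow_le_rpow_of_exponent_le hu1 (by linarith)
          _ = (1 + |v + τ|)⁻¹ := Real.rpow_neg_one _
          _ ≤ (|τ| / 2)⁻¹ := by gcongr
          _ = _ := by rw [inv_div]
      have e2 : y ^ x ≤ y * y ^ ε := by
        rw [← hy1]; exact Real.rpow_le_rpow_of_exponent_le hy hx.2
      calc P * y ^ x * (1 + |v + τ|) ^ (-(1 + ε)) ≤ P * (y * y ^ ε) * (2 / |τ|) := by gcongr
        _ = _ := by ring
    · intro v hv
      rw [hΨ]
      refine norm_mul_diffKernel_le_of_low hε hε' hy hB0 hτ0 (hv.trans (by linarith)) ?_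
      rw [hF _ (by simp [hε])]
      exact norm_LSeries_twist_le (by simp) hsum χ

end TwistedSums

/-! ### Exponentials of power series -/

section ExpSeries

open PowerSeries

lemma coeff_eq_of_hasSum {c d : ℕ → ℂ} {r : ℝ} (hr : 0 < r) {f : ℂ → ℂ}
    (hc : ∀ z : ℂ, ‖z‖ < r → HasSum (fun n => c n * z ^ n) (f z))
    (hd : ∀ z : ℂ, ‖z‖ < r → HasSum (fun n => d n * z ^ n) (f z)) : c = d := by
  have key : ∀ e : ℕ → ℂ, (∀ z : ℂ, ‖z‖ < r → HasSum (fun n => e n * z ^ n) (f z)) →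
      HasFPowerSeriesAt f (FormalMultilinearSeries.ofScalars ℂ e) 0 := by
    intro e he
    refine ⟨ENNReal.ofReal r, ?_, by simpa using hr, ?_⟩
    · refine le_of_forall_lt_imp_le_of_dense fun x hx => ?_
      lift x to NNReal using hx.ne_top
      have hxr : (x : ℝ) < r := by
        rwa [ENNReal.lt_ofReal_iff_toReal_lt ENNReal.coe_ne_top, ENNReal.coe_toReal] at hx
      apply FormalMultilinearSeries.le_radius_of_summable
      have := (he (x : ℝ) (by simpa using hxr)).summable.norm
      refine this.congr fun n => ?_
      rw [FormalMultilinearSeries.ofScalars_norm]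
      simp
    · intro y hy
      have hy' : ‖y‖ < r := by
        rw [Metric.mem_eball, edist_zero_right] at hy
        rwa [← ofReal_norm, ENNReal.ofReal_lt_ofReal_iff hr] at hy
      rw [zero_add]
      simpa [FormalMultilinearSeries.ofScalars_apply_eq, mul_comm] using he y hy'
  exact FormalMultilinearSeries.ofScalars_series_injective ℂ ℂ
    ((key c hc).eq_formalMultilinearSeries (key d hd))

lemma differentiableOn_tsum_pow {b : ℕ → ℂ} {C ρ : ℝ} (hC : 0 ≤ C) (hρ : 0 < ρ)
    (hb : ∀ j, ‖b j‖ ≤ C * ρ ^ (j + 1)) :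
    DifferentiableOn ℂ (fun z => ∑' j, b j * z ^ (j + 1)) (Metric.ball 0 ρ⁻¹) := by
  intro z hz
  obtain ⟨r, h1, h2⟩ := exists_between (Metric.mem_ball.mp hz)
  have hr0 : 0 ≤ r := dist_nonneg.trans h1.le
  have hρr : ρ * r < 1 := by
    rw [lt_inv_comm₀ (by linarith [dist_nonneg.trans_lt h1]) hρ] at h2
    calc ρ * r < r⁻¹ * r := by gcongr; exact dist_nonneg.trans_lt h1
      _ = 1 := inv_mul_cancel₀ (dist_nonneg.trans_lt h1).ne'
  have := Complex.differentiableOn_tsum_of_summable_norm (U := Metric.ball (0 : ℂ) r)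
    (F := fun j z => b j * z ^ (j + 1)) (u := fun j => C * (ρ * r) ^ (j + 1)) ?_ ?_
    Metric.isOpen_ball ?_
  · exact (this.differentiableAt (Metric.isOpen_ball.mem_nhds h1)).differentiableWithinAt
  · refine Summable.mul_left _ ?_
    simp_rw [pow_succ]
    exact (summable_geometric_of_lt_one (by positivity) hρr).mul_right _
  · intro j; fun_prop
  · intro j w hw
    rw [mem_ball_zero_iff] at hw
    rw [norm_mul, norm_pow, mul_pow, ← mul_assoc]
    gcongr
    exact hb j

/-- Taylor's theorem gives convergence on the whole disc of radius `1 / ρ`. Cauchy's estimate on the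
circle of radius `1 / (2ρ)`, where the exponent is at most `C ∑ 2 ^ (-j-1) = C`, gives the
coefficients. -/
lemma exists_powerSeries_exp {b : ℕ → ℂ} {C ρ : ℝ} (hC : 0 ≤ C) (hρ : 0 < ρ)
    (hb : ∀ j, ‖b j‖ ≤ C * ρ ^ (j + 1)) :
    ∃ E : ℂ⟦X⟧, constantCoeff E = 1 ∧ (∀ j, ‖coeff j E‖ ≤ Real.exp C * (2 * ρ) ^ j) ∧
      ∀ z : ℂ, ‖z‖ < ρ⁻¹ →
        HasSum (fun j => coeff j E * z ^ j) (Complex.exp (∑' j, b j * z ^ (j + 1))) := by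
  set B : ℂ → ℂ := fun z => ∑' j, b j * z ^ (j + 1) with hB
  set h : ℂ → ℂ := fun z => Complex.exp (B z) with hh
  have hd : DifferentiableOn ℂ h (Metric.ball 0 ρ⁻¹) := (differentiableOn_tsum_pow hC hρ hb).cexp
  refine ⟨PowerSeries.mk fun n => (n.factorial : ℂ)⁻¹ * iteratedDeriv n h 0, ?_, ?_, ?_⟩
  · rw [← coeff_zero_eq_constantCoeff_apply, coeff_mk]
    simp [hh, hB]
  · intro j
    have hball : Metric.closedBall (0 : ℂ) (2 * ρ)⁻¹ ⊆ Metric.ball 0 ρ⁻¹ := by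
      apply Metric.closedBall_subset_ball
      rw [inv_lt_inv₀ (by positivity) hρ]; linarith
    have h1 : ∀ z ∈ Metric.sphere (0 : ℂ) (2 * ρ)⁻¹, ‖h z‖ ≤ Real.exp C := by
      intro z hz
      rw [mem_sphere_zero_iff_norm] at hz
      rw [hh]
      simp only [Complex.norm_exp]
      rw [Real.exp_le_exp]
      refine (Complex.re_le_norm _).trans ?_
      have hgeo : HasSum (fun j : ℕ => C * (1 / 2 / 2 ^ j)) (C * 1) :=
        (hasSum_geometric_two' (1 : ℝ)).mul_left C
      rw [mul_one] at hgeo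
      refine tsum_of_norm_bounded hgeo fun j => ?_
      rw [norm_mul, norm_pow, hz]
      calc ‖b j‖ * (2 * ρ)⁻¹ ^ (j + 1) ≤ C * ρ ^ (j + 1) * (2 * ρ)⁻¹ ^ (j + 1) := by
            gcongr; exact hb j
        _ = C * (1 / 2 / 2 ^ j) := by
            rw [mul_assoc, ← mul_pow]
            have : ρ * (2 * ρ)⁻¹ = 1 / 2 := by field_simp
            rw [this, pow_succ, one_div, inv_pow]
            ring
    have h2 := Complex.norm_iteratedDeriv_le_of_forall_mem_sphere_norm_le j (by positivity)
      ((hd.mono (Metric.closure_ball_subset_closedBall.trans hball)).diffContOnCl) h1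
    rw [coeff_mk, norm_mul, norm_inv, Complex.norm_natCast]
    have hf : (0 : ℝ) < j.factorial := by exact_mod_cast j.factorial_pos
    rw [inv_mul_le_iff₀ hf]
    refine h2.trans (le_of_eq ?_)
    rw [inv_pow, div_inv_eq_mul]; ring
  · intro z hz
    have := Complex.hasSum_taylorSeries_on_ball hd (z := z) (by simpa using hz)
    have e : (fun j => coeff j (PowerSeries.mk fun n => (n.factorial : ℂ)⁻¹ *
        iteratedDeriv n h 0) * z ^ j) =
        fun n => (n.factorial : ℂ)⁻¹ • (z - 0) ^ n • iteratedDeriv n h 0 := by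
      funext n
      rw [coeff_mk, sub_zero, smul_eq_mul, smul_eq_mul]; ring
    rw [e]
    exact this

lemma hasSum_coeff_mul {A B : ℂ⟦X⟧} {z x y : ℂ} (hA : HasSum (fun j => coeff j A * z ^ j) x)
    (hB : HasSum (fun j => coeff j B * z ^ j) y) :
    HasSum (fun j => coeff j (A * B) * z ^ j) (x * y) := by
  have h := summable_norm_sum_mul_antidiagonal_of_summable_norm hA.summable.norm hB.summable.norm
  have h2 := tsum_mul_tsum_eq_tsum_sum_antidiagonal_of_summable_norm hA.summable.norm
    hB.summable.norm
  rw [hA.tsum_eq, hB.tsum_eq] at h2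
  have h3 : (fun j => coeff j (A * B) * z ^ j) = fun n => ∑ kl ∈ Finset.HasAntidiagonal.antidiagonal n,
      coeff kl.1 A * z ^ kl.1 * (coeff kl.2 B * z ^ kl.2) := by
    funext n
    rw [coeff_mul, Finset.sum_mul]
    refine Finset.sum_congr rfl fun kl hkl => ?_
    rw [← Finset.HasAntidiagonal.mem_antidiagonal.mp hkl, pow_add]; ring
  rw [h3, h2]
  exact h.of_norm.hasSum

lemma mul_eq_one_of_exp {E E' : ℂ⟦X⟧} {r : ℝ} (hr : 0 < r) {B : ℂ → ℂ}
    (hE : ∀ z : ℂ, ‖z‖ < r → HasSum (fun j => coeff j E * z ^ j) (Complex.exp (B z)))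
    (hE' : ∀ z : ℂ, ‖z‖ < r → HasSum (fun j => coeff j E' * z ^ j) (Complex.exp (-B z))) :
    E * E' = 1 := by
  ext j
  refine congrFun (coeff_eq_of_hasSum (c := fun j => coeff j (E * E'))
    (d := fun j => coeff j (1 : ℂ⟦X⟧)) (f := fun _ => 1) hr ?_ ?_) j
  · intro z hz
    have := hasSum_coeff_mul (hE z hz) (hE' z hz)
    rwa [← Complex.exp_add, add_neg_cancel, Complex.exp_zero] at this
  · intro z _
    have h0 : ∀ j, j ≠ 0 → coeff j (1 : ℂ⟦X⟧) * z ^ j = 0 := by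
      intro j hj
      simp [coeff_one, hj]
    convert hasSum_single 0 h0 using 1
    simp

end ExpSeries

/-! ### Multiplicative functions from values at prime powers -/

section MultiplicativeExtension

open ArithmeticFunction

/-- The multiplicative function with prescribed values `e p j` at the prime powers `p ^ j`. -/
noncomputable def mulExt {R : Type*} [CommSemiring R] (e : ℕ → ℕ → R) : ArithmeticFunction R :=
  ⟨fun n => if n = 0 then 0 else n.factorization.prod e, by simp⟩

variable {R : Type*} [CommSemiring R]

lemma mulExt_apply (e : ℕ → ℕ → R) {n : ℕ} (hn : n ≠ 0) :
    mulExt e n = n.factorization.prod e := if_neg hn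

lemma isMultiplicative_mulExt (e : ℕ → ℕ → R) : (mulExt e).IsMultiplicative := by
  rw [IsMultiplicative.iff_ne_zero]
  refine ⟨by rw [mulExt_apply e one_ne_zero]; simp, ?_⟩
  intro m n hm hn hmn
  rw [mulExt_apply e (mul_ne_zero hm hn), mulExt_apply e hm, mulExt_apply e hn,
    Nat.factorization_mul hm hn]
  refine Finsupp.prod_add_index_of_disjoint ?_ _
  simpa using hmn.disjoint_primeFactors

lemma mulExt_prime_pow {e : ℕ → ℕ → R} (he : ∀ p, e p 0 = 1) {p : ℕ} (hp : p.Prime) (j : ℕ) :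
    mulExt e (p ^ j) = e p j := by
  rw [mulExt_apply e (pow_ne_zero _ hp.ne_zero), hp.factorization_pow,
    Finsupp.prod_single_index (he p)]

lemma norm_mulExt_le {e : ℕ → ℕ → ℂ} {K : ℝ}
    (he : ∀ p j : ℕ, p.Prime → ‖e p j‖ ≤ ((p : ℝ) ^ j) ^ K) {n : ℕ} (hn : n ≠ 0) :
    ‖mulExt e n‖ ≤ (n : ℝ) ^ K := by
  rw [mulExt_apply e hn, Finsupp.prod, norm_prod]
  calc ∏ p ∈ n.factorization.support, ‖e p (n.factorization p)‖
      ≤ ∏ p ∈ n.factorization.support, ((p : ℝ) ^ n.factorization p) ^ K := by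
        refine Finset.prod_le_prod (fun _ _ => norm_nonneg _) fun p hp => he p _ ?_
        exact Nat.prime_of_mem_primeFactors (by simpa using hp)
    _ = (n : ℝ) ^ K := by
        rw [Real.finsetProd_rpow _ _ (fun _ _ => by positivity)]
        congr 1
        conv_rhs => rw [← Nat.prod_factorization_pow_eq_self hn]
        rw [Finsupp.prod]
        push_cast
        rfl

end MultiplicativeExtension

/-! ### Multiplicativity and inverse Euler factors -/

section EulerFactors

open PowerSeries

/-- A Dirichlet series with an Euler product has multiplicative coefficients, and the inverses of
its Euler factors converge absolutely on the line `Re s = 1/2`. -/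
lemma HasEulerProduct.multiplicative {a : ℕ → ℂ} (ha : HasEulerProduct a)
    (hs : ∀ s : ℂ, 1 < s.re → LSeriesSummable a s) :
    (∀ m n : ℕ, m ≠ 0 → n ≠ 0 → m.Coprime n → a (m * n) = a m * a n) ∧
      ∀ p : ℕ, p.Prime → Summable fun j =>
        ‖coeff j (PowerSeries.mk fun i => a (p ^ i))⁻¹‖ * ((p : ℝ) ^ (-(1 / 2) : ℝ)) ^ j := by
  obtain ⟨b, θ, hθ, ⟨C, hC⟩, hprod⟩ := ha
  have hb : ∀ p : ℕ, p.Prime → ∀ j : ℕ, ‖b (p ^ (j + 1))‖ ≤ |C| * ((p : ℝ) ^ θ) ^ (j + 1) := by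
    intro p hp j
    refine (hC p hp (j + 1) (by omega)).trans ?_
    rw [← Real.rpow_natCast, ← Real.rpow_mul (by positivity), mul_comm θ]
    gcongr
    exact le_abs_self C
  have hex : ∀ p : ℕ, ∃ E : ℂ⟦X⟧, constantCoeff E = 1 ∧ (p.Prime →
      (∀ j, ‖coeff j E‖ ≤ Real.exp |C| * (2 * (p : ℝ) ^ θ) ^ j) ∧
      ∀ z : ℂ, ‖z‖ < ((p : ℝ) ^ θ)⁻¹ → HasSum (fun j => coeff j E * z ^ j)
        (Complex.exp (∑' j, b (p ^ (j + 1)) * z ^ (j + 1)))) := by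
    intro p
    by_cases hp : p.Prime
    · have hp0 : (0 : ℝ) < p := by exact_mod_cast hp.pos
      obtain ⟨E, h1, h2, h3⟩ := exists_powerSeries_exp (abs_nonneg C) (by positivity) (hb p hp)
      exact ⟨E, h1, fun _ => ⟨h2, h3⟩⟩
    · exact ⟨1, by simp, fun h => absurd h hp⟩
  choose E hE1 hE using hex
  set e : ℕ → ℕ → ℂ := fun p j => coeff j (E p) with he
  have he0 : ∀ p, e p 0 = 1 := fun p => by
    rw [he]; simp only [coeff_zero_eq_constantCoeff_apply, hE1]
  -- The exponent `|C| / log 2` absorbs `exp |C|` because `p ^ j ≥ 2`, and the `2` absorbs `(2 p ^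
  -- θ) ^ j ≤ (p ^ 2) ^ j`. A polynomial bound suffices, since the comparison is made far to the
  -- right.
  set K : ℝ := |C| / Real.log 2 + 2 with hK
  have hlog2 : 0 < Real.log 2 := Real.log_pos (by norm_num)
  have heK : ∀ p j : ℕ, p.Prime → ‖e p j‖ ≤ ((p : ℝ) ^ j) ^ K := by
    intro p j hp
    have hp2 : (2 : ℝ) ≤ p := by exact_mod_cast hp.two_le
    have hp0 : (0 : ℝ) < p := by linarith
    rcases Nat.eq_zero_or_pos j with rfl | hj
    · rw [he0]; simp
    · refine ((hE p hp).1 j).trans ?_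
      have hpj : (2 : ℝ) ≤ (p : ℝ) ^ j := hp2.trans (le_self_pow₀ (by linarith) (by omega))
      rw [hK, Real.rpow_add (by positivity)]
      gcongr
      · calc Real.exp |C| = (2 : ℝ) ^ (|C| / Real.log 2) := by
              rw [Real.rpow_def_of_pos (by norm_num), mul_div_cancel₀ _ hlog2.ne']
          _ ≤ ((p : ℝ) ^ j) ^ (|C| / Real.log 2) :=
              Real.rpow_le_rpow (by norm_num) hpj (by positivity)
      · rw [Real.rpow_two, ← pow_mul, mul_comm j 2, pow_mul]
        gcongr
        rw [sq]
        gcongr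
        calc (p : ℝ) ^ θ ≤ (p : ℝ) ^ (1 : ℝ) :=
              Real.rpow_le_rpow_of_exponent_le (by linarith) (by linarith)
          _ = p := Real.rpow_one _
  set at' := mulExt e with hat
  have hatK : ∀ n : ℕ, n ≠ 0 → ‖at' n‖ ≤ (n : ℝ) ^ K := fun n hn => norm_mulExt_le heK hn
  have hsumat : ∀ s : ℂ, K + 1 < s.re → LSeriesSummable (fun n => at' n) s := by
    intro s hs
    refine LSeriesSummable_of_le_const_mul_rpow hs ⟨1, fun n hn => ?_⟩
    rw [one_mul, add_sub_cancel_right]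
    exact hatK n hn
  have hK0 : 2 ≤ K := by
    have : 0 ≤ |C| / Real.log 2 := by positivity
    linarith
  have hzp : ∀ p : ℕ, p.Prime → ∀ s : ℂ, 1 / 2 ≤ s.re →
      ‖(p : ℂ) ^ (-s)‖ < ((p : ℝ) ^ θ)⁻¹ := by
    intro p hp s hs
    rw [Complex.norm_natCast_cpow_of_pos hp.pos, ← Real.rpow_neg (by positivity)]
    refine Real.rpow_lt_rpow_of_exponent_lt (by exact_mod_cast hp.one_lt) ?_
    simp; linarith
  -- The multiplicative candidate built from the local exponentials has the same Euler product as
  -- `a`. Uniqueness of Dirichlet coefficients then identifies it with `a`.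
  have heq : ∀ s : ℂ, K + 1 < s.re → LSeries a s = LSeries (fun n => at' n) s := by
    intro s hs
    have h1 := hprod s (by linarith)
    have hmul := isMultiplicative_mulExt e
    have h2 := EulerProduct.eulerProduct_hasProd (f := LSeries.term (fun n => at' n) s)
      ?_ ?_ (hsumat s hs).norm (LSeries.term_zero _ _)
    · have hfac : ∀ p : Nat.Primes, ∑' j : ℕ, LSeries.term (fun n => at' n) s ((p : ℕ) ^ j) =
          Complex.exp (∑' j : ℕ, b ((p : ℕ) ^ (j + 1)) *
            ((p : ℕ) : ℂ) ^ (-((j + 1 : ℕ) : ℂ) * s)) := by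
        intro p
        have hp := p.2
        have h3 := (hE p hp).2 _ (hzp p hp s (by linarith))
        have e1 : ∀ j : ℕ, LSeries.term (fun n => at' n) s ((p : ℕ) ^ j) =
            coeff j (E p) * (((p : ℕ) : ℂ) ^ (-s)) ^ j := by
          intro j
          rw [LSeries.term_of_ne_zero (pow_ne_zero _ hp.ne_zero), hat, mulExt_prime_pow he0 hp,
            Nat.cast_pow, ← Complex.natCast_cpow_natCast_mul, ← Complex.cpow_nat_mul, div_eq_mul_inv,
            ← Complex.cpow_neg, mul_neg]
        have e2 : ∀ j : ℕ, ((p : ℕ) : ℂ) ^ (-((j + 1 : ℕ) : ℂ) * s) =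
            (((p : ℕ) : ℂ) ^ (-s)) ^ (j + 1) := by
          intro j
          rw [← Complex.cpow_nat_mul]
          congr 1; ring
        simp_rw [e1, e2]
        exact h3.tsum_eq
      simp_rw [hfac] at h2
      exact h1.unique h2
    · rw [LSeries.term_of_ne_zero one_ne_zero, hmul.map_one]; simp
    · intro m n hmn
      rcases eq_or_ne m 0 with rfl | hm
      · simp
      rcases eq_or_ne n 0 with rfl | hn
      · simp
      rw [LSeries.term_of_ne_zero (mul_ne_zero hm hn), LSeries.term_of_ne_zero hm,
        LSeries.term_of_ne_zero hn, hmul.map_mul_of_coprime hmn, Nat.cast_mul,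
        Complex.natCast_mul_natCast_cpow, mul_div_mul_comm]
  have hat_eq : ∀ n : ℕ, n ≠ 0 → a n = at' n := by
    intro n hn
    refine LSeries.eq_of_LSeries_eventually_eq (f := a) (g := fun n => at' n) ?_ ?_ ?_ hn
    · exact (LSeriesSummable.abscissaOfAbsConv_le (s := 2) (hs 2 (by norm_num))).trans_lt (by simp)
    · exact (LSeriesSummable.abscissaOfAbsConv_le (s := ((K + 2 : ℝ) : ℂ))
        (hsumat _ (by simp))).trans_lt (EReal.coe_lt_top _)
    · filter_upwards [Filter.eventually_gt_atTop (K + 1)] with x hx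
      exact heq x (by simpa using hx)
  refine ⟨?_, ?_⟩
  · intro m n hm hn hmn
    rw [hat_eq _ (mul_ne_zero hm hn), hat_eq _ hm, hat_eq _ hn,
      (isMultiplicative_mulExt e).map_mul_of_coprime hmn]
  · intro p hp
    have hp0 : (0 : ℝ) < p := by exact_mod_cast hp.pos
    have hA : (PowerSeries.mk fun i => a (p ^ i)) = E p := by
      ext j
      rw [coeff_mk, hat_eq _ (pow_ne_zero _ hp.ne_zero), hat, mulExt_prime_pow he0 hp]
    -- The inverse factor is the exponential of the negated series, so it too converges for `|z| < p
    -- ^ (-θ)`. This disc contains `p ^ (-1/2)` because `θ < 1/2`.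
    obtain ⟨E', -, -, hE'⟩ := exists_powerSeries_exp (b := fun j => -b (p ^ (j + 1)))
      (ρ := (p : ℝ) ^ θ)
      (abs_nonneg C) (by positivity) (fun j => by rw [norm_neg]; exact hb p hp j)
    have hone : E p * E' = 1 := by
      refine mul_eq_one_of_exp (B := fun z => ∑' j, b (p ^ (j + 1)) * z ^ (j + 1))
        (inv_pos.mpr (by positivity : 0 < (p : ℝ) ^ θ)) (hE p hp).2 ?_
      intro z hz
      have := hE' z hz
      simpa only [neg_mul, tsum_neg] using this
    have hinv : (E p)⁻¹ = E' := by
      rw [eq_comm, PowerSeries.eq_inv_iff_mul_eq_one (by rw [hE1]; exact one_ne_zero), mul_comm]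
      exact hone
    rw [hA, hinv]
    have h := (hE' _ (hzp p hp (1 / 2) (by norm_num))).summable.norm
    refine h.congr fun j => ?_
    rw [norm_mul, norm_pow, Complex.norm_natCast_cpow_of_pos hp.pos]
    norm_num

end EulerFactors

/-! ### Writing `μ² a`, restricted to `(n, M) = 1`, as a convolution with `a` -/

section SquarefreeConvolution

open PowerSeries ArithmeticFunction

/-- `μ(n)² a(n)` restricted to `n` coprime to `M`. -/
noncomputable def sqfreeCoprime (a : ℕ → ℂ) (M n : ℕ) : ℂ :=
  if Squarefree n ∧ n.Coprime M then a n else 0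

/-- The inverse of the Euler factor at `p`, as a power series in `p ^ (-s)`. -/
noncomputable def invFactor (a : ℕ → ℂ) (p : ℕ) : ℂ⟦X⟧ := (PowerSeries.mk fun i => a (p ^ i))⁻¹

/-- The quotient of the Euler factors at `p` of the series with coefficients `sqfreeCoprime a M` and
of the series with coefficients `a`. -/
noncomputable def quotFactor (a : ℕ → ℂ) (M p : ℕ) : ℂ⟦X⟧ :=
  if p ∣ M then invFactor a p else (1 + C (a p) * X) * invFactor a p

lemma constantCoeff_invFactor {a : ℕ → ℂ} (ha : a 1 = 1) (p : ℕ) :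
    constantCoeff (invFactor a p) = 1 := by
  rw [invFactor, constantCoeff_inv, ← coeff_zero_eq_constantCoeff_apply, coeff_mk]
  simp [ha]

lemma mk_mul_invFactor {a : ℕ → ℂ} (ha : a 1 = 1) (p : ℕ) :
    (PowerSeries.mk fun i => a (p ^ i)) * invFactor a p = 1 := by
  refine PowerSeries.mul_inv_cancel _ ?_
  rw [← coeff_zero_eq_constantCoeff_apply, coeff_mk]
  simp [ha]

lemma coeff_zero_quotFactor {a : ℕ → ℂ} (ha : a 1 = 1) (M p : ℕ) :
    coeff 0 (quotFactor a M p) = 1 := by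
  rw [quotFactor]
  split_ifs <;> simp [constantCoeff_invFactor ha]

/-- The Euler factor of `a` cancels against its inverse, leaving `1` at primes dividing `M` and `1 +
a(p) X` at the others. -/
lemma coeff_mk_mul_quotFactor {a : ℕ → ℂ} (ha : a 1 = 1) (M : ℕ) {p : ℕ} (hp : p.Prime) (j : ℕ) :
    coeff j ((PowerSeries.mk fun i => a (p ^ i)) * quotFactor a M p) =
      sqfreeCoprime a M (p ^ j) := by
  rw [quotFactor, sqfreeCoprime]
  rcases j with _ | _ | j
  · have h1 : constantCoeff (PowerSeries.mk fun i => a (p ^ i)) = 1 := by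
      rw [← coeff_zero_eq_constantCoeff_apply, coeff_mk]; simp [ha]
    split_ifs with h h' h' <;> simp_all [constantCoeff_invFactor ha]
  · split_ifs with h h' h'
    · exfalso
      rw [zero_add, pow_one] at h'
      exact (hp.coprime_iff_not_dvd.mp h'.2) h
    · rw [mk_mul_invFactor ha]; simp [coeff_one]
    · rw [mul_left_comm, mk_mul_invFactor ha, mul_one]
      simp [coeff_one]
    · exfalso
      apply h'
      rw [zero_add, pow_one]
      exact ⟨hp.squarefree, hp.coprime_iff_not_dvd.mpr h⟩
  · have hns : ¬ Squarefree (p ^ (j + 1 + 1)) := by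
      rw [Nat.squarefree_pow_iff hp.one_lt.ne' (by omega)]
      omega
    rw [if_neg (c := Squarefree (p ^ (j + 1 + 1)) ∧ _) (fun h => hns h.1)]
    split_ifs with h
    · rw [mk_mul_invFactor ha]; simp [coeff_one]
    · rw [mul_left_comm, mk_mul_invFactor ha, mul_one]
      simp [coeff_one]

lemma sqfreeCoprime_mul {a : ℕ → ℂ}
    (hmul : ∀ m n : ℕ, m ≠ 0 → n ≠ 0 → m.Coprime n → a (m * n) = a m * a n) (M : ℕ) {m n : ℕ}
    (hm : m ≠ 0) (hn : n ≠ 0) (hmn : m.Coprime n) :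
    sqfreeCoprime a M (m * n) = sqfreeCoprime a M m * sqfreeCoprime a M n := by
  rw [sqfreeCoprime, sqfreeCoprime, sqfreeCoprime]
  simp only [Nat.squarefree_mul hmn, Nat.coprime_mul_iff_left, hmul m n hm hn hmn]
  split_ifs <;> first | tauto | simp

/-- `a` as an arithmetic function. -/
def toArith (a : ℕ → ℂ) : ArithmeticFunction ℂ := ⟨fun n => if n = 0 then 0 else a n, by simp⟩

lemma toArith_apply (a : ℕ → ℂ) {n : ℕ} (hn : n ≠ 0) : toArith a n = a n := if_neg hn

lemma isMultiplicative_toArith {a : ℕ → ℂ} (ha : a 1 = 1)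
    (hmul : ∀ m n : ℕ, m ≠ 0 → n ≠ 0 → m.Coprime n → a (m * n) = a m * a n) :
    (toArith a).IsMultiplicative := by
  rw [IsMultiplicative.iff_ne_zero]
  refine ⟨by rw [toArith_apply a one_ne_zero, ha], fun hm hn hmn => ?_⟩
  rw [toArith_apply a (mul_ne_zero hm hn), toArith_apply a hm, toArith_apply a hn,
    hmul _ _ hm hn hmn]

/-- The Dirichlet quotient of `sqfreeCoprime a M` by `a`. -/
noncomputable def quotFun (a : ℕ → ℂ) (M : ℕ) : ArithmeticFunction ℂ :=
  mulExt fun p j => coeff j (quotFactor a M p)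

lemma quotFun_mul_toArith {a : ℕ → ℂ} (ha : a 1 = 1)
    (hmul : ∀ m n : ℕ, m ≠ 0 → n ≠ 0 → m.Coprime n → a (m * n) = a m * a n) (M : ℕ) :
    quotFun a M * toArith a = toArith (sqfreeCoprime a M) := by
  have h1 := isMultiplicative_toArith ha hmul
  have h2 : (quotFun a M).IsMultiplicative := isMultiplicative_mulExt _
  have h3 : (toArith (sqfreeCoprime a M)).IsMultiplicative := by
    refine isMultiplicative_toArith (by simp [sqfreeCoprime, ha]) ?_
    intro m n hm hn hmn
    exact sqfreeCoprime_mul hmul M hm hn hmn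
  rw [IsMultiplicative.eq_iff_eq_on_prime_powers _ (h2.mul h1) _ h3]
  intro p j hp
  rw [mul_comm, ArithmeticFunction.mul_apply, toArith_apply _ (pow_ne_zero _ hp.ne_zero),
    ← coeff_mk_mul_quotFactor ha M hp j, coeff_mul,
    Nat.sum_divisorsAntidiagonal (f := fun x y => toArith a x * quotFun a M y),
    Nat.sum_divisors_prime_pow hp, Finset.Nat.sum_antidiagonal_eq_sum_range_succ_mk]
  refine Finset.sum_congr rfl fun i hi => ?_
  rw [Finset.mem_range] at hi
  rw [toArith_apply _ (pow_ne_zero _ hp.ne_zero), coeff_mk, Nat.pow_div (by omega) hp.pos, quotFun,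
    mulExt_prime_pow (fun p => coeff_zero_quotFactor ha M p) hp]

end SquarefreeConvolution

/-! ### Local factors of the quotient slightly to the right of `Re s = 1/2` -/

section LocalBounds

open PowerSeries ArithmeticFunction

lemma coeff_succ_invFactor {a : ℕ → ℂ} (ha : a 1 = 1) (p j : ℕ) :
    coeff (j + 1) (invFactor a p) =
      -∑ i ∈ Finset.range (j + 1), a (p ^ (i + 1)) * coeff (j - i) (invFactor a p) := by
  have h := congrArg (coeff (j + 1)) (mk_mul_invFactor ha p)
  rw [coeff_mul, Finset.Nat.sum_antidiagonal_eq_sum_range_succ_mk, Finset.sum_range_succ'] at h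
  simp only [coeff_mk, pow_zero, ha, one_mul, tsub_zero, coeff_one, Nat.add_sub_add_right] at h
  rw [if_neg (by omega)] at h
  exact eq_neg_of_add_eq_zero_right h

/-- Induction through the recursion for an inverse series. The base `C + 1` closes it because `C
∑_{i ≤ j} (C + 1) ^ i = (C + 1) ^ (j + 1) - 1`. -/
lemma norm_coeff_invFactor_le {a : ℕ → ℂ} (ha : a 1 = 1) {C P : ℝ} (hC : 0 ≤ C) (hP : 0 ≤ P)
    {p : ℕ} (hap : ∀ i : ℕ, ‖a (p ^ (i + 1))‖ ≤ C * P ^ (i + 1)) (j : ℕ) :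
    ‖coeff j (invFactor a p)‖ ≤ ((C + 1) * P) ^ j := by
  induction j using Nat.strong_induction_on with
  | _ j ih =>
    rcases j with _ | j
    · rw [coeff_zero_eq_constantCoeff_apply, constantCoeff_invFactor ha]; simp
    · rw [coeff_succ_invFactor ha, norm_neg]
      have hterm : ∀ i ∈ Finset.range (j + 1),
          ‖a (p ^ (i + 1)) * coeff (j - i) (invFactor a p)‖ ≤
            P ^ (j + 1) * (C * (C + 1) ^ (j + 1 - 1 - i)) := by
        intro i hi
        rw [Finset.mem_range] at hi
        rw [norm_mul]
        calc _ ≤ (C * P ^ (i + 1)) * ((C + 1) * P) ^ (j - i) :=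
              mul_le_mul (hap i) (ih _ (by omega)) (norm_nonneg _) (by positivity)
          _ = _ := by
              rw [mul_pow, show j + 1 - 1 - i = j - i by omega]
              have : P ^ (j + 1) = P ^ (i + 1) * P ^ (j - i) := by
                rw [← pow_add]; congr 1; omega
              rw [this]; ring
      refine (norm_sum_le_of_le _ hterm).trans ?_
      rw [← Finset.mul_sum, ← Finset.mul_sum,
        Finset.sum_range_reflect (fun i => (C + 1) ^ i) (j + 1)]
      have hg := mul_geom_sum (C + 1) (j + 1)
      rw [add_sub_cancel_right] at hg
      rw [hg, mul_pow, mul_comm]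
      gcongr
      linarith

lemma coeff_succ_one_add_mul (c : ℂ) (F : ℂ⟦X⟧) (j : ℕ) :
    coeff (j + 1) ((1 + C c * X) * F) = coeff (j + 1) F + c * coeff j F := by
  rw [add_mul, one_mul, map_add, mul_assoc, coeff_C_mul, coeff_succ_X_mul]

lemma summable_one_add_mul {F : ℂ⟦X⟧} {z : ℝ} (hz : 0 ≤ z) (c : ℂ)
    (hF : Summable fun j => ‖coeff j F‖ * z ^ j) :
    Summable (fun j => ‖coeff j ((1 + C c * X) * F)‖ * z ^ j) ∧
      ∑' j, ‖coeff j ((1 + C c * X) * F)‖ * z ^ j ≤ (1 + ‖c‖ * z) * ∑' j, ‖coeff j F‖ * z ^ j := by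
  set G := (1 + C c * X) * F with hG
  have h0 : coeff 0 G = coeff 0 F := by rw [hG]; simp
  have hle : ∀ j, ‖coeff (j + 1) G‖ * z ^ (j + 1) ≤
      ‖coeff (j + 1) F‖ * z ^ (j + 1) + ‖c‖ * z * (‖coeff j F‖ * z ^ j) := by
    intro j
    rw [hG, coeff_succ_one_add_mul]
    calc _ ≤ (‖coeff (j + 1) F‖ + ‖c * coeff j F‖) * z ^ (j + 1) := by
          gcongr; exact norm_add_le _ _
      _ = _ := by rw [norm_mul, pow_succ]; ring
  have hs1 : Summable fun j => ‖coeff (j + 1) F‖ * z ^ (j + 1) :=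
    (summable_nat_add_iff (f := fun j => ‖coeff j F‖ * z ^ j) 1).mpr hF
  have hs2 := hs1.add (hF.mul_left (‖c‖ * z))
  have hs3 : Summable fun j => ‖coeff (j + 1) G‖ * z ^ (j + 1) :=
    Summable.of_nonneg_of_le (fun j => by positivity) hle hs2
  have hs4 : Summable fun j => ‖coeff j G‖ * z ^ j :=
    (summable_nat_add_iff (f := fun j => ‖coeff j G‖ * z ^ j) 1).mp hs3
  refine ⟨hs4, ?_⟩
  rw [hs4.tsum_eq_zero_add, add_mul, one_mul]
  have h5 := hs3.tsum_le_tsum hle hs2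
  rw [hs1.tsum_add (hF.mul_left _), tsum_mul_left] at h5
  have h6 := hF.tsum_eq_zero_add
  rw [h0]
  linarith

/-- The sum of the absolute values of the terms of the local factor of `quotFun` at `Re s = σ`. -/
noncomputable def localSum (a : ℕ → ℂ) (M p : ℕ) (σ : ℝ) : ℝ :=
  ∑' j, ‖coeff j (quotFactor a M p)‖ * ((p : ℝ) ^ (-σ)) ^ j

lemma two_rpow_neg_le {x : ℝ} (hx : 2 ≤ x) {ε : ℝ} (hε : 0 ≤ ε) :
    x ^ (-(1 / 2 + ε) : ℝ) ≤ 3 / 4 := by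
  calc x ^ (-(1 / 2 + ε) : ℝ) ≤ x ^ (-(1 / 2) : ℝ) :=
        Real.rpow_le_rpow_of_exponent_le (by linarith) (by linarith)
    _ ≤ 2 ^ (-(1 / 2) : ℝ) := Real.rpow_le_rpow_of_nonpos (by norm_num) hx (by norm_num)
    _ ≤ 3 / 4 := by
        rw [Real.rpow_neg (by norm_num), ← Real.sqrt_eq_rpow, inv_le_comm₀ (by positivity)
          (by norm_num)]
        apply Real.le_sqrt_of_sq_le
        norm_num

/-- Meant for the finitely many small primes, where the Ramanujan bound is too weak to give
convergence and only the summability of the inverse factor at `p ^ (-1/2)` is available. No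
uniformity in `p` is needed. -/
lemma summable_local_of_small {a : ℕ → ℂ} {p : ℕ} (hp : p.Prime) {ε : ℝ} (hε : 0 ≤ ε)
    (hS : Summable fun j => ‖coeff j (invFactor a p)‖ * ((p : ℝ) ^ (-(1 / 2) : ℝ)) ^ j) (M : ℕ) :
    (Summable fun j => ‖coeff j (quotFactor a M p)‖ * ((p : ℝ) ^ (-(1 / 2 + ε))) ^ j) ∧
      localSum a M p (1 / 2 + ε) ≤
        (1 + ‖a p‖) * ∑' j, ‖coeff j (invFactor a p)‖ * ((p : ℝ) ^ (-(1 / 2) : ℝ)) ^ j := by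
  have hp1 : (1 : ℝ) ≤ p := by exact_mod_cast hp.one_le
  set z := (p : ℝ) ^ (-(1 / 2 + ε)) with hz
  have hz0 : 0 ≤ z := by positivity
  have hz1 : z ≤ 1 := Real.rpow_le_one_of_one_le_of_nonpos hp1 (by linarith)
  have hle : ∀ j, ‖coeff j (invFactor a p)‖ * z ^ j ≤
      ‖coeff j (invFactor a p)‖ * ((p : ℝ) ^ (-(1 / 2) : ℝ)) ^ j := by
    intro j
    gcongr
    exact Real.rpow_le_rpow_of_exponent_le hp1 (by linarith)
  have hS' : Summable fun j => ‖coeff j (invFactor a p)‖ * z ^ j :=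
    Summable.of_nonneg_of_le (fun j => by positivity) hle hS
  have hT := hS'.tsum_le_tsum hle hS
  have hT0 : 0 ≤ ∑' j, ‖coeff j (invFactor a p)‖ * z ^ j := tsum_nonneg fun j => by positivity
  rw [localSum, ← hz, quotFactor]
  split_ifs with h
  · refine ⟨hS', hT.trans ?_⟩
    exact le_mul_of_one_le_left (hT0.trans hT) (by linarith [norm_nonneg (a p)])
  · obtain ⟨h1, h2⟩ := summable_one_add_mul hz0 (a p) hS'
    refine ⟨h1, h2.trans ?_⟩
    refine mul_le_mul ?_ hT hT0 (by positivity)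
    have := mul_le_of_le_one_right (norm_nonneg (a p)) hz1
    linarith

/-- The linear coefficient of `(1 + a(p) X)` times the inverse factor is `a(p) - a(p) = 0`, so for
`p ∤ M` the deviation from `1` starts at `w² = p ^ (-(1 + ε))`. The hypothesis on `p` lets `p ^ (ε /
4)` absorb `C + 1`, which bounds the terms of the inverse factor by `w ^ j` with `w ≤ 3/4`. -/
lemma summable_local_of_large {a : ℕ → ℂ} (ha : a 1 = 1) {p : ℕ} (hp : p.Prime) {C ε : ℝ}
    (hC : 0 ≤ C) (hε : 0 < ε) (hap : ∀ n : ℕ, 1 ≤ n → ‖a n‖ ≤ C * (n : ℝ) ^ (ε / 4))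
    (hpC : C + 1 ≤ (p : ℝ) ^ (ε / 4)) (M : ℕ) :
    (Summable fun j => ‖coeff j (quotFactor a M p)‖ * ((p : ℝ) ^ (-(1 / 2 + ε))) ^ j) ∧
      localSum a M p (1 / 2 + ε) ≤ if p ∣ M then 4 else 1 + 8 * (p : ℝ) ^ (-(1 + ε)) := by
  have hp2 : (2 : ℝ) ≤ p := by exact_mod_cast hp.two_le
  have hp0 : (0 : ℝ) < p := by linarith
  set z := (p : ℝ) ^ (-(1 / 2 + ε)) with hz
  set P := (p : ℝ) ^ (ε / 4) with hP
  set w := (p : ℝ) ^ (-(1 / 2 + ε / 2)) with hw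
  have hz0 : 0 ≤ z := by positivity
  have hP0 : 0 ≤ P := by positivity
  have hw0 : 0 ≤ w := by positivity
  have hw1 : w ≤ 3 / 4 := two_rpow_neg_le hp2 (by linarith)
  have hPPz : P * P * z = w := by
    rw [hP, hz, hw, ← Real.rpow_add hp0, ← Real.rpow_add hp0]; ring_nf
  have hapi : ∀ i : ℕ, ‖a (p ^ (i + 1))‖ ≤ C * P ^ (i + 1) := by
    intro i
    refine (hap _ (Nat.one_le_pow _ _ hp.pos)).trans (le_of_eq ?_)
    rw [Nat.cast_pow, ← Real.rpow_natCast, ← Real.rpow_mul hp0.le, mul_comm ((i + 1 : ℕ) : ℝ),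
      Real.rpow_mul hp0.le, Real.rpow_natCast]
  have hinv : ∀ j, ‖coeff j (invFactor a p)‖ * z ^ j ≤ w ^ j := by
    intro j
    have h1 := norm_coeff_invFactor_le ha hC hP0 hapi j
    calc _ ≤ ((C + 1) * P) ^ j * z ^ j := by gcongr
      _ ≤ (P * P) ^ j * z ^ j := by gcongr
      _ = w ^ j := by rw [← mul_pow, hPPz]
  have hgeo : HasSum (fun j : ℕ => w ^ j) (1 - w)⁻¹ := hasSum_geometric_of_lt_one hw0 (by linarith)
  have hgeo4 : (1 - w)⁻¹ ≤ 4 := by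
    rw [inv_le_comm₀ (by linarith) (by norm_num)]; linarith
  have hS' : Summable fun j => ‖coeff j (invFactor a p)‖ * z ^ j :=
    Summable.of_nonneg_of_le (fun j => by positivity) hinv hgeo.summable
  rw [localSum, ← hz, quotFactor]
  split_ifs with h
  · refine ⟨hS', (hS'.tsum_le_tsum hinv hgeo.summable).trans ?_⟩
    rw [hgeo.tsum_eq]; exact hgeo4
  · obtain ⟨h1, -⟩ := summable_one_add_mul hz0 (a p) hS'
    refine ⟨h1, ?_⟩
    rw [h1.tsum_eq_zero_add, ((summable_nat_add_iff 1).mpr h1).tsum_eq_zero_add]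
    have e0 : coeff 0 ((1 + PowerSeries.C (a p) * X) * invFactor a p) = 1 := by
      simp [constantCoeff_invFactor ha]
    have e1 : coeff (0 + 1) ((1 + PowerSeries.C (a p) * X) * invFactor a p) = 0 := by
      rw [coeff_succ_one_add_mul, coeff_succ_invFactor ha]
      simp [constantCoeff_invFactor ha]
    have hapz : ‖a p‖ * z ≤ w := by
      have := hapi 0
      rw [zero_add, pow_one, pow_one] at this
      calc ‖a p‖ * z ≤ (C * P) * z := by gcongr
        _ ≤ (P * P) * z := by gcongr; linarith
        _ = w := hPPz
    have e2 : ∀ j, ‖coeff (j + 1 + 1) ((1 + PowerSeries.C (a p) * X) * invFactor a p)‖ *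
        z ^ (j + 1 + 1) ≤ 2 * w ^ 2 * w ^ j := by
      intro j
      rw [coeff_succ_one_add_mul]
      calc _ ≤ (‖coeff (j + 1 + 1) (invFactor a p)‖ + ‖a p * coeff (j + 1) (invFactor a p)‖) *
            z ^ (j + 1 + 1) := by gcongr; exact norm_add_le _ _
        _ = ‖coeff (j + 1 + 1) (invFactor a p)‖ * z ^ (j + 1 + 1) +
            (‖a p‖ * z) * (‖coeff (j + 1) (invFactor a p)‖ * z ^ (j + 1)) := by
            rw [norm_mul, pow_succ z (j + 1)]; ring
        _ ≤ w ^ (j + 1 + 1) + w * w ^ (j + 1) := by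
            gcongr
            · exact hinv _
            · exact hinv _
        _ = _ := by ring
    have hs2 := hgeo.mul_left (2 * w ^ 2)
    have h2 : Summable fun j => ‖coeff (j + 1 + 1) ((1 + PowerSeries.C (a p) * X) *
        invFactor a p)‖ * z ^ (j + 1 + 1) :=
      Summable.of_nonneg_of_le (fun j => by positivity) e2 hs2.summable
    have h3 := h2.tsum_le_tsum e2 hs2.summable
    rw [hs2.tsum_eq] at h3
    rw [e0, e1]
    have hw2 : w ^ 2 = (p : ℝ) ^ (-(1 + ε)) := by
      rw [hw, ← Real.rpow_natCast, ← Real.rpow_mul hp0.le]; ring_nf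
    rw [← hw2]
    have h4 : 2 * w ^ 2 * (1 - w)⁻¹ ≤ 2 * w ^ 2 * 4 := by gcongr
    simp only [norm_one, pow_zero, mul_one, norm_zero, zero_mul, zero_add]
    linarith

end LocalBounds

/-! ### Absolute convergence of the quotient, uniformly in `M` -/

section QuotientSum

open PowerSeries ArithmeticFunction

lemma quotFun_prime_pow {a : ℕ → ℂ} (ha : a 1 = 1) (M : ℕ) {p : ℕ} (hp : p.Prime) (j : ℕ) :
    quotFun a M (p ^ j) = coeff j (quotFactor a M p) :=
  mulExt_prime_pow (fun p => coeff_zero_quotFactor ha M p) hp j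

/-- Every `d ≤ N` has only prime factors at most `N`, so by positivity the sum is part of the
expansion of a finite Euler product. -/
lemma sum_norm_quotFun_le_prod {a : ℕ → ℂ} (ha : a 1 = 1) (M : ℕ) (σ : ℝ)
    (hS : ∀ p : ℕ, p.Prime →
      Summable fun j => ‖coeff j (quotFactor a M p)‖ * ((p : ℝ) ^ (-σ)) ^ j) (N : ℕ) :
    ∑ d ∈ Finset.Icc 1 N, ‖quotFun a M d‖ * (d : ℝ) ^ (-σ) ≤
      ∏ p ∈ (N + 1).primesBelow, localSum a M p σ := by
  classical
  set f : ℕ → ℝ := fun n => ‖quotFun a M n‖ * (n : ℝ) ^ (-σ) with hf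
  have hm : (quotFun a M).IsMultiplicative := isMultiplicative_mulExt _
  have hf1 : f 1 = 1 := by simp [hf, hm.map_one]
  have hmul : ∀ {m n : ℕ}, m.Coprime n → f (m * n) = f m * f n := by
    intro m n hmn
    simp only [hf]
    rw [hm.map_mul_of_coprime hmn, norm_mul, Nat.cast_mul,
      Real.mul_rpow (Nat.cast_nonneg m) (Nat.cast_nonneg n)]
    ring
  have hpow : ∀ {p : ℕ}, p.Prime → ∀ j, f (p ^ j) =
      ‖coeff j (quotFactor a M p)‖ * ((p : ℝ) ^ (-σ)) ^ j := by
    intro p hp j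
    simp only [hf]
    rw [quotFun_prime_pow ha M hp, Nat.cast_pow, ← Real.rpow_natCast,
      ← Real.rpow_mul (Nat.cast_nonneg p), mul_comm (j : ℝ), Real.rpow_mul (Nat.cast_nonneg p),
      Real.rpow_natCast]
  have hf0 : ∀ n, 0 ≤ f n := fun n => by positivity
  have hsum : ∀ {p : ℕ}, p.Prime → Summable fun n : ℕ => ‖f (p ^ n)‖ := by
    intro p hp
    refine (hS p hp).congr fun j => ?_
    rw [Real.norm_of_nonneg (hf0 _), hpow hp]
  obtain ⟨-, h⟩ := EulerProduct.summable_and_hasSum_smoothNumbers_prod_primesBelow_tsum hf1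
    (fun {m n} => hmul) hsum (N + 1)
  have h2 : ∏ p ∈ (N + 1).primesBelow, ∑' n : ℕ, f (p ^ n) =
      ∏ p ∈ (N + 1).primesBelow, localSum a M p σ := by
    refine Finset.prod_congr rfl fun p hp => ?_
    rw [localSum]
    exact tsum_congr fun j => hpow (Nat.prime_of_mem_primesBelow hp) j
  rw [← h2]
  have h3 := sum_le_hasSum (Finset.subtype (· ∈ (N + 1).smoothNumbers) (Finset.Icc 1 N))
    (fun i _ => hf0 i) h
  rwa [Finset.sum_subtype_of_mem (f := f)] at h3
  intro n hn
  rw [Finset.mem_Icc] at hn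
  rw [Nat.mem_smoothNumbers']
  intro p _ hpn
  have := Nat.le_of_dvd (by omega) hpn
  omega

lemma prod_ite_dvd_rpow_le {M : ℕ} (hM : 1 ≤ M) {ε : ℝ} (hε : 0 ≤ ε) (N : ℕ) :
    ∏ p ∈ N.primesBelow, (if p ∣ M then (p : ℝ) ^ ε else 1) ≤ (M : ℝ) ^ ε := by
  rw [← Finset.prod_filter, Real.finsetProd_rpow _ _ (fun i _ => Nat.cast_nonneg i),
    ← Nat.cast_prod]
  refine Real.rpow_le_rpow (Nat.cast_nonneg _) ?_ hε
  have hsub : N.primesBelow.filter (· ∣ M) ⊆ M.primeFactors := by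
    intro p hp
    rw [Finset.mem_filter] at hp
    exact Nat.mem_primeFactors.mpr ⟨Nat.prime_of_mem_primesBelow hp.1, hp.2, by omega⟩
  exact_mod_cast Nat.le_of_dvd hM
    ((Finset.prod_dvd_prod_of_subset _ _ _ hsub).trans M.prod_primeFactors_dvd)

theorem sum_norm_quotFun_le {a : ℕ → ℂ} {k : ℕ} (ha : SeriesConditions a k) {ε : ℝ} (hε : 0 < ε) :
    ∃ K : ℝ, 0 < K ∧ ∀ M : ℕ, 1 ≤ M → ∀ N : ℕ,
      ∑ d ∈ Finset.Icc 1 N, ‖quotFun a M d‖ * (d : ℝ) ^ (-(1 / 2 + ε)) ≤ K * (M : ℝ) ^ ε := by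
  obtain ⟨-, hloc⟩ := ha.eulerProduct.multiplicative ha.summable
  obtain ⟨C, hC⟩ := ha.ramanujan (ε / 4) (by positivity)
  have hC0 : 0 ≤ C := by
    have := (norm_nonneg _).trans (hC 1 le_rfl)
    simpa using this
  -- Beyond `P₀`, `p ^ (ε / 4)` exceeds `C + 1`, as the local estimate demands, and `4`, so that the
  -- local sum at `p ∣ M` is at most `p ^ ε`.
  have hlim := ((tendsto_rpow_atTop (show 0 < ε / 4 by positivity)).comp
    (tendsto_natCast_atTop_atTop (R := ℝ))).eventually_ge_atTop (max (C + 1) 4)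
  obtain ⟨P₀, hP₀⟩ := Filter.eventually_atTop.mp hlim
  set T : ℕ → ℝ := fun n =>
    ∑' j, ‖coeff j (invFactor a n)‖ * ((n : ℝ) ^ (-(1 / 2) : ℝ)) ^ j with hT
  have hT0 : ∀ n, 0 ≤ T n := fun n => tsum_nonneg fun j => by positivity
  -- A summable majorant, independent of `M`, for the logarithms of the local sums. What it does not
  -- cover, the factors at large `p ∣ M`, multiplies to at most `M ^ ε`.
  set u : ℕ → ℝ := fun n => 8 * (n : ℝ) ^ (-(1 + ε)) +
    (if n ≤ P₀ then (1 + ‖a n‖) * T n else 0) with hu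
  have hu1 : ∀ n : ℕ, 0 ≤ 8 * (n : ℝ) ^ (-(1 + ε)) := fun n => by positivity
  have hu2 : ∀ n, 0 ≤ (if n ≤ P₀ then (1 + ‖a n‖) * T n else 0) := by
    intro n
    split_ifs
    · exact mul_nonneg (by positivity) (hT0 n)
    · exact le_rfl
  have hu0 : ∀ n, 0 ≤ u n := fun n => add_nonneg (hu1 n) (hu2 n)
  have hus : Summable u := by
    refine ((Real.summable_nat_rpow.mpr (by linarith)).mul_left 8).add ?_
    refine summable_of_ne_finset_zero (s := Finset.range (P₀ + 1)) fun n hn => ?_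
    rw [Finset.mem_range] at hn
    exact if_neg (by omega)
  refine ⟨Real.exp (∑' n, u n), Real.exp_pos _, fun M hM N => ?_⟩
  have key : ∀ p : ℕ, p.Prime →
      (Summable fun j => ‖coeff j (quotFactor a M p)‖ * ((p : ℝ) ^ (-(1 / 2 + ε))) ^ j) ∧
      localSum a M p (1 / 2 + ε) ≤ Real.exp (u p) * (if p ∣ M then (p : ℝ) ^ ε else 1) := by
    intro p hp
    have hp1 : (1 : ℝ) ≤ p := by exact_mod_cast hp.one_le
    have hite : 1 ≤ (if p ∣ M then (p : ℝ) ^ ε else 1) := by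
      split_ifs
      · exact Real.one_le_rpow hp1 hε.le
      · exact le_rfl
    rcases le_or_gt p P₀ with h | h
    · obtain ⟨h1, h2⟩ := summable_local_of_small hp hε.le (hloc p hp) M
      refine ⟨h1, h2.trans ?_⟩
      have h3 : (1 + ‖a p‖) * T p ≤ u p := by
        simp only [hu, if_pos h]
        linarith [hu1 p]
      calc _ ≤ u p := h3
        _ ≤ Real.exp (u p) := by linarith [Real.add_one_le_exp (u p)]
        _ ≤ _ := le_mul_of_one_le_right (Real.exp_pos _).le hite
    · have h3 := hP₀ p h.le
      simp only [Function.comp] at h3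
      obtain ⟨h1, h2⟩ := summable_local_of_large ha.coeff_one hp hC0 hε hC
        ((le_max_left _ _).trans h3) M
      refine ⟨h1, h2.trans ?_⟩
      split_ifs with hd
      · calc (4 : ℝ) ≤ (p : ℝ) ^ (ε / 4) := (le_max_right _ _).trans h3
          _ ≤ (p : ℝ) ^ ε := Real.rpow_le_rpow_of_exponent_le hp1 (by linarith)
          _ ≤ _ := le_mul_of_one_le_left (by positivity) (Real.one_le_exp (hu0 p))
      · rw [mul_one]
        have h4 : u p = 8 * (p : ℝ) ^ (-(1 + ε)) := by simp [hu, h]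
        rw [← h4]
        linarith [Real.add_one_le_exp (u p)]
  refine (sum_norm_quotFun_le_prod ha.coeff_one M _ (fun p hp => (key p hp).1) N).trans ?_
  calc _ ≤ ∏ p ∈ (N + 1).primesBelow, Real.exp (u p) * (if p ∣ M then (p : ℝ) ^ ε else 1) := by
        refine Finset.prod_le_prod (fun p _ => tsum_nonneg fun j => by positivity) fun p hp => ?_
        exact (key p (Nat.prime_of_mem_primesBelow hp)).2
    _ = Real.exp (∑ p ∈ (N + 1).primesBelow, u p) *
        ∏ p ∈ (N + 1).primesBelow, (if p ∣ M then (p : ℝ) ^ ε else 1) := by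
        rw [Finset.prod_mul_distrib, Real.exp_sum]
    _ ≤ _ := by
        gcongr
        · exact hus.sum_le_tsum _ fun i _ => hu0 i
        · exact prod_ite_dvd_rpow_le hM hε.le _

end QuotientSum

/-! ### Character sums over squarefree integers coprime to `M` -/

section SquarefreeTwistedSum

open ArithmeticFunction

lemma Icc_one_eq_Ioc_zero (N : ℕ) : Finset.Icc 1 N = Finset.Ioc 0 N := rfl

lemma sum_convolution_mul (f g : ArithmeticFunction ℂ) {h : ℕ → ℂ}
    (hh : ∀ m n : ℕ, m ≠ 0 → n ≠ 0 → h (m * n) = h m * h n) (N : ℕ) :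
    ∑ n ∈ Finset.Icc 1 N, (f * g) n * h n =
      ∑ d ∈ Finset.Icc 1 N, f d * h d * ∑ l ∈ Finset.Icc 1 (N / d), g l * h l := by
  have key := sum_Ioc_mul_eq_sum_sum (pmul f (toArith h)) (pmul g (toArith h)) N
  simp only [Icc_one_eq_Ioc_zero]
  calc _ = ∑ n ∈ Finset.Ioc 0 N, (pmul f (toArith h) * pmul g (toArith h)) n := by
        refine Finset.sum_congr rfl fun n hn => ?_
        rw [mul_apply, mul_apply, Finset.sum_mul]
        refine Finset.sum_congr rfl fun x hx => ?_
        obtain ⟨h1, h2⟩ := Nat.mem_divisorsAntidiagonal.mp hx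
        have h3 : x.1 ≠ 0 := fun h0 => h2 (by rw [← h1, h0, zero_mul])
        have h4 : x.2 ≠ 0 := fun h0 => h2 (by rw [← h1, h0, mul_zero])
        rw [pmul_apply, pmul_apply, toArith_apply h h3, toArith_apply h h4, ← h1, hh _ _ h3 h4]
        ring
    _ = _ := by
        rw [key]
        refine Finset.sum_congr rfl fun d hd => ?_
        rw [Finset.mem_Ioc] at hd
        rw [pmul_apply, toArith_apply h (by omega)]
        congr 1
        refine Finset.sum_congr rfl fun l hl => ?_
        rw [Finset.mem_Ioc] at hl
        rw [pmul_apply, toArith_apply h (by omega)]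

lemma character_mul_cpow_mul {q : ℕ} (χ : DirichletCharacter ℂ q) (z : ℂ) (m n : ℕ) :
    χ ((m * n : ℕ) : ZMod q) * ((m * n : ℕ) : ℂ) ^ z =
      (χ (m : ZMod q) * (m : ℂ) ^ z) * (χ (n : ZMod q) * (n : ℂ) ^ z) := by
  rw [Nat.cast_mul, map_mul, Nat.cast_mul, Complex.natCast_mul_natCast_cpow]
  ring

lemma norm_character_mul_cpow_le {q : ℕ} (χ : DirichletCharacter ℂ q) (τ : ℝ) {n : ℕ}
    (hn : 1 ≤ n) : ‖χ (n : ZMod q) * (n : ℂ) ^ (τ * Complex.I)‖ ≤ 1 := by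
  rw [norm_mul, norm_natCast_cpow_mul_I hn, mul_one]
  exact χ.norm_le_one _

lemma sqrt_div_add_le {x T d ε : ℝ} (hT : 0 < T) (hd : 1 ≤ d) (hdx : d ≤ x) (hε : 0 ≤ ε) :
    √(x / d) + x / d / T ≤ x ^ ε * d ^ (-(1 / 2 + ε)) * (√x + x / T) := by
  have hd0 : 0 < d := by linarith
  have hx0 : 0 < x := by linarith
  have h1 : d ^ (-(1 / 2) : ℝ) ≤ x ^ ε * d ^ (-(1 / 2 + ε)) := by
    calc d ^ (-(1 / 2) : ℝ) = d ^ ε * d ^ (-(1 / 2 + ε)) := by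
          rw [← Real.rpow_add hd0]; ring_nf
      _ ≤ _ := by gcongr
  have h2 : √(x / d) = d ^ (-(1 / 2) : ℝ) * √x := by
    rw [Real.sqrt_div hx0.le, Real.rpow_neg hd0.le, ← Real.sqrt_eq_rpow]
    field_simp
  have h3 : x / d / T ≤ d ^ (-(1 / 2) : ℝ) * (x / T) := by
    have : d⁻¹ ≤ d ^ (-(1 / 2) : ℝ) := by
      rw [← Real.rpow_neg_one]
      exact Real.rpow_le_rpow_of_exponent_le hd (by norm_num)
    calc x / d / T = d⁻¹ * (x / T) := by field_simp
      _ ≤ _ := by gcongr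
  calc _ ≤ d ^ (-(1 / 2) : ℝ) * (√x + x / T) := by rw [h2, mul_add]; gcongr
    _ ≤ _ := by gcongr

lemma rpow_mul_rpow_mul_rpow_le {M Q x ε : ℝ} (hM : 1 ≤ M) (hQ : 1 ≤ Q) (hx : 1 ≤ x)
    (hε : 0 ≤ ε) : M ^ ε * (Q * x) ^ (2 * ε) * x ^ ε ≤ (M * Q * x) ^ (3 * ε) := by
  have h0 : 0 < M * Q * x := by positivity
  have h1 : (Q * x) ^ (2 * ε) ≤ (M * Q * x) ^ (2 * ε) := by
    gcongr
    exact le_mul_of_one_le_left (by linarith) hM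
  have h2 : (M * x) ^ ε ≤ (M * Q * x) ^ ε := by
    gcongr
    exact le_mul_of_one_le_right (by linarith) hQ
  rw [Real.mul_rpow (by linarith) (by linarith)] at h2
  calc _ = (Q * x) ^ (2 * ε) * (M ^ ε * x ^ ε) := by ring
    _ ≤ (M * Q * x) ^ (2 * ε) * (M * Q * x) ^ ε := by gcongr
    _ = _ := by rw [← Real.rpow_add h0]; ring_nf

/-- In the convolution the inner sum over `l ≤ x / d` is bounded by `√(x / d) + x / (d |τ|)`, so `d`
carries the weight `d ^ (-1/2)`. As `d ≤ x`, a factor `x ^ ε` buys `d ^ (-ε)`, and the sum over `d`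
is the one bounded by `K M ^ ε`. -/
theorem sqfree_twisted_sum_le {a : ℕ → ℂ} {k : ℕ} (ha : SeriesConditions a k) {ε : ℝ} (hε : 0 < ε)
    (hε' : ε ≤ 1 / 2) :
    ∃ C : ℝ, 0 < C ∧ ∀ M : ℕ, 1 ≤ M → ∀ q : ℕ, 1 ≤ q → ∀ χ : DirichletCharacter ℂ q,
      ∀ τ x : ℝ, 1 ≤ |τ| → 1 ≤ x →
        ‖∑ n ∈ Finset.Icc 1 ⌊x⌋₊, sqfreeCoprime a M n *
          (χ (n : ZMod q) * (n : ℂ) ^ (τ * Complex.I))‖ ≤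
        C * (M * q * (1 + |τ|) * x) ^ (3 * ε) * (√x + x / |τ|) := by
  obtain ⟨K, hK, hK'⟩ := sum_norm_quotFun_le ha hε
  obtain ⟨C, hC, hC'⟩ := twisted_sum_le ha hε hε'
  obtain ⟨hmul, -⟩ := ha.eulerProduct.multiplicative ha.summable
  refine ⟨C * K, by positivity, fun M hM q hq χ τ x hτ hx => ?_⟩
  have hM1 : (1 : ℝ) ≤ M := by exact_mod_cast hM
  have hq1 : (1 : ℝ) ≤ q := by exact_mod_cast hq
  have hτ0 : 0 < |τ| := by linarith
  have hx0 : 0 < x := by linarith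
  set h : ℕ → ℂ := fun n => χ (n : ZMod q) * (n : ℂ) ^ (τ * Complex.I) with hh
  have e1 : ∑ n ∈ Finset.Icc 1 ⌊x⌋₊, sqfreeCoprime a M n * h n =
      ∑ n ∈ Finset.Icc 1 ⌊x⌋₊, (quotFun a M * toArith a) n * h n := by
    refine Finset.sum_congr rfl fun n hn => ?_
    rw [Finset.mem_Icc] at hn
    rw [quotFun_mul_toArith ha.coeff_one hmul, toArith_apply _ (by omega)]
  rw [e1, sum_convolution_mul _ _ (fun m n _ _ => character_mul_cpow_mul χ _ m n)]
  set E : ℝ := C * (q * (1 + |τ|) * x) ^ (2 * ε) with hE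
  have hE0 : 0 < E := by positivity
  have hterm : ∀ d ∈ Finset.Icc 1 ⌊x⌋₊,
      ‖quotFun a M d * h d * ∑ l ∈ Finset.Icc 1 (⌊x⌋₊ / d), toArith a l * h l‖ ≤
        (E * x ^ ε * (√x + x / |τ|)) * (‖quotFun a M d‖ * (d : ℝ) ^ (-(1 / 2 + ε))) := by
    intro d hd
    rw [Finset.mem_Icc] at hd
    have hd1 : (1 : ℝ) ≤ d := by exact_mod_cast hd.1
    have hdx : (d : ℝ) ≤ x := (Nat.le_floor_iff hx0.le).mp hd.2
    have hy : 1 ≤ x / d := (one_le_div (by linarith)).mpr hdx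
    have hyx : x / d ≤ x := div_le_self hx0.le hd1
    have hinner : ‖∑ l ∈ Finset.Icc 1 (⌊x⌋₊ / d), toArith a l * h l‖ ≤
        E * (√(x / d) + x / d / |τ|) := by
      have := hC' q hq χ τ (x / d) hτ hy
      rw [Nat.floor_div_natCast] at this
      have e2 : ∑ l ∈ Finset.Icc 1 (⌊x⌋₊ / d), toArith a l * h l =
          ∑ n ∈ Finset.Icc 1 (⌊x⌋₊ / d), twist a χ n * (n : ℂ) ^ (τ * Complex.I) := by
        refine Finset.sum_congr rfl fun l hl => ?_
        rw [Finset.mem_Icc] at hl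
        rw [toArith_apply _ (by omega), hh, twist, mul_assoc]
      rw [e2]
      refine this.trans ?_
      rw [hE]
      gcongr
    rw [norm_mul, norm_mul]
    calc _ ≤ ‖quotFun a M d‖ * 1 * (E * (√(x / d) + x / d / |τ|)) := by
          gcongr
          exact norm_character_mul_cpow_le χ τ hd.1
      _ ≤ ‖quotFun a M d‖ * 1 * (E * (x ^ ε * (d : ℝ) ^ (-(1 / 2 + ε)) * (√x + x / |τ|))) := by
          gcongr
          exact sqrt_div_add_le hτ0 hd1 hdx hε.le
      _ = _ := by ring
  refine (norm_sum_le_of_le _ hterm).trans ?_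
  rw [← Finset.mul_sum]
  calc _ ≤ E * x ^ ε * (√x + x / |τ|) * (K * (M : ℝ) ^ ε) := by
        gcongr
        exact hK' M hM _
    _ = C * K * ((M : ℝ) ^ ε * (q * (1 + |τ|) * x) ^ (2 * ε) * x ^ ε) * (√x + x / |τ|) := by
        rw [hE]; ring
    _ ≤ C * K * (M * q * (1 + |τ|) * x) ^ (3 * ε) * (√x + x / |τ|) := by
        have hqt : 1 ≤ q * (1 + |τ|) := one_le_mul_of_one_le_of_one_le hq1 (by linarith)
        gcongr
        rw [show (M * q * (1 + |τ|) * x : ℝ) = M * (q * (1 + |τ|)) * x by ring]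
        exact rpow_mul_rpow_mul_rpow_le hM1 hqt hx hε.le

end SquarefreeTwistedSum

/-! ### From additive characters to Dirichlet characters -/

section AdditiveTwist

lemma expE_eq_stdAddChar (b : ℤ) (q : ℕ) [NeZero q] (l : ℕ) :
    expE (b * l / q) = ZMod.stdAddChar ((b : ZMod q) * (l : ZMod q)) := by
  have h := ZMod.stdAddChar_coe (N := q) (b * l)
  push_cast at h
  rw [h, expE]
  push_cast
  congr 1
  ring

lemma sum_character_inv_mul_conj {q : ℕ} [NeZero q] (g : ZMod q → ℂ) (χ : DirichletCharacter ℂ q) :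
    (starRingEnd ℂ) (∑ u : (ZMod q)ˣ, g u * χ (u : ZMod q)⁻¹) =
      ∑ v : (ZMod q)ˣ, (starRingEnd ℂ) (g v) * χ (v : ZMod q) := by
  rw [map_sum]
  refine Finset.sum_congr rfl fun v _ => ?_
  rw [map_mul]
  congr 1
  rw [ZMod.inv_coe_unit, ← Complex.inv_eq_conj (χ.unit_norm_eq_one v⁻¹), inv_eq_iff_eq_inv]
  refine eq_inv_of_mul_eq_one_left ?_
  rw [← map_mul]
  simp

/-- Orthogonality gives the coefficients, Parseval their mean square, and Cauchy–Schwarz over the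
`φ(q)` characters yields total mass at most `√φ(q)`. Only the boundedness of `g` matters. -/
lemma exists_character_expansion (q : ℕ) [NeZero q] (g : ZMod q → ℂ) (hg : ∀ u, ‖g u‖ ≤ 1) :
    ∃ c : DirichletCharacter ℂ q → ℂ,
      (∀ l : ZMod q, IsUnit l → g l = ∑ χ : DirichletCharacter ℂ q, c χ * χ l) ∧
        ∑ χ : DirichletCharacter ℂ q, ‖c χ‖ ≤ √q := by
  set T : ℝ := (q.totient : ℝ) with hT
  have hq : 0 < q := Nat.pos_of_ne_zero (NeZero.ne q)
  have hT0 : 0 < T := by rw [hT]; exact_mod_cast Nat.totient_pos.mpr hq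
  have hTq : T ≤ q := by rw [hT]; exact_mod_cast Nat.totient_le q
  have hTC : (q.totient : ℂ) ≠ 0 := by exact_mod_cast (Nat.totient_pos.mpr hq).ne'
  set D : DirichletCharacter ℂ q → ℂ := fun χ => ∑ u : (ZMod q)ˣ, g u * χ (u : ZMod q)⁻¹ with hD
  have hcard : (Fintype.card (DirichletCharacter ℂ q) : ℝ) = T := by
    have := DirichletCharacter.sum_char_inv_mul_char_eq ℂ (n := q) isUnit_one 1
    simp at this
    rw [hT]
    exact_mod_cast this
  have horth : ∀ (φ : (ZMod q)ˣ → ℂ) (l : (ZMod q)ˣ),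
      ∑ χ : DirichletCharacter ℂ q, (∑ u : (ZMod q)ˣ, φ u * χ (u : ZMod q)⁻¹) * χ l =
        q.totient * φ l := by
    intro φ l
    simp_rw [Finset.sum_mul]
    rw [Finset.sum_comm]
    calc _ = ∑ u : (ZMod q)ˣ, φ u * (if (u : ZMod q) = l then (q.totient : ℂ) else 0) := by
          refine Finset.sum_congr rfl fun u _ => ?_
          rw [← DirichletCharacter.sum_char_inv_mul_char_eq ℂ u.isUnit (l : ZMod q), Finset.mul_sum]
          exact Finset.sum_congr rfl fun χ _ => by ring
      _ = _ := by
          simp only [Units.val_inj, mul_ite, mul_zero, Finset.sum_ite_eq', Finset.mem_univ, if_true]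
          ring
  refine ⟨fun χ => (q.totient : ℂ)⁻¹ * D χ, ?_, ?_⟩
  · rintro l ⟨u, rfl⟩
    have := horth (fun u => g u) u
    simp_rw [mul_assoc]
    rw [← Finset.mul_sum, this]
    field_simp
  · have hpars : ∑ χ : DirichletCharacter ℂ q, ‖D χ‖ ^ 2 ≤ T * T := by
      have e : ((∑ χ : DirichletCharacter ℂ q, ‖D χ‖ ^ 2 : ℝ) : ℂ) =
          ((T * ∑ v : (ZMod q)ˣ, ‖g v‖ ^ 2 : ℝ) : ℂ) := by
        push_cast
        calc _ = ∑ χ : DirichletCharacter ℂ q, D χ *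
              ∑ v : (ZMod q)ˣ, (starRingEnd ℂ) (g v) * χ (v : ZMod q) := by
              refine Finset.sum_congr rfl fun χ _ => ?_
              rw [← sum_character_inv_mul_conj g χ, Complex.mul_conj, Complex.normSq_eq_norm_sq]
              push_cast
              rfl
          _ = ∑ v : (ZMod q)ˣ, (starRingEnd ℂ) (g v) *
              ∑ χ : DirichletCharacter ℂ q, D χ * χ (v : ZMod q) := by
              simp_rw [Finset.mul_sum]
              rw [Finset.sum_comm]
              refine Finset.sum_congr rfl fun v _ => Finset.sum_congr rfl fun χ _ => by ring
          _ = _ := by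
              rw [Finset.mul_sum]
              refine Finset.sum_congr rfl fun v _ => ?_
              have := horth (fun u => g u) v
              simp only [hD]
              rw [this]
              have h2 := Complex.mul_conj (g v)
              rw [Complex.normSq_eq_norm_sq] at h2
              push_cast at h2
              rw [← h2, hT]
              push_cast
              ring
      rw [Complex.ofReal_inj] at e
      rw [e]
      gcongr
      calc _ ≤ ∑ v : (ZMod q)ˣ, (1 : ℝ) := by
            refine Finset.sum_le_sum fun v _ => pow_le_one₀ (norm_nonneg _) (hg v)
        _ = T := by rw [Finset.sum_const, Finset.card_univ, ZMod.card_units_eq_totient]; simp [hT]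
    have hcs := sq_sum_le_card_mul_sum_sq (s := (Finset.univ : Finset (DirichletCharacter ℂ q)))
      (f := fun χ => ‖D χ‖)
    rw [Finset.card_univ, hcard] at hcs
    simp_rw [norm_mul, norm_inv, Complex.norm_natCast, ← Finset.mul_sum]
    apply Real.le_sqrt_of_sq_le
    rw [mul_pow]
    calc _ ≤ (T⁻¹) ^ 2 * (T * (T * T)) := by
          rw [← hT]
          gcongr
          exact hcs.trans (by gcongr)
      _ = T := by field_simp
      _ ≤ q := hTq

/-- If `g l` is squarefree and `gcd (g l, q) = g`, then `l` is coprime both to `g` and to `q / g`,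
hence to `q`. -/
lemma sqfreeCoprime_gcd {a : ℕ → ℂ}
    (hmul : ∀ m n : ℕ, m ≠ 0 → n ≠ 0 → m.Coprime n → a (m * n) = a m * a n) (m : ℕ) {q g l : ℕ}
    (hq : q ≠ 0) (hgq : g ∣ q) (hl : l ≠ 0) :
    (if (g * l).gcd q = g then sqfreeCoprime a m (g * l) else 0) =
      sqfreeCoprime a m g * sqfreeCoprime a (m * q) l := by
  have hg : g ≠ 0 := fun h => hq (Nat.eq_zero_of_zero_dvd (h ▸ hgq))
  by_cases hlq : l.Coprime q
  · have hgl : g.Coprime l := (Nat.Coprime.coprime_dvd_right hgq hlq).symm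
    have h1 : (g * l).gcd q = g := by
      rw [Nat.gcd_comm, Nat.Coprime.gcd_mul_right_cancel_right _ hlq]
      exact Nat.gcd_eq_right hgq
    rw [if_pos h1, sqfreeCoprime_mul hmul m hg hl hgl]
    congr 1
    simp only [sqfreeCoprime, Nat.coprime_mul_iff_right, and_iff_left hlq]
  · have h0 : sqfreeCoprime a (m * q) l = 0 := by
      rw [sqfreeCoprime, if_neg]
      rintro ⟨-, h⟩
      exact hlq (Nat.Coprime.coprime_mul_left_right h)
    rw [h0, mul_zero]
    split_ifs with h
    · rw [sqfreeCoprime, if_neg]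
      rintro ⟨hsq, -⟩
      apply hlq
      obtain ⟨r, rfl⟩ := hgq
      rw [Nat.gcd_mul_left] at h
      have h2 : l.Coprime r := by
        have := Nat.eq_of_mul_eq_mul_left (Nat.pos_of_ne_zero hg) (h.trans (mul_one g).symm)
        exact this
      exact Nat.Coprime.mul_right (Nat.coprime_of_squarefree_mul hsq).symm h2
    · rfl

lemma sum_filter_gcd_eq {q g : ℕ} (hg : 0 < g) (X : ℕ) (F : ℕ → ℂ) :
    ∑ n ∈ Finset.Icc 1 X with n.gcd q = g, F n =
      ∑ l ∈ Finset.Icc 1 (X / g), if (g * l).gcd q = g then F (g * l) else 0 := by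
  rw [← Finset.sum_filter]
  refine Finset.sum_nbij' (fun n => n / g) (fun l => g * l) ?_ ?_ ?_ ?_ ?_
  · intro n hn
    obtain ⟨h1, h2⟩ := Finset.mem_filter.mp hn
    have hgn : g ∣ n := h2 ▸ Nat.gcd_dvd_left n q
    rw [Finset.mem_Icc] at h1
    rw [Finset.mem_filter, Finset.mem_Icc, Nat.mul_div_cancel' hgn]
    exact ⟨⟨Nat.div_pos (Nat.le_of_dvd h1.1 hgn) hg, Nat.div_le_div_right h1.2⟩, h2⟩
  · intro l hl
    obtain ⟨h1, h2⟩ := Finset.mem_filter.mp hl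
    rw [Finset.mem_Icc] at h1
    rw [Finset.mem_filter, Finset.mem_Icc]
    refine ⟨⟨Nat.mul_pos hg h1.1, ?_⟩, h2⟩
    rw [mul_comm]
    exact (Nat.le_div_iff_mul_le hg).mp h1.2
  · intro n hn
    obtain ⟨h1, h2⟩ := Finset.mem_filter.mp hn
    exact Nat.mul_div_cancel' (h2 ▸ Nat.gcd_dvd_left n q)
  · intro l hl
    exact Nat.mul_div_cancel_left l hg
  · intro n hn
    obtain ⟨h1, h2⟩ := Finset.mem_filter.mp hn
    rw [Nat.mul_div_cancel' (h2 ▸ Nat.gcd_dvd_left n q)]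

/-- Sorting by `g = gcd (n, q)` reduces the modulus to `q / g` and leaves `l` coprime to `q`, where
the character expansion is valid. The new coprimality condition modulo `m q` costs only ε-powers
later. -/
lemma additive_twist_eq_sum {a : ℕ → ℂ}
    (hmul : ∀ m n : ℕ, m ≠ 0 → n ≠ 0 → m.Coprime n → a (m * n) = a m * a n) (m : ℕ) {q : ℕ}
    (hq : q ≠ 0) (b : ℤ) (z : ℂ) (X : ℕ) :
    ∑ n ∈ Finset.Icc 1 X, sqfreeCoprime a m n * (expE (b * n / q) * (n : ℂ) ^ z) =
      ∑ g ∈ q.divisors, sqfreeCoprime a m g * (g : ℂ) ^ z * ∑ l ∈ Finset.Icc 1 (X / g),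
        sqfreeCoprime a (m * q) l * (expE (b * l / (q / g : ℕ)) * (l : ℂ) ^ z) := by
  have hmaps : ∀ n ∈ Finset.Icc 1 X, n.gcd q ∈ q.divisors := fun n _ =>
    Nat.mem_divisors.mpr ⟨Nat.gcd_dvd_right n q, hq⟩
  rw [← Finset.sum_fiberwise_of_maps_to hmaps]
  refine Finset.sum_congr rfl fun g hg => ?_
  have hgq := Nat.dvd_of_mem_divisors hg
  have hg0 : 0 < g := Nat.pos_of_mem_divisors hg
  rw [sum_filter_gcd_eq hg0, Finset.mul_sum]
  refine Finset.sum_congr rfl fun l hl => ?_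
  rw [Finset.mem_Icc] at hl
  have h := sqfreeCoprime_gcd hmul m hq hgq (show l ≠ 0 by omega)
  have he : (b * (g * l : ℕ) / q : ℝ) = b * l / (q / g : ℕ) := by
    rw [Nat.cast_div hgq (by positivity)]
    have : (g : ℝ) ≠ 0 := by positivity
    push_cast
    field_simp
  rw [he, Nat.cast_mul, Complex.natCast_mul_natCast_cpow]
  calc _ = (if (g * l).gcd q = g then sqfreeCoprime a m (g * l) else 0) *
        (expE (b * l / (q / g : ℕ)) * ((g : ℂ) ^ z * (l : ℂ) ^ z)) := by split_ifs <;> simp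
    _ = _ := by rw [h]; ring

end AdditiveTwist

/-! ### Sums with an additive twist -/

section AdditiveTwistBound

lemma sqfreeCoprime_ne_zero_coprime {a : ℕ → ℂ} {M n : ℕ} (h : sqfreeCoprime a M n ≠ 0) :
    n.Coprime M := by
  by_contra h'
  exact h (if_neg fun h2 => h' h2.2)

lemma norm_sqfreeCoprime_le (a : ℕ → ℂ) (M n : ℕ) : ‖sqfreeCoprime a M n‖ ≤ ‖a n‖ := by
  rw [sqfreeCoprime]
  split_ifs <;> simp

lemma additive_twist_coprime_le {a : ℕ → ℂ} {M r : ℕ} (hr : 1 ≤ r) (hrM : r ∣ M) (b : ℤ) (τ : ℝ)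
    (Y : ℕ) {B : ℝ} (hB : ∀ χ : DirichletCharacter ℂ r, ‖∑ n ∈ Finset.Icc 1 Y, sqfreeCoprime a M n *
      (χ (n : ZMod r) * (n : ℂ) ^ (τ * Complex.I))‖ ≤ B) :
    ‖∑ n ∈ Finset.Icc 1 Y, sqfreeCoprime a M n * (expE (b * n / r) *
      (n : ℂ) ^ (τ * Complex.I))‖ ≤ √r * B := by
  have : NeZero r := ⟨by omega⟩
  obtain ⟨c, hc1, hc2⟩ := exists_character_expansion r
    (fun u => ZMod.stdAddChar ((b : ZMod r) * u)) (fun u => (AddChar.norm_apply _ _).le)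
  have hB0 : 0 ≤ B := (norm_nonneg _).trans (hB 1)
  have e : ∑ n ∈ Finset.Icc 1 Y, sqfreeCoprime a M n * (expE (b * n / r) *
      (n : ℂ) ^ (τ * Complex.I)) = ∑ χ : DirichletCharacter ℂ r, c χ *
        ∑ n ∈ Finset.Icc 1 Y, sqfreeCoprime a M n *
          (χ (n : ZMod r) * (n : ℂ) ^ (τ * Complex.I)) := by
    simp_rw [Finset.mul_sum]
    rw [Finset.sum_comm]
    refine Finset.sum_congr rfl fun n _ => ?_
    by_cases h0 : sqfreeCoprime a M n = 0
    · simp [h0]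
    · have hu : IsUnit (n : ZMod r) := (ZMod.isUnit_iff_coprime n r).mpr
        ((sqfreeCoprime_ne_zero_coprime h0).coprime_dvd_right hrM)
      rw [expE_eq_stdAddChar, hc1 _ hu, Finset.sum_mul, Finset.mul_sum]
      exact Finset.sum_congr rfl fun χ _ => by ring
  rw [e]
  calc _ ≤ ∑ χ : DirichletCharacter ℂ r, ‖c χ‖ * B := by
        refine norm_sum_le_of_le _ fun χ _ => ?_
        rw [norm_mul]
        gcongr
        exact hB χ
    _ ≤ √r * B := by rw [← Finset.sum_mul]; gcongr

lemma rpow_le_of_le_mul {m q T x ε : ℝ} (hm : 1 ≤ m) (hq : 1 ≤ q) (hT : 1 ≤ T) (hx : 1 ≤ x)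
    (hε : 0 ≤ ε) : (m * q * q * T * x) ^ (3 * ε) * q ^ (2 * ε) ≤ (m * q * T * x) ^ (8 * ε) := by
  have hm0 : 0 < m := by linarith
  have hq0 : 0 < q := by linarith
  have hT0 : 0 < T := by linarith
  have hx0 : 0 < x := by linarith
  have h1 : q ≤ m * q * T * x := by
    have : 1 ≤ m * T * x := one_le_mul_of_one_le_of_one_le (one_le_mul_of_one_le_of_one_le hm hT) hx
    calc q ≤ q * (m * T * x) := le_mul_of_one_le_right hq0.le this
      _ = _ := by ring
  set B := m * q * T * x with hB
  have hB0 : 0 < B := by positivity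
  calc _ = (B * q) ^ (3 * ε) * q ^ (2 * ε) := by rw [hB]; ring_nf
    _ ≤ (B * B) ^ (3 * ε) * B ^ (2 * ε) := by gcongr
    _ = _ := by
      rw [Real.mul_rpow hB0.le hB0.le, ← Real.rpow_add hB0, ← Real.rpow_add hB0]; ring_nf

lemma exists_sum_rpow_le {ε : ℝ} (hε : 0 < ε) :
    ∃ Z : ℝ, 0 < Z ∧ ∀ s : Finset ℕ, ∑ g ∈ s, (g : ℝ) ^ (-(1 + ε)) ≤ Z := by
  have hs : Summable fun g : ℕ => (g : ℝ) ^ (-(1 + ε)) := Real.summable_nat_rpow.mpr (by linarith)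
  refine ⟨∑' g : ℕ, (g : ℝ) ^ (-(1 + ε)) + 1, ?_, fun s => ?_⟩
  · have : 0 ≤ ∑' g : ℕ, (g : ℝ) ^ (-(1 + ε)) := tsum_nonneg fun g => by positivity
    linarith
  · have := hs.sum_le_tsum s fun g _ => by positivity
    linarith

/-- Both the modulus and the length shrink by `g`, and `√(q / g) √(x / g) = √q √x / g`. Against `|a
g| ≪ g ^ ε` this makes the sum over `g` converge once a power `q ^ (2ε)` is spent. -/
theorem additive_twist_sum_le {a : ℕ → ℂ} {k : ℕ} (ha : SeriesConditions a k) {ε : ℝ} (hε : 0 < ε)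
    (hε' : ε ≤ 1 / 2) :
    ∃ C : ℝ, 0 < C ∧ ∀ m : ℕ, 1 ≤ m → ∀ q : ℕ, 1 ≤ q → ∀ b : ℤ, ∀ τ x : ℝ, 1 ≤ |τ| → 1 ≤ x →
      ‖∑ n ∈ Finset.Icc 1 ⌊x⌋₊, sqfreeCoprime a m n *
          (expE (b * n / q) * (n : ℂ) ^ (τ * Complex.I))‖ ≤
        C * (m * q * (1 + |τ|) * x) ^ (8 * ε) * √q * (√x + x / |τ|) := by
  obtain ⟨C, hC, hC'⟩ := sqfree_twisted_sum_le ha hε hε'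
  obtain ⟨Z, hZ, hZ'⟩ := exists_sum_rpow_le hε
  obtain ⟨A, hA⟩ := ha.ramanujan ε hε
  have hA0 : 0 < A := by
    have := hA 1 le_rfl
    rw [ha.coeff_one] at this
    simp at this
    linarith
  obtain ⟨hmul, -⟩ := ha.eulerProduct.multiplicative ha.summable
  refine ⟨C * A * Z, by positivity, fun m hm q hq b τ x hτ hx => ?_⟩
  have hm1 : (1 : ℝ) ≤ m := by exact_mod_cast hm
  have hq1 : (1 : ℝ) ≤ q := by exact_mod_cast hq
  have hτ0 : 0 < |τ| := by linarith
  have hx0 : 0 < x := by linarith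
  set E : ℝ := C * (m * q * q * (1 + |τ|) * x) ^ (3 * ε) * √q * (√x + x / |τ|) with hE
  have hE0 : 0 ≤ E := by positivity
  rw [additive_twist_eq_sum hmul m (by omega) b]
  have hterm : ∀ g ∈ q.divisors, ‖sqfreeCoprime a m g * (g : ℂ) ^ (τ * Complex.I) *
      ∑ l ∈ Finset.Icc 1 (⌊x⌋₊ / g), sqfreeCoprime a (m * q) l *
        (expE (b * l / (q / g : ℕ)) * (l : ℂ) ^ (τ * Complex.I))‖ ≤
      E * (A * (q : ℝ) ^ (2 * ε)) * (g : ℝ) ^ (-(1 + ε)) := by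
    intro g hg
    have hgq := Nat.dvd_of_mem_divisors hg
    have hg0 : 0 < g := Nat.pos_of_mem_divisors hg
    have hg1 : (1 : ℝ) ≤ g := by exact_mod_cast hg0
    have hgR : (0 : ℝ) < g := by linarith
    have hgle : (g : ℝ) ≤ q := by exact_mod_cast Nat.le_of_dvd hq hgq
    have hcoef : ‖sqfreeCoprime a m g‖ * (g : ℝ)⁻¹ ≤
        A * (q : ℝ) ^ (2 * ε) * (g : ℝ) ^ (-(1 + ε)) := by
      calc _ ≤ A * (g : ℝ) ^ ε * (g : ℝ)⁻¹ := by
            gcongr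
            exact (norm_sqfreeCoprime_le a m g).trans (hA g hg0)
        _ = A * (g : ℝ) ^ (2 * ε) * (g : ℝ) ^ (-(1 + ε)) := by
            rw [mul_assoc, mul_assoc, ← Real.rpow_neg_one, ← Real.rpow_add hgR,
              ← Real.rpow_add hgR]
            ring_nf
        _ ≤ _ := by gcongr
    set r := q / g with hr
    have hr1 : 1 ≤ r := Nat.div_pos (Nat.le_of_dvd hq hgq) hg0
    have hrq : (r : ℝ) ≤ q := by exact_mod_cast Nat.div_le_self q g
    have hrg : (r : ℝ) = q / g := Nat.cast_div hgq (by positivity)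
    have hinner : ‖∑ l ∈ Finset.Icc 1 (⌊x⌋₊ / g), sqfreeCoprime a (m * q) l *
        (expE (b * l / r) * (l : ℂ) ^ (τ * Complex.I))‖ ≤ E * (g : ℝ)⁻¹ := by
      rcases le_or_gt (g : ℝ) x with hgx | hgx
      · have hy : 1 ≤ x / g := (one_le_div hgR).mpr hgx
        have hyx : x / g ≤ x := div_le_self hx0.le hg1
        have h1 := additive_twist_coprime_le (a := a) (M := m * q) hr1
          ((Nat.div_dvd_of_dvd hgq).mul_left m) b τ (⌊x⌋₊ / g)
          (B := C * (m * q * q * (1 + |τ|) * x) ^ (3 * ε) * (√(x / g) + x / g / |τ|)) (by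
            intro χ
            have := hC' (m * q) (Nat.mul_pos hm hq) r hr1 χ τ (x / g) hτ hy
            rw [Nat.floor_div_natCast] at this
            refine this.trans ?_
            push_cast
            gcongr)
        refine h1.trans ?_
        have h2 : √(r : ℝ) * (√(x / g) + x / g / |τ|) ≤ √q * (√x + x / |τ|) * (g : ℝ)⁻¹ := by
          have hs : (g : ℝ)⁻¹ = (√g)⁻¹ * (√g)⁻¹ := by
            rw [← mul_inv, Real.mul_self_sqrt hgR.le]
          have hs1 : (g : ℝ)⁻¹ ≤ (√g)⁻¹ := by
            apply inv_anti₀ (by positivity)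
            exact Real.sqrt_le_iff.mpr ⟨hgR.le, by nlinarith⟩
          rw [hrg, Real.sqrt_div (by positivity), Real.sqrt_div hx0.le]
          calc √q / √g * (√x / √g + x / g / |τ|) =
                √q * (√g)⁻¹ * (√x * (√g)⁻¹ + x / |τ| * (g : ℝ)⁻¹) := by ring
            _ ≤ √q * (√g)⁻¹ * (√x * (√g)⁻¹ + x / |τ| * (√g)⁻¹) := by gcongr
            _ = _ := by rw [hs]; ring
        calc _ = C * (m * q * q * (1 + |τ|) * x) ^ (3 * ε) *
              (√(r : ℝ) * (√(x / g) + x / g / |τ|)) := by ring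
          _ ≤ C * (m * q * q * (1 + |τ|) * x) ^ (3 * ε) * (√q * (√x + x / |τ|) * (g : ℝ)⁻¹) := by
              gcongr
          _ = _ := by rw [hE]; ring
      · have h0 : ⌊x⌋₊ / g = 0 := Nat.div_eq_of_lt ((Nat.floor_lt hx0.le).mpr hgx)
        rw [h0]
        simp only [Finset.Icc_eq_empty_of_lt zero_lt_one, Finset.sum_empty, norm_zero]
        positivity
    rw [norm_mul, norm_mul, norm_natCast_cpow_mul_I hg0, mul_one]
    calc _ ≤ ‖sqfreeCoprime a m g‖ * (E * (g : ℝ)⁻¹) := by gcongr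
      _ = E * (‖sqfreeCoprime a m g‖ * (g : ℝ)⁻¹) := by ring
      _ ≤ E * (A * (q : ℝ) ^ (2 * ε) * (g : ℝ) ^ (-(1 + ε))) := by gcongr
      _ = _ := by ring
  refine (norm_sum_le_of_le _ hterm).trans ?_
  rw [← Finset.mul_sum]
  calc _ ≤ E * (A * (q : ℝ) ^ (2 * ε)) * Z := by
        gcongr
        exact hZ' _
    _ = C * A * Z * ((m * q * q * (1 + |τ|) * x) ^ (3 * ε) * (q : ℝ) ^ (2 * ε)) * √q *
        (√x + x / |τ|) := by rw [hE]; ring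
    _ ≤ _ := by
        gcongr
        exact rpow_le_of_le_mul hm1 hq1 (by linarith) hx hε.le

end AdditiveTwistBound

/-! ### Local approximation of the phase by `A x + B log x` -/

section Phase

lemma PhaseConditions.exists_bounds {f : ℝ → ℝ} (hf : PhaseConditions f) :
    ∃ c C : ℝ, 0 < c ∧ 0 < C ∧ ∀ N : ℝ, 1 ≤ N → 0 < f N → ∀ x : ℝ, N ≤ x → x ≤ 2 * N →
      ∀ j : ℕ, 1 ≤ j → j ≤ 3 →
        c * (f N / N ^ j) ≤ |derivFromOne j f x| ∧ |derivFromOne j f x| ≤ C * (f N / N ^ j) := by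
  obtain ⟨d, _, hd, _, hd'⟩ := hf.doubling
  obtain ⟨c₁, C₁, h1, h1', H1⟩ := hf.deriv_comparable 1 le_rfl (by norm_num)
  obtain ⟨c₂, C₂, h2, h2', H2⟩ := hf.deriv_comparable 2 (by norm_num) (by norm_num)
  obtain ⟨c₃, C₃, h3, h3', H3⟩ := hf.deriv_comparable 3 (by norm_num) le_rfl
  set c := min c₁ (min c₂ c₃) with hc
  set C := max C₁ (max C₂ C₃) with hC
  have hc0 : 0 < c := lt_min h1 (lt_min h2 h3)
  have hC0 : 0 < C := lt_max_of_lt_left h1'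
  have H : ∀ j : ℕ, 1 ≤ j → j ≤ 3 → ∀ x : ℝ, 1 ≤ x →
      c * |f x / x ^ j| ≤ |derivFromOne j f x| ∧ |derivFromOne j f x| ≤ C * |f x / x ^ j| := by
    intro j hj hj' x hx
    interval_cases j
    · refine ⟨le_trans ?_ (H1 x hx).1, (H1 x hx).2.trans ?_⟩ <;> gcongr
      · exact min_le_left _ _
      · exact le_max_left _ _
    · refine ⟨le_trans ?_ (H2 x hx).1, (H2 x hx).2.trans ?_⟩ <;> gcongr
      · exact (min_le_right _ _).trans (min_le_left _ _)
      · exact (le_max_left _ _).trans (le_max_right _ _)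
    · refine ⟨le_trans ?_ (H3 x hx).1, (H3 x hx).2.trans ?_⟩ <;> gcongr
      · exact (min_le_right _ _).trans (min_le_right _ _)
      · exact (le_max_right _ _).trans (le_max_right _ _)
  refine ⟨c / 8, C / d, by positivity, by positivity, fun N hN hfN x hNx hxN j hj hj' => ?_⟩
  have hx : 1 ≤ x := hN.trans hNx
  have hN0 : 0 < N := by linarith
  have hx0 : 0 < x := by linarith
  have hlow : f N ≤ f x := hf.monotone (Set.mem_Ici.mpr hN) (Set.mem_Ici.mpr hx) hNx
  have hfx : 0 < f x := hfN.trans_le hlow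
  have hup : f x ≤ f N / d := by
    have e1 : f x ≤ f (2 * N) := hf.monotone (Set.mem_Ici.mpr hx)
      (Set.mem_Ici.mpr (by linarith)) hxN
    have e2 := (hd' N hN).1
    rw [abs_of_pos hfN, abs_of_pos (hfx.trans_le e1)] at e2
    rw [le_div_iff₀ hd]
    calc f x * d ≤ f (2 * N) * d := by gcongr
      _ ≤ f N := by linarith
  obtain ⟨g1, g2⟩ := H j hj hj' x hx
  rw [abs_of_pos (by positivity : 0 < f x / x ^ j)] at g1 g2
  have h8 : x ^ j ≤ 8 * N ^ j := by
    calc x ^ j ≤ (2 * N) ^ j := by gcongr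
      _ = 2 ^ j * N ^ j := mul_pow _ _ _
      _ ≤ 2 ^ 3 * N ^ j := by gcongr; norm_num
      _ = _ := by norm_num
  constructor
  · refine le_trans ?_ g1
    calc c / 8 * (f N / N ^ j) = c * (f N / (8 * N ^ j)) := by field_simp
      _ ≤ c * (f x / x ^ j) := by gcongr
  · refine g2.trans ?_
    calc C * (f x / x ^ j) ≤ C * (f N / d / N ^ j) := by gcongr
      _ = _ := by field_simp

lemma hasDerivWithinAt_derivFromOne {f : ℝ → ℝ} (hf : ContDiffOn ℝ 3 f (Set.Ici 1)) {j : ℕ}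
    (hj : j < 3) {x : ℝ} (hx : 1 ≤ x) :
    HasDerivWithinAt (derivFromOne j f) (derivFromOne (j + 1) f x) (Set.Ici 1) x := by
  have h : DifferentiableOn ℝ (iteratedDerivWithin j f (Set.Ici 1)) (Set.Ici 1) :=
    hf.differentiableOn_iteratedDerivWithin (by exact_mod_cast hj) (uniqueDiffOn_Ici 1)
  have := (h x hx).hasDerivWithinAt
  rwa [← iteratedDerivWithin_succ] at this

lemma abs_sub_le_of_derivWithin {g g' : ℝ → ℝ} {X h K : ℝ}
    (hg : ∀ x ∈ Set.Icc X (X + h), HasDerivWithinAt g (g' x) (Set.Icc X (X + h)) x)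
    (hK : ∀ x ∈ Set.Icc X (X + h), |g' x| ≤ K) {x : ℝ} (hx : x ∈ Set.Icc X (X + h)) :
    |g x - g X| ≤ K * h := by
  have hX : X ∈ Set.Icc X (X + h) := ⟨le_rfl, hx.1.trans hx.2⟩
  have hK0 : 0 ≤ K := (abs_nonneg _).trans (hK X hX)
  have := (convex_Icc X (X + h)).norm_image_sub_le_of_norm_hasDerivWithin_le
    (f := g) (f' := g') hg hK hX hx
  rw [Real.norm_eq_abs, Real.norm_eq_abs, abs_of_nonneg (sub_nonneg.mpr hx.1)] at this
  refine this.trans ?_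
  gcongr
  linarith [hx.2]

/-- With this `B` the remainder has zero first derivative at `X`. Its second derivative there is the
first coefficient of the bound, and its third derivative is bounded throughout the block.
Integrating three times from `X` gives the `h ^ 2` and `h ^ 3` terms. -/
lemma phase_expansion {f : ℝ → ℝ} (hf : ContDiffOn ℝ 3 f (Set.Ici 1)) {X h A B T : ℝ} (hX : 1 ≤ X)
    (hh : 0 ≤ h) (hB : B = X * (derivFromOne 1 f X - A))
    (hT : ∀ x ∈ Set.Icc X (X + h), |derivFromOne 3 f x| ≤ T) {x : ℝ}
    (hx : x ∈ Set.Icc X (X + h)) :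
    |(f x - A * x - B * Real.log x) - (f X - A * X - B * Real.log X)| ≤
      |derivFromOne 1 f X + X * derivFromOne 2 f X - A| / X * h ^ 2 +
        (T + 2 * |B| / X ^ 3) * h ^ 3 := by
  have hX0 : 0 < X := by linarith
  have hmem : X ∈ Set.Icc X (X + h) := ⟨le_rfl, by linarith⟩
  have hsub : Set.Icc X (X + h) ⊆ Set.Ici 1 := fun y hy => hX.trans hy.1
  have hd : ∀ j : ℕ, j < 3 → ∀ y ∈ Set.Icc X (X + h),
      HasDerivWithinAt (derivFromOne j f) (derivFromOne (j + 1) f y) (Set.Icc X (X + h)) y :=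
    fun j hj y hy => (hasDerivWithinAt_derivFromOne hf hj (hsub hy)).mono hsub
  have hf0 : derivFromOne 0 f = f := iteratedDerivWithin_zero
  set g₁ : ℝ → ℝ := fun y => derivFromOne 1 f y - A - B / y with hg₁
  set g₂ : ℝ → ℝ := fun y => derivFromOne 2 f y + B / y ^ 2 with hg₂
  set g₃ : ℝ → ℝ := fun y => derivFromOne 3 f y - 2 * B / y ^ 3 with hg₃
  have D0 : ∀ y ∈ Set.Icc X (X + h), HasDerivWithinAt (fun y => f y - A * y - B * Real.log y)
      (g₁ y) (Set.Icc X (X + h)) y := by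
    intro y hy
    have hy0 : y ≠ 0 := (hX0.trans_le hy.1).ne'
    have h0 := hd 0 (by norm_num) y hy
    rw [hf0] at h0
    have h1 := ((hasDerivAt_id y).const_mul A).hasDerivWithinAt (s := Set.Icc X (X + h))
    have h2 := ((Real.hasDerivAt_log hy0).const_mul B).hasDerivWithinAt (s := Set.Icc X (X + h))
    refine ((h0.sub h1).sub h2).congr_deriv ?_
    simp only [hg₁, zero_add, mul_one, div_eq_mul_inv]
  have D1 : ∀ y ∈ Set.Icc X (X + h), HasDerivWithinAt g₁ (g₂ y) (Set.Icc X (X + h)) y := by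
    intro y hy
    have hy0 : y ≠ 0 := (hX0.trans_le hy.1).ne'
    have h2 := ((hasDerivAt_inv hy0).const_mul B).hasDerivWithinAt (s := Set.Icc X (X + h))
    have h3 := ((hd 1 (by norm_num) y hy).sub_const A).sub h2
    refine (h3.congr_of_eventuallyEq ?_ ?_).congr_deriv ?_
    · exact Filter.Eventually.of_forall fun z => by simp [hg₁, div_eq_mul_inv]
    · simp [hg₁, div_eq_mul_inv]
    · simp only [hg₂]; field_simp; ring
  have D2 : ∀ y ∈ Set.Icc X (X + h), HasDerivWithinAt g₂ (g₃ y) (Set.Icc X (X + h)) y := by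
    intro y hy
    have hy0 : y ≠ 0 := (hX0.trans_le hy.1).ne'
    have h2 := (((hasDerivAt_pow 2 y).fun_inv (pow_ne_zero 2 hy0)).const_mul B).hasDerivWithinAt
      (s := Set.Icc X (X + h))
    have h3 := (hd 2 (by norm_num) y hy).add h2
    refine (h3.congr_of_eventuallyEq ?_ ?_).congr_deriv ?_
    · exact Filter.Eventually.of_forall fun z => by simp [hg₂, div_eq_mul_inv]
    · simp [hg₂, div_eq_mul_inv]
    · simp only [hg₃]; field_simp; ring
  have e1 : g₁ X = 0 := by
    simp only [hg₁, hB]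
    field_simp
    ring
  have e2 : |g₂ X| = |derivFromOne 1 f X + X * derivFromOne 2 f X - A| / X := by
    rw [← abs_of_pos hX0, ← abs_div, abs_of_pos hX0]
    congr 1
    simp only [hg₂, hB]
    field_simp
    ring
  set W := |derivFromOne 1 f X + X * derivFromOne 2 f X - A| / X with hW
  set V := T + 2 * |B| / X ^ 3 with hV
  have b3 : ∀ y ∈ Set.Icc X (X + h), |g₃ y| ≤ V := by
    intro y hy
    have hy0 : 0 < y := hX0.trans_le hy.1
    calc |g₃ y| ≤ |derivFromOne 3 f y| + |2 * B / y ^ 3| := abs_sub _ _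
      _ ≤ T + 2 * |B| / X ^ 3 := by
          rw [abs_div, abs_mul, abs_of_pos (by positivity : 0 < y ^ 3), abs_two]
          gcongr
          · exact hT y hy
          · exact hy.1
  have b2 : ∀ y ∈ Set.Icc X (X + h), |g₂ y| ≤ W + V * h := by
    intro y hy
    have h1 := abs_sub_le_of_derivWithin D2 b3 hy
    have h2 : |g₂ y| ≤ |g₂ y - g₂ X| + |g₂ X| := by
      simpa using abs_add_le (g₂ y - g₂ X) (g₂ X)
    linarith
  have b1 : ∀ y ∈ Set.Icc X (X + h), |g₁ y| ≤ (W + V * h) * h := by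
    intro y hy
    have h1 := abs_sub_le_of_derivWithin D1 b2 hy
    rwa [e1, sub_zero] at h1
  refine (abs_sub_le_of_derivWithin D0 b1 hx).trans (le_of_eq ?_)
  ring

/-- `d₁ - b / q` is the Dirichlet error minus `X d₂`, and `|X d₂| ≍ F / N`. So `B = X (d₁ - b / q)`
has size `F` as soon as the Dirichlet error is small compared with `F / N`. -/
lemma exists_rational_approx {c C F N X d₁ d₂ : ℝ} (hc : 0 < c) (hC : 0 < C) (hF : 0 < F)
    (hN : 0 < N) (hNX : N ≤ X) (hXN : X ≤ 2 * N) (h1 : c * (F / N) ≤ |d₁|) (h1' : |d₁| ≤ C * (F / N))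
    (h2 : c * (F / N ^ 2) ≤ |d₂|) (h2' : |d₂| ≤ C * (F / N ^ 2)) {Q : ℕ} (hQ : 12 * C / c ≤ Q) :
    ∃ (b : ℤ) (q : ℕ), 1 ≤ q ∧ q ≤ Q ∧ |d₁ + X * d₂ - b / q| ≤ 1 / (q * Q) ∧
      c / 2 * F ≤ |X * (d₁ - b / q)| ∧ |X * (d₁ - b / q)| ≤ 6 * C * F := by
  have hcC : c ≤ C := by
    have := h1.trans h1'
    have h0 : 0 < F / N := by positivity
    exact le_of_mul_le_mul_right this h0
  have hQ12 : (12 : ℝ) ≤ Q := by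
    refine le_trans ?_ hQ
    rw [le_div_iff₀ hc]
    linarith
  have hQ0 : (0 : ℝ) < Q := by linarith
  have hQpos : 0 < Q := by exact_mod_cast hQ0
  have hX0 : 0 < X := by linarith
  obtain ⟨b, q', hq1, hq2, hbq⟩ := Real.exists_int_int_abs_mul_sub_le (d₁ + X * d₂) hQpos
  lift q' to ℕ using hq1.le
  rename ℕ => q
  have hq0 : 0 < q := by exact_mod_cast hq1
  have hqR : (0 : ℝ) < q := by exact_mod_cast hq0
  set u := (b : ℝ) / q with hu
  have hβ : |d₁ + X * d₂ - u| ≤ 1 / (q * Q) := by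
    have e : d₁ + X * d₂ - u = (q * (d₁ + X * d₂) - b) / q := by rw [hu]; field_simp
    rw [e, abs_div, abs_of_pos hqR, div_le_div_iff₀ hqR (by positivity)]
    have h3 : |(q : ℝ) * (d₁ + X * d₂) - b| ≤ 1 / Q := by
      refine le_trans ?_ (one_div_le_one_div_of_le hQ0 (by linarith : (Q : ℝ) ≤ Q + 1))
      exact_mod_cast hbq
    rw [le_div_iff₀ hQ0] at h3
    nlinarith
  have hXd₂ : c * (F / N) ≤ |X * d₂| ∧ |X * d₂| ≤ 2 * C * (F / N) := by
    rw [abs_mul, abs_of_pos hX0]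
    constructor
    · calc c * (F / N) = N * (c * (F / N ^ 2)) := by field_simp
        _ ≤ X * |d₂| := by gcongr
    · calc X * |d₂| ≤ 2 * N * (C * (F / N ^ 2)) := by gcongr
        _ = _ := by field_simp
  have key : c / 2 * (F / N) ≤ |d₁ - u| ∧ |d₁ - u| ≤ 3 * C * (F / N) := by
    have hFN : 0 < F / N := by positivity
    -- If `b = 0`, the size of `d₁` settles the claim. If `b ≠ 0`, then `1 / q ≤ |b / q| ≪ F / N`,
    -- so the error `1 / (q Q)` gains a further factor `Q`, and `Q ≥ 12 C / c` makes it at most `(c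
    -- / 2) F / N`.
    rcases eq_or_ne b 0 with hb | hb
    · have hu0 : u = 0 := by rw [hu, hb]; simp
      rw [hu0, sub_zero]
      constructor <;> nlinarith
    · have hb1 : (1 : ℝ) ≤ |(b : ℝ)| := by exact_mod_cast Int.one_le_abs hb
      have hu1 : 1 / (q : ℝ) ≤ |u| := by
        rw [hu, abs_div, abs_of_pos hqR]
        gcongr
      have hu2 : |u| ≤ |d₁| + |X * d₂| + |d₁ + X * d₂ - u| := by
        have e : u = d₁ + X * d₂ - (d₁ + X * d₂ - u) := by ring
        calc |u| = |d₁ + X * d₂ - (d₁ + X * d₂ - u)| := by rw [← e]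
          _ ≤ |d₁ + X * d₂| + |d₁ + X * d₂ - u| := abs_sub _ _
          _ ≤ _ := by gcongr; exact abs_add_le _ _
      have h3 : 1 / ((q : ℝ) * Q) = 1 / q / Q := by field_simp
      set v := 1 / (q : ℝ) with hv
      have hv0 : 0 < v := by positivity
      have h4 : v / Q ≤ v / 2 := by gcongr; linarith
      have h5 : v ≤ 6 * C * (F / N) := by
        rw [h3] at hβ
        nlinarith [hXd₂.2]
      have h6 : v / Q ≤ c / 2 * (F / N) := by
        rw [div_le_iff₀ hQ0]
        rw [div_le_iff₀ hc] at hQ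
        nlinarith
      have h7 : |d₁ + X * d₂ - u| ≤ c / 2 * (F / N) := hβ.trans (h3.trans_le h6)
      have e : d₁ - u = (d₁ + X * d₂ - u) - X * d₂ := by ring
      constructor
      · have := abs_sub_abs_le_abs_sub (X * d₂) (d₁ + X * d₂ - u)
        rw [abs_sub_comm (X * d₂) (d₁ + X * d₂ - u), ← e] at this
        linarith [hXd₂.1]
      · have := abs_sub (d₁ + X * d₂ - u) (X * d₂)
        rw [← e] at this
        nlinarith [hXd₂.2]
  refine ⟨b, q, hq0, by exact_mod_cast hq2, hβ, ?_, ?_⟩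
  · rw [abs_mul, abs_of_pos hX0]
    calc c / 2 * F = N * (c / 2 * (F / N)) := by field_simp
      _ ≤ X * |d₁ - u| := by gcongr; exact key.1
  · rw [abs_mul, abs_of_pos hX0]
    calc X * |d₁ - u| ≤ 2 * N * (3 * C * (F / N)) := by gcongr; exact key.2
      _ = 6 * C * F := by field_simp; ring

end Phase

/-! ### Elementary properties of `e(x)` -/

section Exponential

lemma expE_add (x y : ℝ) : expE (x + y) = expE x * expE y := by
  rw [expE, expE, expE, ← Complex.exp_add]
  push_cast
  ring_nf

lemma norm_expE (x : ℝ) : ‖expE x‖ = 1 := by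
  rw [expE, show (2 * Real.pi * Complex.I * x : ℂ) = ((2 * Real.pi * x : ℝ) : ℂ) * Complex.I by
    push_cast; ring]
  exact Complex.norm_exp_ofReal_mul_I _

lemma norm_expE_sub_le (x y : ℝ) : ‖expE x - expE y‖ ≤ 2 * Real.pi * |x - y| := by
  have h : expE x - expE y = expE y * (expE (x - y) - 1) := by
    rw [mul_sub, ← expE_add]; simp
  rw [h, norm_mul, norm_expE, one_mul, expE, show (2 * Real.pi * Complex.I * (x - y : ℝ) : ℂ) =
    Complex.I * ((2 * Real.pi * (x - y) : ℝ) : ℂ) by push_cast; ring]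
  refine (Real.norm_exp_I_mul_ofReal_sub_one_le).trans (le_of_eq ?_)
  rw [Real.norm_eq_abs, abs_mul, abs_of_pos (by positivity)]

lemma expE_mul_log (B : ℝ) {n : ℕ} (hn : 1 ≤ n) :
    expE (B * Real.log n) = (n : ℂ) ^ (((2 * Real.pi * B : ℝ) : ℂ) * Complex.I) := by
  have h0 : (n : ℂ) ≠ 0 := by exact_mod_cast (by omega : n ≠ 0)
  rw [Complex.cpow_def_of_ne_zero h0, expE, Complex.natCast_log.symm]
  push_cast
  ring_nf

end Exponential

/-! ### Covering an interval by blocks of varying length -/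

/-- Blocks are taken greedily from the left; the lower bound `κ` makes this terminate. Complete
blocks have total length at most `N' - N`, and the last one, possibly cut short, accounts for `E *
H`. -/
lemma norm_sum_Ioc_le_of_blocks {G : ℕ → ℂ} {N N' κ H E : ℝ} (hκ : 0 < κ) (hE : 0 ≤ E)
    (hNN : N ≤ N')
    (hG : ∀ X : ℝ, N ≤ X → X ≤ N' → ∃ h : ℝ, κ ≤ h ∧ h ≤ H ∧ ∀ Y : ℝ, X ≤ Y → Y ≤ X + h → Y ≤ N' →
      ‖∑ n ∈ Finset.Ioc ⌊X⌋₊ ⌊Y⌋₊, G n‖ ≤ E * h) :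
    ‖∑ n ∈ Finset.Ioc ⌊N⌋₊ ⌊N'⌋₊, G n‖ ≤ E * (N' - N) + E * H := by
  have key : ∀ j : ℕ, ∀ X : ℝ, N ≤ X → X ≤ N' → N' - X ≤ j * κ →
      ‖∑ n ∈ Finset.Ioc ⌊X⌋₊ ⌊N'⌋₊, G n‖ ≤ E * (N' - X) + E * H := by
    intro j
    induction j with
    | zero =>
      intro X hX hX' hj
      have : X = N' := by
        push_cast at hj
        linarith
      obtain ⟨h, h1, h2, -⟩ := hG X hX hX'
      subst this
      have hH : 0 ≤ H := by linarith
      simp only [Finset.Ioc_self, Finset.sum_empty, norm_zero, sub_self, mul_zero, zero_add]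
      positivity
    | succ j ih =>
      intro X hX hX' hj
      obtain ⟨h, h1, h2, h3⟩ := hG X hX hX'
      rcases le_or_gt N' (X + h) with hc | hc
      · have h4 := h3 N' hX' hc le_rfl
        have h5 : E * h ≤ E * H := by gcongr
        have h6 : 0 ≤ E * (N' - X) := mul_nonneg hE (by linarith)
        linarith
      · have h4 := h3 (X + h) (by linarith) le_rfl hc.le
        have h5 := ih (X + h) (by linarith) hc.le (by push_cast at hj; linarith)
        rw [← Finset.sum_Ioc_consecutive G (Nat.floor_mono (by linarith : X ≤ X + h))
          (Nat.floor_mono hc.le)]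
        refine (norm_add_le _ _).trans ?_
        linarith
  obtain ⟨j, hj⟩ := exists_nat_ge ((N' - N) / κ)
  exact key j N le_rfl hNN ((div_le_iff₀ hκ).mp hj)

/-! ### Block lengths and the estimates on one block -/

section Blocks

/-- No partial summation is needed: the slowly varying phase is frozen at `ψ₀`, and the error is
bounded termwise by the Lipschitz constant `2π`. -/
lemma norm_sum_mul_expE_le {s : Finset ℕ} (c w : ℕ → ℂ) (φ ψ : ℕ → ℝ) (ψ₀ : ℝ) {δ : ℝ}
    (hφ : ∀ n ∈ s, expE (φ n) = w n * expE (ψ n)) (hw : ∀ n ∈ s, ‖w n‖ = 1)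
    (hψ : ∀ n ∈ s, |ψ n - ψ₀| ≤ δ) :
    ‖∑ n ∈ s, c n * expE (φ n)‖ ≤ ‖∑ n ∈ s, c n * w n‖ + 2 * Real.pi * δ * ∑ n ∈ s, ‖c n‖ := by
  have e : ∑ n ∈ s, c n * expE (φ n) = (∑ n ∈ s, c n * w n) * expE ψ₀ +
      ∑ n ∈ s, c n * w n * (expE (ψ n) - expE ψ₀) := by
    rw [Finset.sum_mul, ← Finset.sum_add_distrib]
    refine Finset.sum_congr rfl fun n hn => ?_
    rw [hφ n hn]
    ring
  rw [e]
  refine (norm_add_le _ _).trans ?_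
  rw [norm_mul, norm_expE, mul_one, Finset.mul_sum]
  gcongr
  refine norm_sum_le_of_le _ fun n hn => ?_
  rw [norm_mul, norm_mul, hw n hn, mul_one, mul_comm]
  gcongr
  refine (norm_expE_sub_le _ _).trans ?_
  have := hψ n hn
  gcongr

/-- The three conditions on `h` ask for enough cancellation and for small quadratic and cubic phase
errors. The length is the largest one permitted by the two phase errors; what has to be checked is
that it still leaves enough cancellation. -/
lemma exists_block_length {K N F R : ℝ} (hK : 1 ≤ K) (hN : 1 ≤ N) (hF1 : √N ≤ F)
    (hF2 : F ≤ N ^ (3 / 2 : ℝ)) (hR : R = (N ^ (3 / 2 : ℝ) / F) ^ (-(1 / 11) : ℝ)) :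
    0 < R ∧ R ≤ 1 ∧ ∃ Q : ℕ, K ≤ Q ∧ (Q : ℝ) ≤ 2 * K * N ∧ ∀ q : ℕ, 1 ≤ q → q ≤ Q →
      ∃ h : ℝ, 0 < h ∧ h ≤ N ∧ √q * √N ≤ √(2 * K) * (R * h) ∧ h ^ 2 ≤ N * q * Q * R ∧
        h ^ 3 * F ≤ N ^ 3 * R ∧ 1 ≤ √(2 * K) * h := by
  have hN0 : 0 < N := by linarith
  have hsN : 1 ≤ √N := Real.one_le_sqrt.mpr hN
  have hF1' : 1 ≤ F := hsN.trans hF1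
  have hF : 0 < F := by linarith
  set S := N ^ (3 / 2 : ℝ) / F with hS
  have hS1 : 1 ≤ S := (one_le_div hF).mpr hF2
  have hS0 : 0 < S := by linarith
  have hSN : S ≤ N := by
    rw [hS, div_le_iff₀ hF]
    calc N ^ (3 / 2 : ℝ) = N * √N := by
          rw [Real.sqrt_eq_rpow, ← Real.rpow_one_add' hN0.le (by norm_num)]; norm_num
      _ ≤ N * F := by gcongr
  have hR0 : 0 < R := by rw [hR]; positivity
  have hR1 : R ≤ 1 := by rw [hR]; exact Real.rpow_le_one_of_one_le_of_nonpos hS1 (by norm_num)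
  have hR3 : S ^ (3 / 11 : ℝ) * R ^ 3 = 1 := by
    rw [hR, ← Real.rpow_natCast, ← Real.rpow_mul hS0.le, ← Real.rpow_add hS0]
    norm_num
  have hP1 : 1 ≤ S ^ (3 / 11 : ℝ) := Real.one_le_rpow hS1 (by norm_num)
  have hPS : S ^ (3 / 11 : ℝ) ≤ S := by
    calc _ ≤ S ^ (1 : ℝ) := Real.rpow_le_rpow_of_exponent_le hS1 (by norm_num)
      _ = S := Real.rpow_one S
  have hKP : 1 ≤ K * S ^ (3 / 11 : ℝ) := one_le_mul_of_one_le_of_one_le hK hP1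
  have hQ1 : K * S ^ (3 / 11 : ℝ) ≤ ⌈K * S ^ (3 / 11 : ℝ)⌉₊ := Nat.le_ceil _
  have hQ2 : (⌈K * S ^ (3 / 11 : ℝ)⌉₊ : ℝ) ≤ 2 * K * S ^ (3 / 11 : ℝ) := by
    have := Nat.ceil_lt_add_one (show 0 ≤ K * S ^ (3 / 11 : ℝ) by linarith)
    linarith
  -- With `R = S ^ (-1/11)` this is the size of `Q` for which `Q R ^ 3 ≥ 1`, which is what `√(q N) ≤
  -- R √(N q Q R)` requires.
  set Q := ⌈K * S ^ (3 / 11 : ℝ)⌉₊ with hQ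
  have hQ3 : 1 ≤ Q * R ^ 3 := by
    calc 1 = S ^ (3 / 11 : ℝ) * R ^ 3 := hR3.symm
      _ ≤ K * S ^ (3 / 11 : ℝ) * R ^ 3 := by
          gcongr
          exact le_mul_of_one_le_left (by positivity) hK
      _ ≤ _ := by gcongr
  have hQ0 : (0 : ℝ) < Q := by linarith
  refine ⟨hR0, hR1, Q, ?_, ?_, fun q hq hqQ => ?_⟩
  · exact le_trans (le_mul_of_one_le_right (by linarith) hP1) hQ1
  · refine hQ2.trans ?_
    gcongr
    exact hPS.trans hSN
  have hq0 : (0 : ℝ) < q := by exact_mod_cast hq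
  have hq1 : (1 : ℝ) ≤ q := by exact_mod_cast hq
  have hqQ' : (q : ℝ) ≤ Q := by exact_mod_cast hqQ
  set h₁ := N * (R / F) ^ (1 / 3 : ℝ) with hh₁
  set h₂ := √(N * q * Q * R) with hh₂
  have hh₁0 : 0 < h₁ := by positivity
  have hh₂0 : 0 < h₂ := by positivity
  have hcube : h₁ ^ 3 * F = N ^ 3 * R := by
    rw [hh₁, mul_pow, ← Real.rpow_natCast ((R / F) ^ (1 / 3 : ℝ)), ← Real.rpow_mul (by positivity)]
    norm_num
    field_simp
  have hK2 : 1 ≤ √(2 * K) := Real.one_le_sqrt.mpr (by linarith)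
  -- Here `R h₁ = √N S ^ (1/3 - 4/33) = √N S ^ (7/33)`, while `√q ≤ √(2K) S ^ (3/22)`, and `3/22 ≤
  -- 7/33`.
  have b1 : √q * √N ≤ √(2 * K) * (R * h₁) := by
    have e1 : √q ≤ √(2 * K) * S ^ (3 / 22 : ℝ) := by
      have : S ^ (3 / 22 : ℝ) = √(S ^ (3 / 11 : ℝ)) := by
        rw [Real.sqrt_eq_rpow, ← Real.rpow_mul hS0.le]; norm_num
      rw [this, ← Real.sqrt_mul (by positivity)]
      exact Real.sqrt_le_sqrt (hqQ'.trans hQ2)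
    have e2 : √N * S ^ (3 / 22 : ℝ) ≤ R * h₁ := by
      have hS3 : S ^ (1 / 3 : ℝ) = √N * (1 / F) ^ (1 / 3 : ℝ) := by
        rw [hS, div_eq_mul_one_div, Real.mul_rpow (by positivity) (by positivity),
          ← Real.rpow_mul hN0.le, Real.sqrt_eq_rpow]
        norm_num
      have hRh : R * h₁ = √N * (S ^ (-(4 / 33) : ℝ) * S ^ (1 / 3 : ℝ)) := by
        rw [hS3, hh₁, div_eq_mul_one_div R, Real.mul_rpow hR0.le (by positivity)]
        have hR4 : S ^ (-(4 / 33) : ℝ) = R * R ^ (1 / 3 : ℝ) := by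
          rw [hR, ← Real.rpow_mul hS0.le, ← Real.rpow_add hS0]
          norm_num
        rw [hR4]
        nth_rewrite 1 [← Real.mul_self_sqrt hN0.le]
        ring
      rw [hRh, ← Real.rpow_add hS0]
      gcongr
      norm_num
    calc √q * √N ≤ √(2 * K) * S ^ (3 / 22 : ℝ) * √N := by gcongr
      _ = √(2 * K) * (√N * S ^ (3 / 22 : ℝ)) := by ring
      _ ≤ _ := by gcongr
  have b2 : √q * √N ≤ √(2 * K) * (R * h₂) := by
    have e1 : √q * √N ≤ R * h₂ := by
      rw [← Real.sqrt_mul hq0.le, hh₂]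
      nth_rewrite 1 [← Real.sqrt_sq hR0.le]
      rw [← Real.sqrt_mul (by positivity)]
      apply Real.sqrt_le_sqrt
      calc q * N ≤ q * N * (Q * R ^ 3) := le_mul_of_one_le_right (by positivity) hQ3
        _ = _ := by ring
    refine e1.trans (le_mul_of_one_le_left (by positivity) hK2)
  have b3 : √q * √N ≤ √(2 * K) * (R * min h₁ h₂) := by
    rcases min_choice h₁ h₂ with h | h <;> rw [h]
    · exact b1
    · exact b2
  have hmin : 0 < min h₁ h₂ := lt_min hh₁0 hh₂0
  refine ⟨min h₁ h₂, hmin, ?_, b3, ?_, ?_, ?_⟩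
  · refine (min_le_left _ _).trans ?_
    refine mul_le_of_le_one_right hN0.le (Real.rpow_le_one (by positivity) ?_ (by norm_num))
    rw [div_le_one hF]
    linarith
  · calc (min h₁ h₂) ^ 2 ≤ h₂ ^ 2 := by
          gcongr
          exact min_le_right _ _
      _ = _ := Real.sq_sqrt (by positivity)
  · calc (min h₁ h₂) ^ 3 * F ≤ h₁ ^ 3 * F := by
          gcongr
          exact min_le_left _ _
      _ = _ := hcube
  · calc (1 : ℝ) ≤ √q * √N :=
          one_le_mul_of_one_le_of_one_le (Real.one_le_sqrt.mpr hq1) hsN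
      _ ≤ √(2 * K) * (R * min h₁ h₂) := b3
      _ ≤ _ := by
          gcongr
          exact mul_le_of_le_one_left hmin.le hR1

lemma norm_sum_Ioc_floor_le (g : ℕ → ℂ) {X Y B : ℝ} (hXY : X ≤ Y)
    (hX : ‖∑ n ∈ Finset.Icc 1 ⌊X⌋₊, g n‖ ≤ B) (hY : ‖∑ n ∈ Finset.Icc 1 ⌊Y⌋₊, g n‖ ≤ B) :
    ‖∑ n ∈ Finset.Ioc ⌊X⌋₊ ⌊Y⌋₊, g n‖ ≤ 2 * B := by
  rw [Icc_one_eq_Ioc_zero] at hX hY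
  have h := Finset.sum_Ioc_consecutive g (Nat.zero_le ⌊X⌋₊) (Nat.floor_mono hXY)
  rw [eq_sub_of_add_eq' h]
  refine (norm_sub_le _ _).trans ?_
  linarith

lemma card_Ioc_floor_le {X Y : ℝ} (hX : 0 ≤ X) (hXY : X ≤ Y) :
    ((Finset.Ioc ⌊X⌋₊ ⌊Y⌋₊).card : ℝ) ≤ Y - X + 1 := by
  rw [Nat.card_Ioc, Nat.cast_sub (Nat.floor_mono hXY)]
  have h1 := Nat.floor_le (hX.trans hXY)
  have h2 := Nat.lt_floor_add_one X
  linarith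

lemma sum_norm_sqfreeCoprime_le {a : ℕ → ℂ} {A ε : ℝ} (hA : 0 ≤ A) (hε : 0 ≤ ε)
    (ha : ∀ n : ℕ, 1 ≤ n → ‖a n‖ ≤ A * (n : ℝ) ^ ε) (m : ℕ) {N X Y : ℝ} (hX : 0 ≤ X)
    (hXY : X ≤ Y) (hY : Y ≤ 2 * N) :
    ∑ n ∈ Finset.Ioc ⌊X⌋₊ ⌊Y⌋₊, ‖sqfreeCoprime a m n‖ ≤ A * (2 * N) ^ ε * (Y - X + 1) := by
  have h1 := sum_norm_le_of_ramanujan (c := sqfreeCoprime a m) hA hε (y := 2 * N)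
    (fun n hn => (norm_sqfreeCoprime_le a m n).trans (ha n hn)) (Finset.Ioc ⌊X⌋₊ ⌊Y⌋₊) (by
      intro n hn
      rw [Finset.mem_Ioc] at hn
      exact ⟨by omega, (Nat.le_floor_iff (hX.trans hXY)).mp hn.2 |>.trans hY⟩)
  refine h1.trans ?_
  have h0 : 0 ≤ 2 * N := by linarith
  gcongr
  exact card_Ioc_floor_le hX hXY

end Blocks

/-! ### The exponential sum over one block -/

section BlockSum

lemma additive_twist_block_le {a : ℕ → ℂ} {k : ℕ} (ha : SeriesConditions a k) {ε : ℝ} (hε : 0 < ε)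
    (hε' : ε ≤ 1 / 2) :
    ∃ C : ℝ, 0 < C ∧ ∀ m : ℕ, 1 ≤ m → ∀ q : ℕ, 1 ≤ q → ∀ b : ℤ, ∀ τ N X Y : ℝ, 1 ≤ |τ| →
      1 ≤ X → X ≤ Y → Y ≤ 2 * N →
      ‖∑ n ∈ Finset.Ioc ⌊X⌋₊ ⌊Y⌋₊, sqfreeCoprime a m n *
          (expE (b * n / q) * (n : ℂ) ^ (τ * Complex.I))‖ ≤
        C * (m * q * (1 + |τ|) * (2 * N)) ^ (8 * ε) * √q * (√(2 * N) + 2 * N / |τ|) := by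
  obtain ⟨C, hC, hC'⟩ := additive_twist_sum_le ha hε hε'
  refine ⟨2 * C, by positivity, fun m hm q hq b τ N X Y hτ hX hXY hY => ?_⟩
  have hτ0 : 0 < |τ| := by linarith
  have h : ∀ x : ℝ, 1 ≤ x → x ≤ 2 * N → ‖∑ n ∈ Finset.Icc 1 ⌊x⌋₊, sqfreeCoprime a m n *
          (expE (b * n / q) * (n : ℂ) ^ (τ * Complex.I))‖ ≤
        C * (m * q * (1 + |τ|) * (2 * N)) ^ (8 * ε) * √q * (√(2 * N) + 2 * N / |τ|) := by
    intro x hx hxN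
    refine (hC' m hm q hq b τ x hτ hx).trans ?_
    have hx0 : 0 < x := by linarith
    have hN0 : 0 < N := by linarith
    gcongr
  refine (norm_sum_Ioc_floor_le _ hXY (h X hX (hXY.trans hY)) (h Y (hX.trans hXY) hY)).trans
    (le_of_eq ?_)
  ring

lemma four_mul_rpow_le {m q T N L ε δ : ℝ} (hm : 1 ≤ m) (hN : 1 ≤ N) (hq : 0 ≤ q) (hT : 0 ≤ T)
    (hL : 0 < L) (hqT : q * T * (2 * N) ≤ L * N ^ 4) (hδ : 0 ≤ δ) (hδε : 32 * δ ≤ ε) :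
    (m * q * T * (2 * N)) ^ (8 * δ) ≤ L ^ (8 * δ) * (m ^ ε * N ^ ε) := by
  have hN0 : 0 < N := by linarith
  have hm0 : 0 < m := by linarith
  calc _ ≤ (L * (m * N ^ 4)) ^ (8 * δ) := by
        refine Real.rpow_le_rpow (by positivity) ?_ (by positivity)
        calc m * q * T * (2 * N) = m * (q * T * (2 * N)) := by ring
          _ ≤ m * (L * N ^ 4) := by gcongr
          _ = L * (m * N ^ 4) := by ring
    _ = L ^ (8 * δ) * (m ^ (8 * δ) * N ^ (32 * δ)) := by
        rw [Real.mul_rpow hL.le (by positivity), Real.mul_rpow hm0.le (by positivity),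
          ← Real.rpow_natCast, ← Real.rpow_mul hN0.le]
        ring_nf
    _ ≤ _ := by
        gcongr
        linarith

set_option maxHeartbeats 1000000 in
/-- On each starting point `X` there is a block length `h` for which the sums over subintervals of
`(X, X + h]` starting at `X` save the factor `(N ^ (3 / 2) / f N) ^ (-1 / 11)` over `h`. -/
theorem exists_block_sum_le {a : ℕ → ℂ} {k : ℕ} (ha : SeriesConditions a k) {f : ℝ → ℝ}
    (hf : PhaseConditions f) {ε : ℝ} (hε : 0 < ε) :
    ∃ c κ C : ℝ, 0 < c ∧ 0 < κ ∧ 0 < C ∧ ∀ m : ℕ, 1 ≤ m → ∀ N : ℝ, 1 ≤ N → √N ≤ f N →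
      f N ≤ N ^ (3 / 2 : ℝ) → 1 ≤ c * f N → ∀ X : ℝ, N ≤ X → X ≤ 2 * N →
        ∃ h : ℝ, κ ≤ h ∧ h ≤ N ∧ ∀ Y : ℝ, X ≤ Y → Y ≤ X + h → Y ≤ 2 * N →
          ‖∑ n ∈ Finset.Ioc ⌊X⌋₊ ⌊Y⌋₊, sqfreeCoprime a m n * expE (f n)‖ ≤
            C * m ^ ε * N ^ ε * (N ^ (3 / 2 : ℝ) / f N) ^ (-(1 / 11) : ℝ) * h := by
  obtain ⟨c, D, hc, hD, hb⟩ := hf.exists_bounds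
  set K := max 1 (12 * D / c) with hK
  have hK1 : 1 ≤ K := le_max_left _ _
  -- The exponent `8δ` is applied to a quantity of size `m N ^ 4`, since `q ≪ N`, `|τ| ≪ N ^ 2` and
  -- `x ≪ N`; hence the factor `32`.
  set δ := min ε 1 / 32 with hδ
  have hδ0 : 0 < δ := by have : 0 < min ε 1 := lt_min hε one_pos
                         positivity
  have hδ1 : δ ≤ 1 / 2 := by have : min ε 1 ≤ 1 := min_le_right _ _
                             linarith
  have hδε : 32 * δ ≤ ε := by have : min ε 1 ≤ ε := min_le_left _ _
                              linarith
  obtain ⟨C₁, hC₁, hC₁'⟩ := additive_twist_block_le ha hδ0 hδ1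
  obtain ⟨A, hA⟩ := ha.ramanujan ε hε
  have hA0 : 0 ≤ A := by
    have := hA 1 le_rfl
    rw [ha.coeff_one] at this
    simp at this
    linarith
  set L := 2 * K * (96 * D) * 2 with hL
  have hL0 : 0 < L := by positivity
  set G₁ := C₁ * L ^ (8 * δ) * (2 + 2 / c) * √(2 * K) with hG₁
  set G₂ := 2 * Real.pi * (1 + 13 * D) * (A * 2 ^ ε * (1 + √(2 * K))) with hG₂
  have hG₁0 : 0 < G₁ := by positivity
  have hG₂0 : 0 ≤ G₂ := by positivity
  have hsK : 0 < √(2 * K) := by positivity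
  refine ⟨c, (√(2 * K))⁻¹, G₁ + G₂, hc, by positivity, by positivity, ?_⟩
  intro m hm N hN hF1 hF2 hcF X hNX hXN
  have hm1 : (1 : ℝ) ≤ m := by exact_mod_cast hm
  have hN0 : 0 < N := by linarith
  have hX1 : 1 ≤ X := hN.trans hNX
  have hX0 : 0 < X := by linarith
  set F := f N with hF
  have hF0 : 0 < F := lt_of_lt_of_le (by positivity) hF1
  set R := (N ^ (3 / 2 : ℝ) / F) ^ (-(1 / 11) : ℝ) with hR
  obtain ⟨hR0, hR1, Q, hKQ, hQN, hQ⟩ := exists_block_length hK1 hN hF1 hF2 hR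
  obtain ⟨d1, d1'⟩ := hb N hN hF0 X hNX hXN 1 le_rfl (by norm_num)
  obtain ⟨d2, d2'⟩ := hb N hN hF0 X hNX hXN 2 (by norm_num) (by norm_num)
  rw [pow_one] at d1 d1'
  obtain ⟨b, q, hq1, hqQ, hbeta, hB1, hB2⟩ := exists_rational_approx hc hD hF0 hN0 hNX hXN d1 d1'
    d2 d2' ((le_max_right _ _).trans hKQ)
  obtain ⟨h, hh0, hhN, hh1, hh2, hh3, hh4⟩ := hQ q hq1 hqQ
  have hq0 : (0 : ℝ) < q := by exact_mod_cast hq1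
  have hqQ' : (q : ℝ) ≤ Q := by exact_mod_cast hqQ
  have hQ0 : (0 : ℝ) < Q := by linarith
  refine ⟨h, ?_, hhN, fun Y hXY hYh hYN => ?_⟩
  · rwa [inv_le_iff_one_le_mul₀' hsK]
  set B := X * (derivFromOne 1 f X - b / q) with hB
  set τ := 2 * Real.pi * B with hτ
  have hτabs : |τ| = 2 * Real.pi * |B| := by
    rw [hτ, abs_mul, abs_of_pos (by positivity)]
  have hpi3 := Real.pi_gt_three
  have hpi4 := Real.pi_le_four
  have hτ1 : c * F ≤ |τ| := by
    calc c * F = 2 * 1 * (c / 2 * F) := by ring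
      _ ≤ 2 * Real.pi * |B| := by gcongr; linarith
      _ = |τ| := hτabs.symm
  have hτ2 : |τ| ≤ 48 * D * F := by
    calc |τ| = 2 * Real.pi * |B| := hτabs
      _ ≤ 2 * 4 * (6 * D * F) := by gcongr
      _ = 48 * D * F := by ring
  have hτone : 1 ≤ |τ| := hcF.trans hτ1
  have hτ0 : 0 < |τ| := by linarith
  set ψ : ℝ → ℝ := fun x => f x - b / q * x - B * Real.log x with hψ
  set h' := Y - X with hh'
  have hh'0 : 0 ≤ h' := by rw [hh']; linarith
  have hh'h : h' ≤ h := by rw [hh']; linarith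
  have hXh' : X + h' = Y := by rw [hh']; ring
  have hphase : ∀ n ∈ Finset.Ioc ⌊X⌋₊ ⌊Y⌋₊, |ψ n - ψ X| ≤ (1 + 13 * D) * R := by
    intro n hn
    rw [Finset.mem_Ioc, Nat.floor_lt hX0.le, Nat.le_floor_iff (hX0.le.trans hXY)] at hn
    have h1 := phase_expansion hf.contDiff (A := b / q) (B := B) (T := D * (F / N ^ 3)) hX1 hh'0 hB
      (by
        intro x hx
        rw [hXh'] at hx
        exact (hb N hN hF0 x (hNX.trans hx.1) (hx.2.trans hYN) 3 (by norm_num) le_rfl).2)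
      (x := n) (by rw [hXh']; exact ⟨hn.1.le, hn.2⟩)
    refine h1.trans ?_
    have t1 : |derivFromOne 1 f X + X * derivFromOne 2 f X - b / q| / X * h' ^ 2 ≤ R := by
      calc _ ≤ 1 / (q * Q) / N * (N * q * Q * R) := by
            gcongr
            exact (pow_le_pow_left₀ hh'0 hh'h 2).trans hh2
        _ = R := by field_simp
    have t2 : (D * (F / N ^ 3) + 2 * |B| / X ^ 3) * h' ^ 3 ≤ 13 * D * R := by
      calc _ ≤ (D * (F / N ^ 3) + 2 * (6 * D * F) / N ^ 3) * h ^ 3 := by gcongr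
        _ = 13 * D * (h ^ 3 * F) / N ^ 3 := by ring
        _ ≤ 13 * D * (N ^ 3 * R) / N ^ 3 := by gcongr
        _ = _ := by field_simp
    linarith
  have hfactor : ∀ n ∈ Finset.Ioc ⌊X⌋₊ ⌊Y⌋₊,
      expE (f n) = expE (b * n / q) * (n : ℂ) ^ (τ * Complex.I) * expE (ψ n) := by
    intro n hn
    rw [Finset.mem_Ioc] at hn
    rw [hτ, ← expE_mul_log B (by omega), ← expE_add, ← expE_add, hψ]
    congr 1
    ring
  have hunit : ∀ n ∈ Finset.Ioc ⌊X⌋₊ ⌊Y⌋₊,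
      ‖expE (b * n / q) * (n : ℂ) ^ (τ * Complex.I)‖ = 1 := by
    intro n hn
    rw [Finset.mem_Ioc] at hn
    rw [norm_mul, norm_expE, norm_natCast_cpow_mul_I (by omega), mul_one]
  have main := norm_sum_mul_expE_le (sqfreeCoprime a m)
    (fun n => expE (b * n / q) * (n : ℂ) ^ (τ * Complex.I)) (fun n => f n) (fun n => ψ n) (ψ X)
    hfactor hunit hphase
  refine main.trans ?_
  have P1 : ‖∑ n ∈ Finset.Ioc ⌊X⌋₊ ⌊Y⌋₊, sqfreeCoprime a m n *
      (expE (b * n / q) * (n : ℂ) ^ (τ * Complex.I))‖ ≤ G₁ * (m ^ ε * N ^ ε) * (R * h) := by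
    have hF2' : F ≤ N ^ 2 := by
      refine hF2.trans ?_
      rw [← Real.rpow_natCast]
      exact Real.rpow_le_rpow_of_exponent_le hN (by norm_num)
    have hsize : q * (1 + |τ|) * (2 * N) ≤ L * N ^ 4 := by
      calc q * (1 + |τ|) * (2 * N) ≤ (2 * K * N) * (96 * D * N ^ 2) * (2 * N) := by
            have : 1 + |τ| ≤ 96 * D * N ^ 2 := by
              calc 1 + |τ| ≤ 2 * (48 * D * F) := by linarith
                _ ≤ 2 * (48 * D * N ^ 2) := by gcongr
                _ = _ := by ring
            have h2 : (q : ℝ) ≤ 2 * K * N := hqQ'.trans hQN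
            gcongr
        _ = _ := by rw [hL]; ring
    -- The low-height term is no larger than the main one because `|τ| ≥ c f(N) ≥ c √N`.
    have hend : √(2 * N) + 2 * N / |τ| ≤ (2 + 2 / c) * √N := by
      have e1 : √(2 * N) ≤ 2 * √N := by
        rw [Real.sqrt_le_left (by positivity), mul_pow, Real.sq_sqrt hN0.le]
        linarith
      have e2 : 2 * N / |τ| ≤ 2 / c * √N := by
        calc 2 * N / |τ| ≤ 2 * N / (c * √N) := by
              gcongr
              exact le_trans (by gcongr) hτ1
          _ = 2 / c * (N / √N) := by field_simp
          _ = _ := by rw [Real.div_sqrt]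
      linarith
    calc _ ≤ C₁ * (m * q * (1 + |τ|) * (2 * N)) ^ (8 * δ) * √q * (√(2 * N) + 2 * N / |τ|) :=
          hC₁' m hm q hq1 b τ N X Y hτone hX1 hXY hYN
      _ ≤ C₁ * (L ^ (8 * δ) * (m ^ ε * N ^ ε)) * √q * ((2 + 2 / c) * √N) := by
          gcongr
          exact four_mul_rpow_le hm1 hN hq0.le (by positivity) hL0 hsize hδ0.le hδε
      _ = C₁ * L ^ (8 * δ) * (2 + 2 / c) * (m ^ ε * N ^ ε) * (√q * √N) := by ring
      _ ≤ C₁ * L ^ (8 * δ) * (2 + 2 / c) * (m ^ ε * N ^ ε) * (√(2 * K) * (R * h)) := by gcongr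
      _ = _ := by rw [hG₁]; ring
  have P2 : 2 * Real.pi * ((1 + 13 * D) * R) *
      ∑ n ∈ Finset.Ioc ⌊X⌋₊ ⌊Y⌋₊, ‖sqfreeCoprime a m n‖ ≤ G₂ * (m ^ ε * N ^ ε) * (R * h) := by
    have e1 := sum_norm_sqfreeCoprime_le hA0 hε.le hA m hX0.le hXY hYN
    have e2 : Y - X + 1 ≤ (1 + √(2 * K)) * h := by
      rw [add_mul, one_mul]
      linarith
    have e3 : (2 * N) ^ ε = 2 ^ ε * N ^ ε := Real.mul_rpow (by norm_num) hN0.le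
    have e4 : 1 ≤ (m : ℝ) ^ ε := Real.one_le_rpow hm1 hε.le
    calc _ ≤ 2 * Real.pi * ((1 + 13 * D) * R) * (A * (2 ^ ε * N ^ ε) * ((1 + √(2 * K)) * h)) := by
          gcongr
          refine e1.trans ?_
          rw [e3]
          gcongr
      _ = G₂ * (1 * N ^ ε) * (R * h) := by rw [hG₂]; ring
      _ ≤ _ := by gcongr
  calc _ ≤ G₁ * (m ^ ε * N ^ ε) * (R * h) + G₂ * (m ^ ε * N ^ ε) * (R * h) := add_le_add P1 P2
    _ = _ := by ring

end BlockSum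

/-! ### Assembling the blocks -/

lemma sum_moebius_sq_eq (a : ℕ → ℂ) (m : ℕ) (w : ℕ → ℂ) (s : Finset ℕ) :
    ∑ n ∈ s with Nat.Coprime n m, ((ArithmeticFunction.moebius n : ℤ) : ℂ) ^ 2 * a n * w n =
      ∑ n ∈ s, sqfreeCoprime a m n * w n := by
  rw [Finset.sum_filter]
  refine Finset.sum_congr rfl fun n _ => ?_
  have h : ((ArithmeticFunction.moebius n : ℤ) : ℂ) ^ 2 = if Squarefree n then 1 else 0 := by
    exact_mod_cast congrArg (Int.cast (R := ℂ)) (ArithmeticFunction.moebius_sq (n := n))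
  rw [h, sqfreeCoprime]
  split_ifs <;> first | tauto | simp

theorem theorem2 (a : ℕ → ℂ) (k : ℕ) (ha : SeriesConditions a k)
    (f : ℝ → ℝ) (hf : PhaseConditions f) (η : ℝ) (hη : 0 < η) (ε : ℝ) (hε : 0 < ε) :
    ∃ C : ℝ, ∀ m : ℕ, 1 ≤ m → ∀ N N' : ℝ, 1 ≤ N → N < N' → N' ≤ 2 * N →
      N ^ (1 / 2 + η) ≤ f N → f N ≤ N ^ (3 / 2 - η) →
      ‖∑ n ∈ Finset.Ioc ⌊N⌋₊ ⌊N'⌋₊ with Nat.Coprime n m,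
          ((ArithmeticFunction.moebius n : ℤ) : ℂ) ^ 2 * a n * expE (f n)‖ ≤
        C * (m : ℝ) ^ ε * N ^ (19 / 22 + ε) * (f N) ^ (1 / 11 : ℝ) := by
  obtain ⟨c, κ, C, hc, hκ, hC, hblock⟩ := exists_block_sum_le ha hf hε
  obtain ⟨A, hA⟩ := ha.ramanujan ε hε
  have hA0 : 0 ≤ A := by
    have := hA 1 le_rfl
    rw [ha.coeff_one] at this
    simp at this
    linarith
  set C₂ := A * 2 ^ ε * (c⁻¹ ^ 2 + 1) with hC₂
  have hC₂0 : 0 ≤ C₂ := by positivity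
  refine ⟨2 * C + C₂, fun m hm N N' hN hNN' hN'2 hF1 hF2 => ?_⟩
  have hN0 : 0 < N := by linarith
  have hm1 : (1 : ℝ) ≤ m := by exact_mod_cast hm
  have hsF : √N ≤ f N := by
    refine le_trans ?_ hF1
    rw [Real.sqrt_eq_rpow]
    exact Real.rpow_le_rpow_of_exponent_le hN (by linarith)
  have hF32 : f N ≤ N ^ (3 / 2 : ℝ) :=
    hF2.trans (Real.rpow_le_rpow_of_exponent_le hN (by linarith))
  have hFone : 1 ≤ f N := (Real.one_le_sqrt.mpr hN).trans hsF
  have hF0 : 0 < f N := by linarith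
  set V := (m : ℝ) ^ ε * N ^ (19 / 22 + ε) * (f N) ^ (1 / 11 : ℝ) with hV
  have hV0 : 0 < V := by positivity
  suffices hs : ‖∑ n ∈ Finset.Ioc ⌊N⌋₊ ⌊N'⌋₊, sqfreeCoprime a m n * expE (f n)‖ ≤
      2 * C * V + C₂ * V by
    rw [sum_moebius_sq_eq a m (fun n => expE (f n))]
    calc _ ≤ _ := hs
      _ = _ := by rw [hV]; ring
  have hme : 1 ≤ (m : ℝ) ^ ε := Real.one_le_rpow hm1 hε.le
  -- The condition `c f(N) ≥ 1` ensures `|τ| ≥ 1` on every block. If it fails, `√N ≤ f(N) < 1 / c`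
  -- bounds `N`, and the trivial estimate is enough.
  rcases le_or_gt 1 (c * f N) with hcF | hcF
  · set R := (N ^ (3 / 2 : ℝ) / f N) ^ (-(1 / 11) : ℝ) with hR
    have hE : 0 ≤ C * m ^ ε * N ^ ε * R := by positivity
    have h1 := norm_sum_Ioc_le_of_blocks (G := fun n => sqfreeCoprime a m n * expE (f n))
      (N := N) (N' := N') (H := N) hκ hE hNN'.le (by
        intro X hX hX'
        obtain ⟨h, g1, g2, g3⟩ := hblock m hm N hN hsF hF32 hcF X hX (hX'.trans hN'2)
        exact ⟨h, g1, g2, fun Y y1 y2 y3 => g3 Y y1 y2 (y3.trans hN'2)⟩)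
    have h2 : C * m ^ ε * N ^ ε * R * (N' - N) + C * m ^ ε * N ^ ε * R * N ≤
        2 * (C * m ^ ε * N ^ ε * R * N) := by
      have : C * m ^ ε * N ^ ε * R * (N' - N) ≤ C * m ^ ε * N ^ ε * R * N := by
        gcongr
        linarith
      linarith
    -- The exponent of `N` is `1 - (3/2) (1/11) = 19/22`, and `f(N)` appears to the power `1/11`.
    have h3 : N ^ ε * R * N = N ^ (19 / 22 + ε) * (f N) ^ (1 / 11 : ℝ) := by
      rw [hR, Real.div_rpow (by positivity) hF0.le, ← Real.rpow_mul hN0.le, Real.rpow_neg hF0.le,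
        div_inv_eq_mul]
      have e : N ^ (19 / 22 + ε) = N ^ ε * N ^ (3 / 2 * -(1 / 11) : ℝ) * N := by
        rw [← Real.rpow_add hN0, ← Real.rpow_add_one hN0.ne']
        ring_nf
      rw [e]
      ring
    calc _ ≤ 2 * (C * m ^ ε * N ^ ε * R * N) := h1.trans h2
      _ = 2 * C * (m ^ ε * (N ^ ε * R * N)) := by ring
      _ = 2 * C * V := by rw [h3, hV]; ring
      _ ≤ _ := le_add_of_nonneg_right (by positivity)
  · have hNc : N ≤ c⁻¹ ^ 2 := by
      have h1 : √N ≤ c⁻¹ := by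
        refine hsF.trans ?_
        rw [← one_div, le_div_iff₀ hc]
        linarith
      calc N = √N ^ 2 := (Real.sq_sqrt hN0.le).symm
        _ ≤ _ := by gcongr
    have h1 : ‖∑ n ∈ Finset.Ioc ⌊N⌋₊ ⌊N'⌋₊, sqfreeCoprime a m n * expE (f n)‖ ≤
        A * (2 * N) ^ ε * (N' - N + 1) := by
      refine le_trans (norm_sum_le_of_le _ fun n _ => ?_)
        (sum_norm_sqfreeCoprime_le hA0 hε.le hA m hN0.le hNN'.le hN'2)
      rw [norm_mul, norm_expE, mul_one]
    have h2 : N ^ ε ≤ V := by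
      have e1 : N ^ ε ≤ N ^ (19 / 22 + ε) :=
        Real.rpow_le_rpow_of_exponent_le hN (by linarith)
      have e2 : 1 ≤ (f N) ^ (1 / 11 : ℝ) := Real.one_le_rpow hFone (by norm_num)
      calc N ^ ε = 1 * N ^ ε * 1 := by ring
        _ ≤ V := by rw [hV]; gcongr
    calc _ ≤ A * (2 * N) ^ ε * (N' - N + 1) := h1
      _ ≤ A * (2 ^ ε * N ^ ε) * (c⁻¹ ^ 2 + 1) := by
          rw [Real.mul_rpow (by norm_num) hN0.le]
          gcongr
          linarith
      _ = C₂ * N ^ ε := by rw [hC₂]; ring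
      _ ≤ C₂ * V := by gcongr
      _ ≤ _ := le_add_of_nonneg_left (by positivity)
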